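/- **Setting.** Let $\xi$ be a random variable and let $\hat f(x,y,\xi),\hat g(x,y,\xi)$ be real functions on $\mathbb R^{d_x}\times\mathbb R^{d_y}$, with $\hat f$ differentiable and $\hat g$ twice differentiable in $(x,y)$; put $f=\mathbb E\hat f$, $g=\mathbb E\hat g$, and assume $f$ differentiable and $g$ twice differentiable. Let $\partial_{yy}g$ be the Hessian of $g$ in $y$ and $\partial_{xy}g\in\mathbb R^{d_x\times d_y}$ the transposed Jacobian of $x\mapsto\partial_yg(x,y)$. Assume, for constants $0<\mu_g\le L_g$ and $L_g',L_f,M_g,B>0$ and for all arguments: 1. $g(x,\cdot)$ is $L_g$-smooth and $\mu_g$-strongly convex; $\kappa_g:=L_g/\mu_g$; 2. $\nabla f$ is $L_f$-Lipschitz and $\|\partial_yf\|\le B$; 3. $\partial_{xy}g$ and $\partial_{yy}g$ are $M_g$-Lipschitz in $(x,y)$ in operator norm, and $\|\partial_yg(x,y)-\partial_yg(x',y)\|\le L_g'\|x-x'\|$; 4. $\nabla\hat f,\partial_y\hat g,\partial_{xy}\hat g,\partial_{yy}\hat g$ are unbiased, with $\mathbb E\|\nabla\hat f-\nabla f\|^2\le\tilde\sigma_f^2$,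 $\mathbb E\|\partial_y\hat g-\partial_yg\|^2\le\tilde\sigma_g^2$, $\|\mathbb E[F_1^\top F_1]\|_{op}\le\tilde\sigma_{g_{xy}}^2$ and $\|\mathbb E[F_2^\top F_2]\|_{op}\le\tilde\sigma_{g_{yy}}^2$, where $F_1=\partial_{xy}\hat g-\partial_{xy}g$ and $F_2=\partial_{yy}\hat g-\partial_{yy}g$. Let $y^\star(x)=\arg\min_yg(x,y)$, let $z^\star(x,y)=\arg\min_z\{\frac12z^\top\partial_{yy}g(x,y)z+z^\top\partial_yf(x,y)\}$, and let $\mathcal L(x)=f(x,y^\star(x))$, which is assumed bounded below but not convex, with $\mathcal L^\star=\inf\mathcal L$. Put $$L=\big(L_f+\mu_g^{-2}L_g'M_gB+\mu_g^{-1}(L_g'L_f+M_gB)\big)\big(1+\mu_g^{-1}L_g'\big).$$ **Algorithm (AmIGO).** Given (possibly random) $x_0,y_{-1},z_{-1}$, independent of the samples below, do for $k=0,1,\dots$: - $y_k$ is the result of $T$ steps $y\leftarrow y-L_g^{-1}\partial_y\hat g(x_k,y,\mathcal D_g)$ from $y_{k-1}$; - $(u_k,v_k)=\nabla\hat f(x_k,y_k,\mathcal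 D_f)$; - $z_k$ is the result of $N$ steps $z\leftarrow z-(2L_g)^{-1}(\partial_{yy}\hat g(x_k,y_k,\mathcal D_{g_{yy}})z+v_k)$ from $z_{k-1}$; - $x_{k+1}=x_k-L^{-1}(u_k+\partial_{xy}\hat g(x_k,y_k,\mathcal D_{g_{xy}})z_k)$. Every step uses a new batch of i.i.d. copies of $\xi$, a batch argument denoting the average over the batch. Put $E_0^y=\mathbb E\|y_{-1}-y^\star(x_0)\|^2$, $E_0^z=\mathbb E\|z_{-1}-z^\star(x_0,y_0)\|^2$ and $\Delta=\mathbb E[\mathcal L(x_0)-\mathcal L^\star]+E_0^y+E_0^z$, all assumed finite. The complexity of $k$ iterations is the number of gradients, Jacobian- and Hessian-vector products used, $$\mathcal C=k\,(T|\mathcal D_g|+N|\mathcal D_{g_{yy}}|+|\mathcal D_{g_{xy}}|+|\mathcal D_f|).$$ **Claim.** For all $L_g,L_g',L_f,M_g,B,\epsilon_{\max}>0$ there is $c>0$ such that for every $c'\ge c$ there is $C>0$ for which the following holds, for all dimensions, all $\mu_g\in(0,L_g]$, all variances, all problems and initializations as above, and all $0<\epsilon\le\epsilon_{\max}$. Choose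 integers $T,N\in[c,c']\cdot\kappa_g(1+\log\kappa_g)$ and batch sizes $|\mathcal D|\ge1$ with $c\,q\le|\mathcal D|\le1+c'q$, where $q$ is, respectively, $$q_g=\frac{\kappa_g^5\tilde\sigma_g^2}{\epsilon},\quad q_{g_{yy}}=\frac{\kappa_g^3\tilde\sigma_{g_{yy}}^2}{\epsilon}(1\vee\epsilon\mu_g^2),\quad q_{g_{xy}}=\frac{\kappa_g^2\tilde\sigma_{g_{xy}}^2}{\epsilon},\quad q_f=\frac{\kappa_g^2\tilde\sigma_f^2}{\epsilon}.$$ Then $\mathcal L$ is differentiable and, for every integer $k\ge1$ with $k\ge c\,\kappa_g^3\Delta/\epsilon$, the $\|\nabla\mathcal L(x_i)\|^2$, $1\le i\le k$, are integrable and $$\frac1k\sum_{i=1}^k\mathbb E\|\nabla\mathcal L(x_i)\|^2\le\epsilon .$$ If moreover $k\le c'\kappa_g^3\Delta/\epsilon$ and $\epsilon\le c'\kappa_gS$, where $S=\kappa_g^4\tilde\sigma_g^2+\kappa_g^2(1\vee\epsilon\mu_g^2)\tilde\sigma_{g_{yy}}^2+\tilde\sigma_{g_{xy}}^2+\tilde\sigma_f^2$,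 then $$\mathcal C\le C\,(1+\log\kappa_g)\,\frac{\kappa_g^5}{\epsilon^2}\,S\,\Delta .$$ Thus the precision $\epsilon$ is reached with complexity of order $\epsilon^{-2}$, without a factor $\log(1/\epsilon)$. -/

import Mathlib

open MeasureTheory ProbabilityTheory
open scoped InnerProductSpace

noncomputable section

namespace Amigo

/-! ### Calculus in the two variables `x`, `y` -/

/-- The Euclidean space of dimension `d`. -/
abbrev Vec (d : ℕ) : Type := EuclideanSpace ℝ (Fin d)

variable {dx dy : ℕ}

/-- The Euclidean norm of the pair `(a, b)`. -/
def pairNorm (a : Vec dx) (b : Vec dy) : ℝ := Real.sqrt (‖a‖ ^ 2 + ‖b‖ ^ 2)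

/-- The partial gradient `∂ₓ h (x, y)`. -/
def gradX (h : Vec dx → Vec dy → ℝ) (x : Vec dx) (y : Vec dy) : Vec dx :=
  gradient (fun x' => h x' y) x

/-- The partial gradient `∂_y h (x, y)`. -/
def gradY (h : Vec dx → Vec dy → ℝ) (x : Vec dx) (y : Vec dy) : Vec dy :=
  gradient (fun y' => h x y') y

/-- The Hessian block `∂_yy h (x, y)`, the derivative of `∂_y h` with respect to `y`. -/
def hessYY (h : Vec dx → Vec dy → ℝ) (x : Vec dx) (y : Vec dy) : Vec dy →L[ℝ] Vec dy :=
  fderiv ℝ (fun y' => gradY h x y') y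

/-- The mixed block `∂_xy h (x, y)`, as the `dx × dy` matrix that acts on vectors `z` of the
inner space: it is the transpose of the Jacobian of `x ↦ ∂_y h (x, y)`, so that
`∂_xy h (x, y) z` is the gradient of `x ↦ ⟪∂_y h (x, y), z⟫`. -/
def jacXY (h : Vec dx → Vec dy → ℝ) (x : Vec dx) (y : Vec dy) : Vec dy →L[ℝ] Vec dx :=
  ContinuousLinearMap.adjoint (fderiv ℝ (fun x' => gradY h x' y) x)

/-- Joint (Fréchet) differentiability of a function of two variables. -/
def Diff (h : Vec dx → Vec dy → ℝ) : Prop :=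
  Differentiable ℝ (fun q : Vec dx × Vec dy => h q.1 q.2)

/-- Joint twice (Fréchet) differentiability of a function of two variables. -/
def TwiceDiff (h : Vec dx → Vec dy → ℝ) : Prop :=
  Diff h ∧ Differentiable ℝ (fderiv ℝ (fun q : Vec dx × Vec dy => h q.1 q.2))

/-- A global minimizer of `h` (an arbitrary point if there is none). -/
def argmin {d : ℕ} (h : Vec d → ℝ) : Vec d :=
  Classical.epsilon (fun v => IsMinOn h Set.univ v)

/-! ### The stochastic bilevel problem -/

/-- The data of a stochastic bilevel problem: the law of the noise variable `ξ` and the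
stochastic outer and inner costs. -/
structure Problem (dx dy : ℕ) (Ξ : Type*) [MeasurableSpace Ξ] where
  /-- the law of the noise variable -/
  law : Measure Ξ
  /-- the stochastic outer cost `f̂(x, y, ξ)` -/
  fhat : Ξ → Vec dx → Vec dy → ℝ
  /-- the stochastic inner cost `ĝ(x, y, ξ)` -/
  ghat : Ξ → Vec dx → Vec dy → ℝ

namespace Problem

variable {Ξ : Type*} [MeasurableSpace Ξ] (p : Problem dx dy Ξ)

/-- The outer cost `f(x, y) = E f̂(x, y, ξ)`. -/
def f (x : Vec dx) (y : Vec dy) : ℝ := ∫ ξ, p.fhat ξ x y ∂p.law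

/-- The inner cost `g(x, y) = E ĝ(x, y, ξ)`. -/
def g (x : Vec dx) (y : Vec dy) : ℝ := ∫ ξ, p.ghat ξ x y ∂p.law

/-- The inner solution `y⋆(x)`, the minimizer of `g(x, ·)`. -/
def yStar (x : Vec dx) : Vec dy := argmin (fun y => p.g x y)

/-- The quadratic cost `Q(x, y, z) = ½ zᵀ ∂_yy g(x, y) z + zᵀ ∂_y f(x, y)`. -/
def Q (x : Vec dx) (y z : Vec dy) : ℝ :=
  (1 / 2) * ⟪z, hessYY p.g x y z⟫_ℝ + ⟪z, gradY p.f x y⟫_ℝ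

/-- The adjoint solution `z⋆(x, y)`, the minimizer of `Q(x, y, ·)`. -/
def zStar (x : Vec dx) (y : Vec dy) : Vec dy := argmin (fun z => p.Q x y z)

/-- The bilevel objective `ℒ(x) = f(x, y⋆(x))`. -/
def loss (x : Vec dx) : ℝ := p.f x (p.yStar x)

/-- The infimum `ℒ⋆` of the bilevel objective. -/
def lossInf : ℝ := ⨅ x, p.loss x

/-- The standing assumptions on a stochastic bilevel problem: regularity of the costs and of
their stochastic versions, `L_g`-smoothness and `μ_g`-strong convexity of `g(x, ·)`, Lipschitz
conditions on the derivatives of `f` and `g`, and unbiasedness and bounded variance of the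
stochastic derivatives at one sample (the corresponding facts for a batch of `n` i.i.d. samples,
with variances divided by `n`, follow). -/
structure Assumptions (μg Lg Lg' Lf Mg B σf σg σgxy σgyy : ℝ) : Prop where
  prob : IsProbabilityMeasure p.law
  -- the stochastic costs are integrable random functions, and differentiable for every noise
  fhat_meas : ∀ x y, Measurable (fun ξ => p.fhat ξ x y)
  ghat_meas : ∀ x y, Measurable (fun ξ => p.ghat ξ x y)
  fhat_int : ∀ x y, Integrable (fun ξ => p.fhat ξ x y) p.law
  ghat_int : ∀ x y, Integrable (fun ξ => p.ghat ξ x y) p.law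
  fhat_diff : ∀ ξ, Diff (p.fhat ξ)
  ghat_diff : ∀ ξ, TwiceDiff (p.ghat ξ)
  f_diff : Diff p.f
  g_diff : TwiceDiff p.g
  -- the inner cost is strongly convex and smooth
  g_strong : ∀ x, StrongConvexOn Set.univ μg (fun y => p.g x y)
  g_smooth : ∀ x y y', ‖gradY p.g x y - gradY p.g x y'‖ ≤ Lg * ‖y - y'‖
  -- smoothness of the outer cost
  f_smooth : ∀ x x' y y',
    pairNorm (gradX p.f x y - gradX p.f x' y') (gradY p.f x y - gradY p.f x' y')
      ≤ Lf * pairNorm (x - x') (y - y')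
  f_bound : ∀ x y, ‖gradY p.f x y‖ ≤ B
  -- smoothness of the second derivatives of the inner cost
  g_jac : ∀ x x' y y', ‖jacXY p.g x y - jacXY p.g x' y'‖ ≤ Mg * pairNorm (x - x') (y - y')
  g_hess : ∀ x x' y y', ‖hessYY p.g x y - hessYY p.g x' y'‖ ≤ Mg * pairNorm (x - x') (y - y')
  g_cross : ∀ x x' y, ‖gradY p.g x y - gradY p.g x' y‖ ≤ Lg' * ‖x - x'‖
  -- unbiased first derivatives
  fx_int : ∀ x y, Integrable (fun ξ => gradX (p.fhat ξ) x y) p.law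
  fy_int : ∀ x y, Integrable (fun ξ => gradY (p.fhat ξ) x y) p.law
  gy_int : ∀ x y, Integrable (fun ξ => gradY (p.ghat ξ) x y) p.law
  fx_mean : ∀ x y, ∫ ξ, gradX (p.fhat ξ) x y ∂p.law = gradX p.f x y
  fy_mean : ∀ x y, ∫ ξ, gradY (p.fhat ξ) x y ∂p.law = gradY p.f x y
  gy_mean : ∀ x y, ∫ ξ, gradY (p.ghat ξ) x y ∂p.law = gradY p.g x y
  -- bounded variance of the first derivatives
  f_var_int : ∀ x y, Integrable (fun ξ => ‖gradX (p.fhat ξ) x y - gradX p.f x y‖ ^ 2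
    + ‖gradY (p.fhat ξ) x y - gradY p.f x y‖ ^ 2) p.law
  f_var : ∀ x y, ∫ ξ, (‖gradX (p.fhat ξ) x y - gradX p.f x y‖ ^ 2
    + ‖gradY (p.fhat ξ) x y - gradY p.f x y‖ ^ 2) ∂p.law ≤ σf ^ 2
  g_var_int : ∀ x y, Integrable (fun ξ => ‖gradY (p.ghat ξ) x y - gradY p.g x y‖ ^ 2) p.law
  g_var : ∀ x y, ∫ ξ, ‖gradY (p.ghat ξ) x y - gradY p.g x y‖ ^ 2 ∂p.law ≤ σg ^ 2
  -- unbiased second derivatives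
  gxy_int : ∀ x y, Integrable (fun ξ => jacXY (p.ghat ξ) x y) p.law
  gyy_int : ∀ x y, Integrable (fun ξ => hessYY (p.ghat ξ) x y) p.law
  gxy_mean : ∀ x y, ∫ ξ, jacXY (p.ghat ξ) x y ∂p.law = jacXY p.g x y
  gyy_mean : ∀ x y, ∫ ξ, hessYY (p.ghat ξ) x y ∂p.law = hessYY p.g x y
  -- bounded variance of the second derivatives: `‖E[Fᵀ F]‖ ≤ σ²` in operator norm
  gxy_var_int : ∀ x y, Integrable (fun ξ =>
    (ContinuousLinearMap.adjoint (jacXY (p.ghat ξ) x y - jacXY p.g x y)).comp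
      (jacXY (p.ghat ξ) x y - jacXY p.g x y)) p.law
  gxy_var : ∀ x y, ‖∫ ξ,
    (ContinuousLinearMap.adjoint (jacXY (p.ghat ξ) x y - jacXY p.g x y)).comp
      (jacXY (p.ghat ξ) x y - jacXY p.g x y) ∂p.law‖ ≤ σgxy ^ 2
  gyy_var_int : ∀ x y, Integrable (fun ξ =>
    (ContinuousLinearMap.adjoint (hessYY (p.ghat ξ) x y - hessYY p.g x y)).comp
      (hessYY (p.ghat ξ) x y - hessYY p.g x y)) p.law
  gyy_var : ∀ x y, ‖∫ ξ,
    (ContinuousLinearMap.adjoint (hessYY (p.ghat ξ) x y - hessYY p.g x y)).comp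
      (hessYY (p.ghat ξ) x y - hessYY p.g x y) ∂p.law‖ ≤ σgyy ^ 2

end Problem

/-- The smoothness constant `L` of the bilevel objective (its inverse is the outer step size). -/
def smoothConst (μg Lg' Lf Mg B : ℝ) : ℝ :=
  (Lf + μg⁻¹ ^ 2 * Lg' * Mg * B + μg⁻¹ * (Lg' * Lf + Mg * B)) * (1 + μg⁻¹ * Lg')

/-! ### The algorithm -/

/-- The parameters of AmIGO: numbers `T`, `N` of inner steps, batch sizes, step sizes. -/
structure Params where
  T : ℕ
  N : ℕ
  /-- batch size for `∂_y ĝ` -/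
  ng : ℕ
  /-- batch size for `∂_yy ĝ` -/
  ngyy : ℕ
  /-- batch size for `∂_xy ĝ` -/
  ngxy : ℕ
  /-- batch size for `∇ f̂` -/
  nf : ℕ
  /-- step size of the inner algorithm for `y` -/
  α : ℝ
  /-- step size of the inner algorithm for `z` -/
  β : ℝ
  /-- outer step size -/
  γ : ℝ

/-- The labels of the noise samples. The batches of the outer iteration `k` are
`(f k i)`, `i < nf`, for `∇ f̂`; `(gxy k i)`, `i < ngxy`, for `∂_xy ĝ`; for each inner step `t`,
`(g k t i)`, `i < ng`, for `∂_y ĝ`; for each inner step `n`, `(gyy k n i)`, `i < ngyy`,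
for `∂_yy ĝ`. -/
inductive Sample : Type
  | f (k i : ℕ)
  | g (k t i : ℕ)
  | gxy (k i : ℕ)
  | gyy (k n i : ℕ)

/-- The average over a batch of size `n`. -/
def batchAvg {V : Type*} [AddCommGroup V] [Module ℝ V] (n : ℕ) (F : ℕ → V) : V :=
  (n : ℝ)⁻¹ • ∑ i ∈ Finset.range n, F i

/-- The state `(x_k, y_{k-1}, z_{k-1})` of AmIGO at the start of the outer iteration `k`. -/
structure State (dx dy : ℕ) where
  x : Vec dx
  y : Vec dy
  z : Vec dy

variable {Ξ : Type*} [MeasurableSpace Ξ] (p : Problem dx dy Ξ) (a : Params)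

/-- The inner algorithm for `y`: the `t`-th iterate of stochastic gradient descent on `g(x, ·)`
from `y₀`, with the batches of the outer iteration `k`. -/
def algA (s : Sample → Ξ) (k : ℕ) (x : Vec dx) (y₀ : Vec dy) : ℕ → Vec dy
  | 0 => y₀
  | t + 1 => algA s k x y₀ t -
      a.α • batchAvg a.ng (fun i => gradY (p.ghat (s (.g k t i))) x (algA s k x y₀ t))

/-- The inner algorithm for `z`: the `n`-th iterate of stochastic gradient descent on
`Q(x, y, ·)` from `z₀`, with the batches of the outer iteration `k` and with `v` in the place of
`∂_y f(x, y)`. -/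
def algB (s : Sample → Ξ) (k : ℕ) (x : Vec dx) (y v z₀ : Vec dy) : ℕ → Vec dy
  | 0 => z₀
  | n + 1 => algB s k x y v z₀ n -
      a.β • (batchAvg a.ngyy (fun i => hessYY (p.ghat (s (.gyy k n i))) x y
        (algB s k x y v z₀ n)) + v)

/-- The outer iteration `k` of AmIGO, from `(x_k, y_{k-1}, z_{k-1})` to `(x_{k+1}, y_k, z_k)`. -/
def step (s : Sample → Ξ) (k : ℕ) (st : State dx dy) : State dx dy :=
  let x := st.x
  let y := algA p a s k x st.y a.T
  let u := batchAvg a.nf (fun i => gradX (p.fhat (s (.f k i))) x y)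
  let v := batchAvg a.nf (fun i => gradY (p.fhat (s (.f k i))) x y)
  let z := algB p a s k x y v st.z a.N
  let w := batchAvg a.ngxy (fun i => jacXY (p.ghat (s (.gxy k i))) x y z)
  { x := x - a.γ • (u + w), y := y, z := z }

/-- The states of AmIGO, for the noise samples `s` and the inputs `x₀, y₋₁, z₋₁`. -/
def run (s : Sample → Ξ) (init : State dx dy) : ℕ → State dx dy
  | 0 => init
  | k + 1 => step p a s k (run s init k)

/-- The complexity of `k` outer iterations: the total number of gradients, Jacobian-vector and
Hessian-vector products of the stochastic costs that are computed. -/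
def complexity (k : ℕ) : ℕ := k * (a.T * a.ng + a.N * a.ngyy + a.ngxy + a.nf)

/-! ### The random algorithm -/

variable {Ω : Type*} [MeasurableSpace Ω]

/-- The noise samples `ξ` are i.i.d. with the law of the problem, and independent of the
(possibly random) inputs `x₀, y₋₁, z₋₁`. -/
structure Sampling (P : Measure Ω) (ξ : Sample → Ω → Ξ) (init : Ω → State dx dy) : Prop where
  prob : IsProbabilityMeasure P
  meas : ∀ i, Measurable (ξ i)
  law : ∀ i, P.map (ξ i) = p.law
  indep : iIndepFun ξ P
  x_meas : Measurable (fun ω => (init ω).x)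
  y_meas : Measurable (fun ω => (init ω).y)
  z_meas : Measurable (fun ω => (init ω).z)
  init_indep : IndepFun (fun ω => ((init ω).x, (init ω).y, (init ω).z)) (fun ω i => ξ i ω) P

/-- The random state `(x_k, y_{k-1}, z_{k-1})` of AmIGO. -/
def runRV (ξ : Sample → Ω → Ξ) (init : Ω → State dx dy) (k : ℕ) (ω : Ω) : State dx dy :=
  run p a (fun i => ξ i ω) (init ω) k

/-- The squared initial error `‖y₋₁ - y⋆(x₀)‖²` of the inner problem. -/
def errY (init : Ω → State dx dy) (ω : Ω) : ℝ :=
  ‖(init ω).y - p.yStar (init ω).x‖ ^ 2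

/-- The squared initial error `‖z₋₁ - z⋆(x₀, y₀)‖²` of the linear system, where `y₀` is the
output of the first call of the inner algorithm for `y`. -/
def errZ (ξ : Sample → Ω → Ξ) (init : Ω → State dx dy) (ω : Ω) : ℝ :=
  ‖(init ω).z - p.zStar (init ω).x (runRV p a ξ init 1 ω).y‖ ^ 2

/-- The initial gap `E[ℒ(x₀) - ℒ⋆] + E₀^y + E₀^z`. -/
def initGap (P : Measure Ω) (ξ : Sample → Ω → Ξ) (init : Ω → State dx dy) : ℝ :=
  (∫ ω, (p.loss (init ω).x - p.lossInf) ∂P) + (∫ ω, errY p init ω ∂P)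
    + ∫ ω, errZ p a ξ init ω ∂P

/-- The noise level `κ⁴ σ_g² + κ² (1 ∨ ε μ_g²) σ_gyy² + σ_gxy² + σ_f²`. -/
def noiseLevel (κ ε μg σf σg σgxy σgyy : ℝ) : ℝ :=
  κ ^ 4 * σg ^ 2 + κ ^ 2 * max 1 (ε * μg ^ 2) * σgyy ^ 2 + σgxy ^ 2 + σf ^ 2

/-- The integer `n ≥ 1` is of order `q`, up to rounding, with constants `c ≤ c'`. -/
def BatchOrder (c c' q : ℝ) (n : ℕ) : Prop := 1 ≤ n ∧ c * q ≤ n ∧ (n : ℝ) ≤ 1 + c' * q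

/-- The integer `n` is of order `q`, with constants `c ≤ c'`. -/
def IsOrder (c c' q : ℝ) (n : ℕ) : Prop := c * q ≤ n ∧ (n : ℝ) ≤ c' * q

end Amigo

end

/-! Let h_k be the mean of ‖∇ℒ(x_k)‖² and e_k the mean squared distance from the direction u_k + w_k
of the outer step to ∇ℒ(x_k). With step 1/L, the descent lemma and polarization give, for any
direction, biased or not, E ℒ(x_{k+1}) ≤ E ℒ(x_k) - h_k/(2L) + e_k/(2L). So it is enough to bound ∑
e_k by a small multiple of ∑ h_k, a term in the initial errors, and a noise floor of order ε per
iteration.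

The error e_k is at most a constant times W_k + S. Here W_k is κ⁴ E‖y_k - y⋆‖² + E‖z_k - z⋆‖², with
the weight κ⁴ because the hypergradient has a Lipschitz constant of order κ² in y. The level S = ε/c
bounds the four batch variances once they are multiplied by the powers of κ with which they enter;
the batch sizes are chosen for this.

Each inner loop multiplies its squared error by a factor at most ρ, up to a floor of order S. By
warm start, the error at the beginning of a loop is controlled by the error at the end of the
preceding one and by the displacement of y⋆ and z⋆. These are Lipschitz, so the displacement is
controlled by ‖x_{k+1} - x_k‖², hence by h_k + e_k, and for z⋆ also by the inner errors of y. This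
gives W_{k+1} ≤ η (W_k + h_k + S) + O(S) with η of order κ⁶ρ (`inner_error_recursion`). With κ(1 +
log κ) inner steps, ρ is a large negative power of κ, and η is small uniformly in κ
(`pow_mul_exp_le`). The inner errors need only be small relative to the gradients, which the descent
pays for, so the number of inner steps does not depend on ε and no log(1/ε) appears. Summation and
absorption are done in `sum_sq_gradient_le`.

Two further ingredients carry the argument. The gradient of ℒ is the hypergradient at y⋆(x), with
Lipschitz constant L of order κ³ (`hasGradientAt_loss`, `norm_hyperGrad_yStar_sub_le`). A batch
independent of the current state adds only its variance to a second moment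
(`Sampling.integral_sq_norm_add_batch_le`). -/

noncomputable section

namespace Amigo

/-! ### Convex analysis: strong convexity, descent lemma, gradient contractions -/

section Analysis

variable {E : Type*} [NormedAddCommGroup E] [InnerProductSpace ℝ E]

/-- First-order characterization of strong convexity. -/
theorem strongConvexOn_le_add [CompleteSpace E] {h : E → ℝ} {m : ℝ}
    (hh : StrongConvexOn Set.univ m h) {x g : E} (hg : HasGradientAt h g x) (y : E) :
    h x + ⟪g, y - x⟫_ℝ + m / 2 * ‖y - x‖ ^ 2 ≤ h y := by
  have h1 : HasDerivAt (fun t : ℝ => h (x + t • (y - x))) ⟪g, y - x⟫_ℝ 0 := by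
    have hl : HasDerivAt (fun t : ℝ => x + t • (y - x)) (y - x) 0 := by
      simpa using ((hasDerivAt_id (0 : ℝ)).smul_const (y - x)).const_add x
    have hf : HasFDerivAt h (InnerProductSpace.toDual ℝ E g) (x + (0 : ℝ) • (y - x)) := by
      simpa using hg.hasFDerivAt
    exact (hf.comp_hasDerivAt (0 : ℝ) hl).congr_deriv (by simp)
  have h2 := h1.tendsto_slope_zero_right
  have h3 : Filter.Tendsto (fun t : ℝ => h y - h x - (1 - t) * (m / 2 * ‖y - x‖ ^ 2))
      (nhdsWithin 0 (Set.Ioi 0)) (nhds (h y - h x - (1 - 0) * (m / 2 * ‖y - x‖ ^ 2))) := by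
    apply Filter.Tendsto.mono_left _ nhdsWithin_le_nhds
    apply Continuous.tendsto
    fun_prop
  -- Strong convexity at (1 - t)x + ty bounds the slope at t ∈ (0, 1); the claim is the limit t →
  -- 0⁺.
  have h4 := le_of_tendsto_of_tendsto h2 h3 (by
    have : Set.Ioo (0 : ℝ) 1 ∈ nhdsWithin (0 : ℝ) (Set.Ioi 0) := Ioo_mem_nhdsGT one_pos
    filter_upwards [this] with t ht
    have := hh.2 (Set.mem_univ x) (Set.mem_univ y) (by linarith [ht.2] : 0 ≤ 1 - t) ht.1.le
        (by ring)
    have e : (1 - t) • x + t • y = x + t • (y - x) := by module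
    rw [e] at this
    simp only [smul_eq_mul, zero_add, zero_smul, add_zero] at this ⊢
    rw [norm_sub_rev x y] at this
    rw [inv_mul_le_iff₀ ht.1]
    linarith)
  linarith

theorem strongConvexOn_inner_gradient [CompleteSpace E] {h : E → ℝ} {m : ℝ}
    (hh : StrongConvexOn Set.univ m h) {x y g g' : E} (hg : HasGradientAt h g x)
    (hg' : HasGradientAt h g' y) : m * ‖x - y‖ ^ 2 ≤ ⟪g - g', x - y⟫_ℝ := by
  have h1 := strongConvexOn_le_add hh hg y
  have h2 := strongConvexOn_le_add hh hg' x
  rw [← neg_sub x y, inner_neg_right, norm_neg] at h1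
  rw [inner_sub_left]
  linarith

theorem exists_isMinOn_of_strongConvexOn [FiniteDimensional ℝ E] {h : E → ℝ} {m : ℝ} (hm : 0 < m)
    (hh : StrongConvexOn Set.univ m h) (hd : Differentiable ℝ h) :
    ∃ x, IsMinOn h Set.univ x := by
  have hc : Filter.Tendsto h (Filter.cocompact E) Filter.atTop := by
    have h0 := strongConvexOn_le_add hh (hd 0).hasGradientAt
    set g := gradient h 0
    -- The quadratic lower bound at the origin makes h coercive, and a continuous coercive function
    -- attains its minimum.
    have h1 : ∀ y, h 0 + ‖y‖ * (m / 2 * ‖y‖ - ‖g‖) ≤ h y := by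
      intro y
      have := h0 y
      have h2 := neg_le_of_abs_le (abs_real_inner_le_norm g y)
      simp only [sub_zero] at this
      nlinarith
    refine Filter.tendsto_atTop_mono h1 ?_
    have hn := tendsto_norm_cocompact_atTop (E := E)
    apply Filter.tendsto_atTop_add_const_left
    apply Filter.Tendsto.atTop_mul_atTop₀ hn
    apply Filter.tendsto_atTop_add_const_right
    exact hn.const_mul_atTop (by positivity)
  obtain ⟨x, hx⟩ := hd.continuous.exists_forall_le hc
  exact ⟨x, fun y _ => hx y⟩

/-- The descent lemma. -/
theorem le_add_inner_add_sq_of_lipschitz_gradient [CompleteSpace E] {h : E → ℝ} {G : E → E} {K : ℝ}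
    (hG : ∀ x, HasGradientAt h (G x) x) (hL : ∀ x y, ‖G x - G y‖ ≤ K * ‖x - y‖) (x v : E) :
    h (x + v) ≤ h x + ⟪G x, v⟫_ℝ + K / 2 * ‖v‖ ^ 2 := by
  -- The Lipschitz bound makes the derivative of φ nonpositive on (0, 1), and the claim is φ 1 ≤ φ
  -- 0.
  set φ : ℝ → ℝ := fun t => h (x + t • v) - t * ⟪G x, v⟫_ℝ - K / 2 * t ^ 2 * ‖v‖ ^ 2
  have hφ : ∀ t, HasDerivAt φ (⟪G (x + t • v), v⟫_ℝ - ⟪G x, v⟫_ℝ - K * t * ‖v‖ ^ 2) t := by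
    intro t
    have hl : HasDerivAt (fun t : ℝ => x + t • v) v t := by
      simpa using ((hasDerivAt_id t).smul_const v).const_add x
    have h1 := (hG (x + t • v)).hasFDerivAt.comp_hasDerivAt t hl
    have h2 := (hasDerivAt_id t).mul_const ⟪G x, v⟫_ℝ
    have h3 := (((hasDerivAt_id t).pow 2).const_mul (K / 2)).mul_const (‖v‖ ^ 2)
    refine ((h1.sub h2).sub h3).congr_deriv ?_
    have e : InnerProductSpace.toDual ℝ E (G (x + t • v)) v = ⟪G (x + t • v), v⟫_ℝ := by simp
    rw [e]
    simp only [id, Nat.cast_ofNat, Nat.add_one_sub_one, pow_one]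
    ring
  have hanti : AntitoneOn φ (Set.Icc 0 1) := by
    apply antitoneOn_of_deriv_nonpos (convex_Icc 0 1)
    · exact fun t _ => (hφ t).continuousAt.continuousWithinAt
    · exact fun t _ => (hφ t).differentiableAt.differentiableWithinAt
    · intro t ht
      rw [interior_Icc] at ht
      rw [(hφ t).deriv]
      have h1 : ⟪G (x + t • v) - G x, v⟫_ℝ ≤ ‖G (x + t • v) - G x‖ * ‖v‖ := real_inner_le_norm _ _
      have h2 := hL (x + t • v) x
      rw [add_sub_cancel_left, norm_smul, Real.norm_of_nonneg ht.1.le] at h2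
      rw [inner_sub_left] at h1
      nlinarith [norm_nonneg v]
  have := hanti (Set.left_mem_Icc.2 zero_le_one) (Set.right_mem_Icc.2 zero_le_one) zero_le_one
  simp only [φ] at this
  simp at this
  linarith

/-- A gradient step of length 1/K lowers h by at least ‖G x‖²/(2K) and cannot go below b. This makes
the squared gradients integrable as soon as the optimality gap is. -/
theorem sq_norm_gradient_le [CompleteSpace E] {h : E → ℝ} {G : E → E} {K b : ℝ} (hK : 0 < K)
    (hG : ∀ x, HasGradientAt h (G x) x) (hL : ∀ x y, ‖G x - G y‖ ≤ K * ‖x - y‖)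
    (hb : ∀ x, b ≤ h x) (x : E) : ‖G x‖ ^ 2 ≤ 2 * K * (h x - b) := by
  have h1 := le_add_inner_add_sq_of_lipschitz_gradient hG hL x (-(K⁻¹ • G x))
  have h2 := hb (x + -(K⁻¹ • G x))
  rw [inner_neg_right, norm_neg, inner_smul_right, norm_smul, Real.norm_of_nonneg (by positivity),
    real_inner_self_eq_norm_sq] at h1
  have h3 : K / 2 * (K⁻¹ * ‖G x‖) ^ 2 = K⁻¹ * ‖G x‖ ^ 2 / 2 := by field_simp
  have h4 : K⁻¹ * ‖G x‖ ^ 2 ≤ 2 * (h x - b) := by linarith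
  rw [inv_mul_le_iff₀ hK] at h4
  linarith

/-- Cauchy-Schwarz bound for a positive semidefinite symmetric operator. -/
theorem norm_apply_le_of_posSemidef {T : E →L[ℝ] E} {c : ℝ}
    (hs : ∀ v w, ⟪T v, w⟫_ℝ = ⟪v, T w⟫_ℝ) (h0 : ∀ v, 0 ≤ ⟪T v, v⟫_ℝ)
    (h1 : ∀ v, ⟪T v, v⟫_ℝ ≤ c * ‖v‖ ^ 2) (hc : 0 ≤ c) (v : E) : ‖T v‖ ≤ c * ‖v‖ := by
  have key : ⟪T v, T v⟫_ℝ ^ 2 ≤ ⟪T v, v⟫_ℝ * ⟪T (T v), T v⟫_ℝ := by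
    -- The form of T at v + t T v is a nonnegative quadratic polynomial in t, so its discriminant is
    -- nonpositive.
    have hq : ∀ t : ℝ, 0 ≤ ⟪T (T v), T v⟫_ℝ * (t * t) + 2 * ⟪T v, T v⟫_ℝ * t + ⟪T v, v⟫_ℝ := by
      intro t
      have := h0 (v + t • T v)
      simp only [map_add, map_smul, inner_add_left, inner_add_right, inner_smul_left,
        inner_smul_right, RCLike.conj_to_real] at this
      rw [hs (T v) v] at this
      linarith
    have := discrim_le_zero hq
    simp only [discrim] at this
    linarith
  rw [real_inner_self_eq_norm_sq] at key
  have h2 := h1 v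
  have h3 := h1 (T v)
  have h4 : (‖T v‖ ^ 2) ^ 2 ≤ (c * ‖v‖) ^ 2 * ‖T v‖ ^ 2 := by
    calc _ ≤ _ := key
      _ ≤ (c * ‖v‖ ^ 2) * (c * ‖T v‖ ^ 2) := mul_le_mul h2 h3 (h0 _) (by positivity)
      _ = _ := by ring
  rcases (norm_nonneg (T v)).eq_or_lt with h5 | h5
  · rw [← h5]; positivity
  · have h6 : ‖T v‖ ^ 2 ≤ (c * ‖v‖) ^ 2 := by
      have : 0 < ‖T v‖ ^ 2 := by positivity
      nlinarith
    exact le_of_sq_le_sq h6 (by positivity)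

/-- A gradient step on a quadratic with curvature in `[m, K]` is a contraction. -/
theorem norm_sub_smul_apply_le {H : E →L[ℝ] E} {m K b : ℝ}
    (hs : ∀ v w, ⟪H v, w⟫_ℝ = ⟪v, H w⟫_ℝ) (h0 : ∀ v, m * ‖v‖ ^ 2 ≤ ⟪H v, v⟫_ℝ)
    (h1 : ∀ v, ‖H v‖ ≤ K * ‖v‖) (hb : 0 ≤ b) (hbK : b * K ≤ 1) (hbm : b * m ≤ 1) (v : E) :
    ‖v - b • H v‖ ≤ (1 - b * m) * ‖v‖ := by
  -- The operator I - bH is positive semidefinite since bK ≤ 1, and its form is at most 1 - bm by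
  -- the lower curvature bound.
  have := norm_apply_le_of_posSemidef (T := ContinuousLinearMap.id ℝ E - b • H) (c := 1 - b * m)
    (fun v w => by simp [inner_sub_left, inner_sub_right, inner_smul_left, inner_smul_right, hs])
    (fun v => by
      simp only [sub_apply, ContinuousLinearMap.id_apply,
        smul_apply, inner_sub_left, inner_smul_left, RCLike.conj_to_real,
        real_inner_self_eq_norm_sq]
      have h2 := real_inner_le_norm (H v) v
      have h3 := h1 v
      have h4 : ⟪H v, v⟫_ℝ ≤ K * ‖v‖ ^ 2 := by nlinarith [norm_nonneg v]
      nlinarith [mul_le_mul_of_nonneg_left h4 hb, sq_nonneg ‖v‖])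
    (fun v => by
      simp only [sub_apply, ContinuousLinearMap.id_apply,
        smul_apply, inner_sub_left, inner_smul_left, RCLike.conj_to_real,
        real_inner_self_eq_norm_sq]
      nlinarith [mul_le_mul_of_nonneg_left (h0 v) hb])
    (by linarith) v
  simpa using this

end Analysis

/-! ### Partial derivatives of functions of two variables -/

section Pair

variable {dx dy : ℕ}

theorem pairNorm_nonneg (a : Vec dx) (b : Vec dy) : 0 ≤ pairNorm a b := Real.sqrt_nonneg _

theorem sq_pairNorm (a : Vec dx) (b : Vec dy) : pairNorm a b ^ 2 = ‖a‖ ^ 2 + ‖b‖ ^ 2 :=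
  Real.sq_sqrt (by positivity)

theorem norm_le_pairNorm_left (a : Vec dx) (b : Vec dy) : ‖a‖ ≤ pairNorm a b :=
  Real.le_sqrt_of_sq_le (by nlinarith [sq_nonneg ‖b‖])

theorem norm_le_pairNorm_right (a : Vec dx) (b : Vec dy) : ‖b‖ ≤ pairNorm a b :=
  Real.le_sqrt_of_sq_le (by nlinarith [sq_nonneg ‖a‖])

theorem pairNorm_le_add (a : Vec dx) (b : Vec dy) : pairNorm a b ≤ ‖a‖ + ‖b‖ :=
  Real.sqrt_le_iff.2 ⟨by positivity, by nlinarith [mul_nonneg (norm_nonneg a) (norm_nonneg b)]⟩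

theorem pairNorm_zero_left (b : Vec dy) : pairNorm (0 : Vec dx) b = ‖b‖ := by
  simp [pairNorm]

variable {h : Vec dx → Vec dy → ℝ}

theorem Diff.hasFDerivAt (hh : Diff h) (x : Vec dx) (y : Vec dy) :
    HasFDerivAt (fun q : Vec dx × Vec dy => h q.1 q.2)
      (fderiv ℝ (fun q : Vec dx × Vec dy => h q.1 q.2) (x, y)) (x, y) :=
  (hh (x, y)).hasFDerivAt

theorem Diff.differentiable_left (hh : Diff h) (y : Vec dy) :
    Differentiable ℝ (fun x => h x y) := fun x =>
  (HasFDerivAt.comp (f := fun x' => (x', y)) x (hh.hasFDerivAt x y)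
    (hasFDerivAt_prodMk_left x y)).differentiableAt

theorem Diff.differentiable_right (hh : Diff h) (x : Vec dx) :
    Differentiable ℝ (fun y => h x y) := fun y =>
  ((hh.hasFDerivAt x y).comp y (hasFDerivAt_prodMk_right x y)).differentiableAt

theorem Diff.hasGradientAt_gradX (hh : Diff h) (x : Vec dx) (y : Vec dy) :
    HasGradientAt (fun x' => h x' y) (gradX h x y) x :=
  (hh.differentiable_left y x).hasGradientAt

theorem Diff.hasGradientAt_gradY (hh : Diff h) (x : Vec dx) (y : Vec dy) :
    HasGradientAt (fun y' => h x y') (gradY h x y) y :=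
  (hh.differentiable_right x y).hasGradientAt

theorem Diff.fderiv_apply (hh : Diff h) (x : Vec dx) (y : Vec dy) (u : Vec dx) (w : Vec dy) :
    fderiv ℝ (fun q : Vec dx × Vec dy => h q.1 q.2) (x, y) (u, w)
      = ⟪gradX h x y, u⟫_ℝ + ⟪gradY h x y, w⟫_ℝ := by
  have h1 := (hh.hasFDerivAt x y).comp x (hasFDerivAt_prodMk_left (𝕜 := ℝ) x y)
  have h2 := (hh.hasFDerivAt x y).comp y (hasFDerivAt_prodMk_right (𝕜 := ℝ) x y)
  have e1 := DFunLike.congr_fun (h1.unique (hh.hasGradientAt_gradX x y).hasFDerivAt) u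
  have e2 := DFunLike.congr_fun (h2.unique (hh.hasGradientAt_gradY x y).hasFDerivAt) w
  simp at e1 e2
  rw [← e1, ← e2, ← map_add]
  simp

theorem Diff.gradY_eq (hh : Diff h) (x : Vec dx) (y : Vec dy) :
    gradY h x y = (InnerProductSpace.toDual ℝ (Vec dy)).symm
      ((fderiv ℝ (fun q : Vec dx × Vec dy => h q.1 q.2) (x, y)).comp
        (ContinuousLinearMap.inr ℝ (Vec dx) (Vec dy))) := by
  rw [LinearIsometryEquiv.eq_symm_apply]
  ext w
  simp [hh.fderiv_apply]

theorem TwiceDiff.differentiable_gradY (hh : TwiceDiff h) :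
    Differentiable ℝ (fun q : Vec dx × Vec dy => gradY h q.1 q.2) := by
  have e : (fun q : Vec dx × Vec dy => gradY h q.1 q.2) = fun q : Vec dx × Vec dy =>
      (InnerProductSpace.toDual ℝ (Vec dy)).symm
      ((fderiv ℝ (fun q : Vec dx × Vec dy => h q.1 q.2) q).comp
        (ContinuousLinearMap.inr ℝ (Vec dx) (Vec dy))) := by
    ext1 q
    exact hh.1.gradY_eq q.1 q.2
  rw [e]
  have h2 := hh.2
  have hT : Differentiable ℝ (fun T : (Vec dx × Vec dy) →L[ℝ] ℝ =>
      (InnerProductSpace.toDual ℝ (Vec dy)).symm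
        (T.comp (ContinuousLinearMap.inr ℝ (Vec dx) (Vec dy)))) := by
    have h3 : Differentiable ℝ (fun T : (Vec dx × Vec dy) →L[ℝ] ℝ =>
      (T.comp (ContinuousLinearMap.inr ℝ (Vec dx) (Vec dy)))) := by fun_prop
    exact ((InnerProductSpace.toDual ℝ (Vec dy)).symm
        |>.toContinuousLinearEquiv.toContinuousLinearMap.differentiable).comp h3
  exact hT.comp h2

theorem TwiceDiff.hasFDerivAt_hessYY (hh : TwiceDiff h) (x : Vec dx) (y : Vec dy) :
    HasFDerivAt (fun y' => gradY h x y') (hessYY h x y) y := by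
  have : DifferentiableAt ℝ (fun y' => gradY h x y') y :=
    ((hh.differentiable_gradY (x, y)).hasFDerivAt.comp y
      (hasFDerivAt_prodMk_right x y)).differentiableAt
  exact this.hasFDerivAt

/-- The derivative of `x ↦ ∂_y h (x, y)`, of which `jacXY` is the transpose. -/
theorem TwiceDiff.hasFDerivAt_adjoint_jacXY (hh : TwiceDiff h) (x : Vec dx) (y : Vec dy) :
    HasFDerivAt (fun x' => gradY h x' y) (ContinuousLinearMap.adjoint (jacXY h x y)) x := by
  have : DifferentiableAt ℝ (fun x' => gradY h x' y) x :=
    (HasFDerivAt.comp (f := fun x' => (x', y)) x (hh.differentiable_gradY (x, y)).hasFDerivAt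
      (hasFDerivAt_prodMk_left x y)).differentiableAt
  rw [jacXY, ContinuousLinearMap.adjoint_adjoint]
  exact this.hasFDerivAt

/-- Symmetry of the second derivative needs only twice differentiability, not continuity of the
Hessian. -/
theorem TwiceDiff.hessYY_symm (hh : TwiceDiff h) (x : Vec dx) (y v w : Vec dy) :
    ⟪hessYY h x y v, w⟫_ℝ = ⟪v, hessYY h x y w⟫_ℝ := by
  have h1 : ∀ y', HasFDerivAt (fun y' => h x y')
      (InnerProductSpace.toDual ℝ (Vec dy) (gradY h x y')) y' :=
    fun y' => (hh.1.hasGradientAt_gradY x y').hasFDerivAt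
  have h2 : HasFDerivAt (fun y' => InnerProductSpace.toDual ℝ (Vec dy) (gradY h x y'))
      (((InnerProductSpace.toDual ℝ (Vec dy)).toContinuousLinearEquiv.toContinuousLinearMap).comp
        (hessYY h x y)) y :=
    ((InnerProductSpace.toDual ℝ (Vec dy))
        |>.toContinuousLinearEquiv.toContinuousLinearMap.hasFDerivAt).comp
      y (hh.hasFDerivAt_hessYY x y)
  have := second_derivative_symmetric h1 h2 v w
  simpa [real_inner_comm v] using this

end Pair

theorem TwiceDiff.fderiv_gradY_apply {dx dy : ℕ} {h : Vec dx → Vec dy → ℝ} (hh : TwiceDiff h)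
    (x : Vec dx) (y : Vec dy) (u : Vec dx) (w : Vec dy) :
    fderiv ℝ (fun q : Vec dx × Vec dy => gradY h q.1 q.2) (x, y) (u, w)
      = ContinuousLinearMap.adjoint (jacXY h x y) u + hessYY h x y w := by
  have h0 := (hh.differentiable_gradY (x, y)).hasFDerivAt
  have h1 := HasFDerivAt.comp (f := fun x' => (x', y)) x h0 (hasFDerivAt_prodMk_left x y)
  have h2 := h0.comp y (hasFDerivAt_prodMk_right (𝕜 := ℝ) x y)
  have e1 := DFunLike.congr_fun (h1.unique (hh.hasFDerivAt_adjoint_jacXY x y)) u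
  have e2 := DFunLike.congr_fun (h2.unique (hh.hasFDerivAt_hessYY x y)) w
  rw [← e1, ← e2]
  simp only [ContinuousLinearMap.comp_apply, ContinuousLinearMap.inl_apply,
    ContinuousLinearMap.inr_apply, ← map_add]
  simp

theorem argmin_isMinOn {d : ℕ} {h : Vec d → ℝ} (hh : ∃ v, IsMinOn h Set.univ v) :
    IsMinOn h Set.univ (argmin h) :=
  Classical.epsilon_spec hh

/-! ### Deterministic bilevel estimates: y⋆, z⋆, the hypergradient -/

namespace Problem

variable {dx dy : ℕ} {Ξ : Type*} [MeasurableSpace Ξ] {p : Problem dx dy Ξ}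
  {μg Lg Lg' Lf Mg B σf σg σgxy σgyy : ℝ}

theorem Assumptions.gradY_yStar (A : p.Assumptions μg Lg Lg' Lf Mg B σf σg σgxy σgyy) (hμ : 0 < μg)
    (x : Vec dx) : gradY p.g x (p.yStar x) = 0 := by
  have hm : IsMinOn (fun y => p.g x y) Set.univ (p.yStar x) := argmin_isMinOn
    (exists_isMinOn_of_strongConvexOn hμ (A.g_strong x) (A.g_diff.1.differentiable_right x))
  have h1 : IsLocalMin (fun y => p.g x y) (p.yStar x) := hm.isLocalMin Filter.univ_mem
  have := h1.hasFDerivAt_eq_zero (A.g_diff.1.hasGradientAt_gradY x (p.yStar x)).hasFDerivAt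
  simpa using this

theorem Assumptions.inner_gradY_sub (A : p.Assumptions μg Lg Lg' Lf Mg B σf σg σgxy σgyy)
    (x : Vec dx) (y y' : Vec dy) :
    μg * ‖y - y'‖ ^ 2 ≤ ⟪gradY p.g x y - gradY p.g x y', y - y'⟫_ℝ :=
  strongConvexOn_inner_gradient (A.g_strong x) (A.g_diff.1.hasGradientAt_gradY x y)
    (A.g_diff.1.hasGradientAt_gradY x y')

/-- Strong monotonicity of ∂_y g(x, ·) between y⋆(x) and y⋆(x'): the first gradient vanishes, and
the second has norm at most Lg'‖x - x'‖ because ∂_y g(x', y⋆(x')) = 0. -/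
theorem Assumptions.norm_yStar_sub_le (A : p.Assumptions μg Lg Lg' Lf Mg B σf σg σgxy σgyy)
    (hμ : 0 < μg) (x x' : Vec dx) : ‖p.yStar x - p.yStar x'‖ ≤ μg⁻¹ * Lg' * ‖x - x'‖ := by
  have h1 := A.inner_gradY_sub x (p.yStar x) (p.yStar x')
  have h2 := A.g_cross x' x (p.yStar x')
  rw [A.gradY_yStar hμ x] at h1
  rw [A.gradY_yStar hμ x', norm_sub_rev x' x] at h2
  have h3 := real_inner_le_norm (0 - gradY p.g x (p.yStar x')) (p.yStar x - p.yStar x')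
  rcases (norm_nonneg (p.yStar x - p.yStar x')).eq_or_lt with h5 | h5
  · rw [← h5, mul_assoc]
    exact mul_nonneg (by positivity) ((norm_nonneg _).trans h2)
  · rw [mul_assoc, ← div_eq_inv_mul, le_div_iff₀ hμ]
    have : μg * ‖p.yStar x - p.yStar x'‖ * ‖p.yStar x - p.yStar x'‖
        ≤ Lg' * ‖x - x'‖ * ‖p.yStar x - p.yStar x'‖ := by
      nlinarith
    linarith [le_of_mul_le_mul_right this h5]

theorem Assumptions.inner_hessYY (A : p.Assumptions μg Lg Lg' Lf Mg B σf σg σgxy σgyy)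
    (x : Vec dx) (y v : Vec dy) : μg * ‖v‖ ^ 2 ≤ ⟪hessYY p.g x y v, v⟫_ℝ := by
  have hl : HasDerivAt (fun t : ℝ => y + t • v) v 0 := by
    simpa using ((hasDerivAt_id (0 : ℝ)).smul_const v).const_add y
  have hf : HasFDerivAt (fun y' => gradY p.g x y') (hessYY p.g x y) (y + (0 : ℝ) • v) := by
    simpa using A.g_diff.hasFDerivAt_hessYY x y
  have h1 := (hf.comp_hasDerivAt (0 : ℝ) hl).tendsto_slope_zero_right
  have h2 := Filter.Tendsto.inner (𝕜 := ℝ) h1 (tendsto_const_nhds (x := v))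
  refine ge_of_tendsto h2 ?_
  filter_upwards [self_mem_nhdsWithin] with t ht
  rw [Set.mem_Ioi] at ht
  have := A.inner_gradY_sub x (y + t • v) y
  simp only [Function.comp, zero_add, zero_smul, add_zero, inner_smul_left, RCLike.conj_to_real]
  rw [add_sub_cancel_left, inner_smul_right, norm_smul, Real.norm_of_nonneg ht.le] at this
  rw [← div_eq_inv_mul, le_div_iff₀ ht]
  have h3 : t * (μg * ‖v‖ ^ 2 * t) ≤ t * ⟪gradY p.g x (y + t • v) - gradY p.g x y, v⟫_ℝ := by
    linarith
  exact le_of_mul_le_mul_left h3 ht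

theorem Assumptions.norm_hessYY_le (A : p.Assumptions μg Lg Lg' Lf Mg B σf σg σgxy σgyy)
    (hL : 0 ≤ Lg) (x : Vec dx) (y : Vec dy) : ‖hessYY p.g x y‖ ≤ Lg :=
  (A.g_diff.hasFDerivAt_hessYY x y).le_of_lip' hL
    (Filter.Eventually.of_forall fun y' => A.g_smooth x y' y)

theorem Assumptions.norm_jacXY_le (A : p.Assumptions μg Lg Lg' Lf Mg B σf σg σgxy σgyy)
    (hL : 0 ≤ Lg') (x : Vec dx) (y : Vec dy) : ‖jacXY p.g x y‖ ≤ Lg' := by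
  have := (A.g_diff.hasFDerivAt_adjoint_jacXY x y).le_of_lip' hL
    (Filter.Eventually.of_forall fun x' => A.g_cross x' x y)
  rwa [LinearIsometryEquiv.norm_map] at this

theorem Assumptions.norm_le_norm_hessYY (A : p.Assumptions μg Lg Lg' Lf Mg B σf σg σgxy σgyy)
    (hμ : 0 < μg) (x : Vec dx) (y v : Vec dy) : ‖v‖ ≤ μg⁻¹ * ‖hessYY p.g x y v‖ := by
  have h1 := A.inner_hessYY x y v
  have h2 := real_inner_le_norm (hessYY p.g x y v) v
  rw [← div_eq_inv_mul, le_div_iff₀ hμ]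
  rcases (norm_nonneg v).eq_or_lt with h5 | h5
  · rw [← h5]; simp
  · refine le_of_mul_le_mul_right ?_ h5
    nlinarith

/-- The Hessian is injective, hence surjective in finite dimension, so the linear system has a
solution z. Completing the square around z shows that z minimizes Q and that every minimizer equals
z; the first fact is needed for `argmin` to return a minimizer at all. -/
theorem Assumptions.hessYY_zStar (A : p.Assumptions μg Lg Lg' Lf Mg B σf σg σgxy σgyy)
    (hμ : 0 < μg) (x : Vec dx) (y : Vec dy) :
    hessYY p.g x y (p.zStar x y) = -gradY p.f x y := by
  have hinj : Function.Injective (hessYY p.g x y).toLinearMap := by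
    rw [injective_iff_map_eq_zero]
    intro v hv
    have := A.norm_le_norm_hessYY hμ x y v
    rw [ContinuousLinearMap.coe_coe] at hv
    rw [hv, norm_zero, mul_zero] at this
    exact norm_le_zero_iff.1 this
  obtain ⟨z, hz⟩ := LinearMap.injective_iff_surjective.1 hinj (-gradY p.f x y)
  rw [ContinuousLinearMap.coe_coe] at hz
  have key : ∀ w, p.Q x y w = p.Q x y z + (1 / 2) * ⟪hessYY p.g x y (w - z), w - z⟫_ℝ := by
    intro w
    have hv : gradY p.f x y = -hessYY p.g x y z := by rw [hz, neg_neg]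
    have h1 := A.g_diff.hessYY_symm x y z w
    have h2 := A.g_diff.hessYY_symm x y w w
    have h3 := A.g_diff.hessYY_symm x y z z
    have h4 := A.g_diff.hessYY_symm x y w z
    have h5 := real_inner_comm w (hessYY p.g x y z)
    simp only [Q, hv, map_sub, inner_sub_left, inner_sub_right, inner_neg_right]
    linarith
  have hpos : ∀ w, 0 ≤ ⟪hessYY p.g x y w, w⟫_ℝ := fun w =>
    le_trans (by positivity) (A.inner_hessYY x y w)
  have hmin : IsMinOn (fun w => p.Q x y w) Set.univ (p.zStar x y) := argmin_isMinOn
    ⟨z, fun w _ => by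
      simp only [Set.mem_ofPred_eq]
      rw [key w]
      linarith [hpos (w - z)]⟩
  have h1 : p.Q x y (p.zStar x y) ≤ p.Q x y z := hmin (Set.mem_univ z)
  rw [key (p.zStar x y)] at h1
  have h2 := A.inner_hessYY x y (p.zStar x y - z)
  have h3 : ‖p.zStar x y - z‖ ^ 2 ≤ 0 := by nlinarith
  have h4 : p.zStar x y - z = 0 := by
    rw [← norm_eq_zero]
    exact pow_eq_zero_iff two_ne_zero |>.1 (le_antisymm h3 (by positivity))
  rw [sub_eq_zero.1 h4, hz]

theorem Assumptions.norm_zStar_le (A : p.Assumptions μg Lg Lg' Lf Mg B σf σg σgxy σgyy)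
    (hμ : 0 < μg) (x : Vec dx) (y : Vec dy) : ‖p.zStar x y‖ ≤ μg⁻¹ * B := by
  refine (A.norm_le_norm_hessYY hμ x y _).trans ?_
  rw [A.hessYY_zStar hμ, norm_neg]
  exact mul_le_mul_of_nonneg_left (A.f_bound x y) (by positivity)

theorem Assumptions.norm_gradY_f_sub_le (A : p.Assumptions μg Lg Lg' Lf Mg B σf σg σgxy σgyy)
    (x x' : Vec dx) (y y' : Vec dy) :
    ‖gradY p.f x y - gradY p.f x' y'‖ ≤ Lf * pairNorm (x - x') (y - y') :=
  (norm_le_pairNorm_right _ _).trans (A.f_smooth x x' y y')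

theorem Assumptions.norm_gradX_f_sub_le (A : p.Assumptions μg Lg Lg' Lf Mg B σf σg σgxy σgyy)
    (x x' : Vec dx) (y y' : Vec dy) :
    ‖gradX p.f x y - gradX p.f x' y'‖ ≤ Lf * pairNorm (x - x') (y - y') :=
  (norm_le_pairNorm_left _ _).trans (A.f_smooth x x' y y')

/-- Subtracting the two linear systems, the Hessian at (x, y) maps z⋆ - z⋆' to a difference of ∂_y f
plus a difference of Hessians applied to z⋆', where ‖z⋆'‖ ≤ B/μ. -/
theorem Assumptions.norm_zStar_sub_le (A : p.Assumptions μg Lg Lg' Lf Mg B σf σg σgxy σgyy)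
    (hμ : 0 < μg) (x x' : Vec dx) (y y' : Vec dy) :
    ‖p.zStar x y - p.zStar x' y'‖ ≤ μg⁻¹ * (Lf + Mg * (μg⁻¹ * B)) * pairNorm (x - x') (y - y') := by
  refine (A.norm_le_norm_hessYY hμ x y _).trans ?_
  rw [mul_assoc]
  refine mul_le_mul_of_nonneg_left ?_ (by positivity)
  have e : hessYY p.g x y (p.zStar x y - p.zStar x' y') = -(gradY p.f x y - gradY p.f x' y')
      - (hessYY p.g x y - hessYY p.g x' y') (p.zStar x' y') := by
    rw [map_sub, sub_apply, A.hessYY_zStar hμ x y, A.hessYY_zStar hμ x' y']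
    abel
  rw [e, add_mul]
  refine (norm_sub_le _ _).trans (add_le_add ?_ ?_)
  · rw [norm_neg]
    exact A.norm_gradY_f_sub_le x x' y y'
  · refine (ContinuousLinearMap.le_opNorm _ _).trans ?_
    have := mul_le_mul (A.g_hess x x' y y') (A.norm_zStar_le hμ x' y') (norm_nonneg _)
      ((norm_nonneg _).trans (A.g_hess x x' y y'))
    linarith

variable (p) in
/-- The approximate hypergradient `∂ₓ f + ∂_xy g z⋆` at `(x, y)`. -/
def hyperGrad (x : Vec dx) (y : Vec dy) : Vec dx :=
  gradX p.f x y + jacXY p.g x y (p.zStar x y)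

variable (μg Lg' Lf Mg B) in
/-- The Lipschitz constant of the approximate hypergradient. -/
def hyperConst : ℝ := Lf + μg⁻¹ ^ 2 * Lg' * Mg * B + μg⁻¹ * (Lg' * Lf + Mg * B)

/-- Used twice: along y = y⋆(x) for the smoothness of ℒ, and at fixed x to turn the inner error of y
into an error of the hypergradient. -/
theorem Assumptions.norm_hyperGrad_sub_le (A : p.Assumptions μg Lg Lg' Lf Mg B σf σg σgxy σgyy)
    (hμ : 0 < μg) (hL : 0 ≤ Lg') (x x' : Vec dx) (y y' : Vec dy) :
    ‖p.hyperGrad x y - p.hyperGrad x' y'‖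
      ≤ hyperConst μg Lg' Lf Mg B * pairNorm (x - x') (y - y') := by
  have e : p.hyperGrad x y - p.hyperGrad x' y' = (gradX p.f x y - gradX p.f x' y')
      + ((jacXY p.g x y - jacXY p.g x' y') (p.zStar x y)
        + jacXY p.g x' y' (p.zStar x y - p.zStar x' y')) := by
    simp only [hyperGrad, map_sub, sub_apply]
    abel
  rw [e]
  have h1 := A.norm_gradX_f_sub_le x x' y y'
  have h2 := ((jacXY p.g x y - jacXY p.g x' y').le_opNorm (p.zStar x y)).trans
    (mul_le_mul (A.g_jac x x' y y') (A.norm_zStar_le hμ x y) (norm_nonneg _)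
      ((norm_nonneg _).trans (A.g_jac x x' y y')))
  have h3 := ((jacXY p.g x' y').le_opNorm (p.zStar x y - p.zStar x' y')).trans
    (mul_le_mul (A.norm_jacXY_le hL x' y') (A.norm_zStar_sub_le hμ x x' y y') (norm_nonneg _) hL)
  refine (norm_add_le _ _).trans ((add_le_add_right (norm_add_le _ _) _).trans ?_)
  rw [hyperConst]
  linarith

/-- Differentiability of y⋆ is not needed, only its Lipschitz bound. Both f and ∂_y g are expanded
to first order at (x, y⋆(x)) along the curve x' ↦ (x', y⋆(x')), with remainders o(‖x' - x‖). Since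
∂_y g vanishes on the curve, pairing its expansion with z⋆ trades the term in ∂_y f and y⋆(x') -
y⋆(x) for one in x' - x. -/
theorem Assumptions.hasGradientAt_loss (A : p.Assumptions μg Lg Lg' Lf Mg B σf σg σgxy σgyy)
    (hμ : 0 < μg) (x : Vec dx) : HasGradientAt p.loss (p.hyperGrad x (p.yStar x)) x := by
  rw [hasGradientAt_iff_isLittleO]
  have hlip := A.norm_yStar_sub_le hμ
  have hO : (fun x' => ((x', p.yStar x') : Vec dx × Vec dy) - (x, p.yStar x))
      =O[nhds x] fun x' => x' - x := by
    refine Asymptotics.IsBigO.of_bound (max 1 (μg⁻¹ * Lg'))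
      (Filter.Eventually.of_forall fun x' => ?_)
    rw [Prod.norm_def]
    refine max_le ?_ ?_
    · exact le_mul_of_one_le_left (norm_nonneg _) (le_max_left _ _)
    · exact (hlip x' x).trans (mul_le_mul_of_nonneg_right (le_max_right _ _) (norm_nonneg _))
  have hT : Filter.Tendsto (fun x' => (x', p.yStar x')) (nhds x) (nhds (x, p.yStar x)) := by
    rw [← tendsto_sub_nhds_zero_iff]
    exact hO.trans_tendsto (tendsto_sub_nhds_zero_iff.2 Filter.tendsto_id)
  have hF := ((A.f_diff.hasFDerivAt x (p.yStar x)).isLittleO.comp_tendsto hT).trans_isBigO hO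
  have hG := ((A.g_diff.differentiable_gradY (x, p.yStar x)).hasFDerivAt.isLittleO.comp_tendsto
    hT).trans_isBigO hO
  have hz : (fun x' => ⟪p.zStar x (p.yStar x), gradY p.g x' (p.yStar x') - gradY p.g x (p.yStar x) -
      fderiv ℝ (fun q : Vec dx × Vec dy => gradY p.g q.1 q.2) (x, p.yStar x)
        ((x', p.yStar x') - (x, p.yStar x))⟫_ℝ) =o[nhds x] fun x' => x' - x :=
    ((innerSL ℝ (p.zStar x (p.yStar x))).isBigO_comp _ _).trans_isLittleO hG
  refine (hF.add hz).congr_left fun x' => ?_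
  simp only [Function.comp, loss, A.gradY_yStar hμ, Prod.mk_sub_mk, A.f_diff.fderiv_apply,
    A.g_diff.fderiv_gradY_apply, hyperGrad, inner_add_left, inner_add_right, inner_sub_right,
    inner_zero_right, ContinuousLinearMap.adjoint_inner_right]
  have h1 := A.hessYY_zStar hμ x (p.yStar x)
  have h2 := A.g_diff.hessYY_symm x (p.yStar x) (p.zStar x (p.yStar x)) (p.yStar x' - p.yStar x)
  rw [h1, inner_neg_left] at h2
  simp only [inner_sub_right, map_sub] at h2 ⊢
  linarith

theorem Assumptions.norm_hyperGrad_yStar_sub_le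
    (A : p.Assumptions μg Lg Lg' Lf Mg B σf σg σgxy σgyy) (hμ : 0 < μg) (hL : 0 ≤ Lg')
    (hc : 0 ≤ hyperConst μg Lg' Lf Mg B) (x x' : Vec dx) :
    ‖p.hyperGrad x (p.yStar x) - p.hyperGrad x' (p.yStar x')‖
      ≤ smoothConst μg Lg' Lf Mg B * ‖x - x'‖ := by
  refine (A.norm_hyperGrad_sub_le hμ hL _ _ _ _).trans ?_
  have e : smoothConst μg Lg' Lf Mg B = hyperConst μg Lg' Lf Mg B * (1 + μg⁻¹ * Lg') := rfl
  rw [e, mul_assoc]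
  refine mul_le_mul_of_nonneg_left ?_ hc
  have := A.norm_yStar_sub_le hμ x x'
  linarith [pairNorm_le_add (x - x') (p.yStar x - p.yStar x')]

/-- The step map has y⋆(x) as a fixed point and derivative I - Lg⁻¹ ∂_yy g, of norm at most 1 -
μ/L_g; the mean value inequality gives the contraction. -/
theorem Assumptions.norm_gradient_step_sub_yStar_le
    (A : p.Assumptions μg Lg Lg' Lf Mg B σf σg σgxy σgyy) (hμ : 0 < μg) (hL : 0 < Lg)
    (hμL : μg ≤ Lg) (x : Vec dx) (y : Vec dy) :
    ‖y - Lg⁻¹ • gradY p.g x y - p.yStar x‖ ≤ (1 - Lg⁻¹ * μg) * ‖y - p.yStar x‖ := by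
  have hs : Lg⁻¹ * μg ≤ 1 := by rwa [inv_mul_le_iff₀ hL, mul_one]
  have h1 : ∀ y' ∈ (Set.univ : Set (Vec dy)), HasFDerivWithinAt
      (fun y' => y' - Lg⁻¹ • gradY p.g x y')
      (ContinuousLinearMap.id ℝ _ - Lg⁻¹ • hessYY p.g x y') Set.univ y' := fun y' _ =>
    ((hasFDerivAt_id y').fun_sub
      ((A.g_diff.hasFDerivAt_hessYY x y').fun_const_smul _)).hasFDerivWithinAt
  have h2 : ∀ y' ∈ (Set.univ : Set (Vec dy)),
      ‖ContinuousLinearMap.id ℝ _ - Lg⁻¹ • hessYY p.g x y'‖ ≤ 1 - Lg⁻¹ * μg := fun y' _ =>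
    ContinuousLinearMap.opNorm_le_bound _ (by linarith) fun v =>
      norm_sub_smul_apply_le (A.g_diff.hessYY_symm x y') (A.inner_hessYY x y')
        (fun v => (ContinuousLinearMap.le_opNorm _ v).trans
          (mul_le_mul_of_nonneg_right (A.norm_hessYY_le hL.le x y') (norm_nonneg _)))
        (by positivity) (by rw [inv_mul_cancel₀ hL.ne']) hs v
  have := convex_univ.norm_image_sub_le_of_norm_hasFDerivWithin_le h1 h2
    (Set.mem_univ (p.yStar x)) (Set.mem_univ y)
  simpa [A.gradY_yStar hμ] using this

theorem Assumptions.norm_sub_smul_hessYY_le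
    (A : p.Assumptions μg Lg Lg' Lf Mg B σf σg σgxy σgyy) (hL : 0 < Lg)
    (hμL : μg ≤ Lg) (x : Vec dx) (y v : Vec dy) :
    ‖v - (2 * Lg)⁻¹ • hessYY p.g x y v‖ ≤ (1 - (2 * Lg)⁻¹ * μg) * ‖v‖ :=
  norm_sub_smul_apply_le (A.g_diff.hessYY_symm x y) (A.inner_hessYY x y)
    (fun v => (ContinuousLinearMap.le_opNorm _ v).trans
      (mul_le_mul_of_nonneg_right (A.norm_hessYY_le hL.le x y) (norm_nonneg _)))
    (by positivity) (by rw [inv_mul_le_iff₀ (by positivity)]; linarith)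
    (by rw [inv_mul_le_iff₀ (by positivity)]; linarith) v

end Problem

/-! ### Measurability of stochastic derivatives at random points -/

section Measurability

variable {dx dy : ℕ} {Ω : Type*} [mΩ : MeasurableSpace Ω] {Ξ : Type*} [MeasurableSpace Ξ]

theorem measurable_of_measurable_inner {d : ℕ} {F : Ω → Vec d}
    (h : ∀ w, Measurable (fun ω => ⟪F ω, w⟫_ℝ)) : Measurable F := by
  have e : F = fun ω => ∑ i, ⟪F ω, EuclideanSpace.basisFun (Fin d) ℝ i⟫_ℝ •
      EuclideanSpace.basisFun (Fin d) ℝ i := by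
    ext1 ω
    conv_lhs => rw [← (EuclideanSpace.basisFun (Fin d) ℝ).sum_repr' (F ω)]
    simp only [real_inner_comm]
  rw [e]
  exact Finset.measurable_sum _ fun i _ => (h _).smul_const _

/-- The directional derivatives of a measurable family of functions are measurable. -/
theorem measurable_fderiv_apply_of_measurable_comp {V W : Type*} [NormedAddCommGroup V]
    [NormedSpace ℝ V] [MeasurableSpace V] [BorelSpace V] [SecondCountableTopology V]
    [NormedAddCommGroup W] [NormedSpace ℝ W] [MeasurableSpace W] [BorelSpace W]
    [SecondCountableTopology W] {F : Ω → V → W} {F' : Ω → V →L[ℝ] W} {Z v : Ω → V}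
    (hF : ∀ ω, HasFDerivAt (F ω) (F' ω) (Z ω)) (hZ : Measurable Z) (hv : Measurable v)
    (hm : ∀ Z' : Ω → V, Measurable Z' → Measurable (fun ω => F ω (Z' ω))) :
    Measurable (fun ω => F' ω (v ω)) := by
  -- The directional derivative is the limit of difference quotients with step 1/n. These only
  -- evaluate F at measurable random points, so measurability of F' as an operator is never
  -- required.
  refine measurable_of_tendsto_metrizable (f := fun (n : ℕ) ω =>
    (n : ℝ) • (F ω (Z ω + (n : ℝ)⁻¹ • v ω) - F ω (Z ω))) (fun n => ?_) ?_
  · exact ((hm _ (hZ.add (hv.const_smul _))).sub (hm _ hZ)).const_smul _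
  · rw [tendsto_pi_nhds]
    intro ω
    refine (hF ω).lim (v ω) ?_
    simpa using tendsto_natCast_atTop_atTop (R := ℝ)

variable {h : Ξ → Vec dx → Vec dy → ℝ} {ξ : Ω → Ξ} {X : Ω → Vec dx} {Y : Ω → Vec dy}

/-- A Carathéodory function, continuous in (x, y) and measurable in ξ, is jointly measurable. -/
theorem measurable_eval_of_diff (hd : ∀ ξ, Diff (h ξ)) (hm : ∀ x y, Measurable (fun ξ => h ξ x y))
    (hξ : Measurable ξ) (hX : Measurable X) (hY : Measurable Y) :
    Measurable (fun ω => h (ξ ω) (X ω) (Y ω)) := by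
  have h1 : Measurable (Function.uncurry fun (q : Vec dx × Vec dy) (ξ : Ξ) => h ξ q.1 q.2) :=
    measurable_uncurry_of_continuous_of_measurable (fun ξ => (hd ξ).continuous)
      (fun q => hm q.1 q.2)
  exact h1.comp ((hX.prodMk hY).prodMk hξ)

theorem measurable_gradX (hd : ∀ ξ, Diff (h ξ)) (hm : ∀ x y, Measurable (fun ξ => h ξ x y))
    (hξ : Measurable ξ) (hX : Measurable X) (hY : Measurable Y) :
    Measurable (fun ω => gradX (h (ξ ω)) (X ω) (Y ω)) := by
  refine measurable_of_measurable_inner fun w => ?_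
  have := measurable_fderiv_apply_of_measurable_comp
    (fun ω => ((hd (ξ ω)).hasGradientAt_gradX (X ω) (Y ω)).hasFDerivAt) hX
    (measurable_const (a := w)) (fun Z hZ => measurable_eval_of_diff hd hm hξ hZ hY)
  simpa using this

theorem measurable_gradY (hd : ∀ ξ, Diff (h ξ)) (hm : ∀ x y, Measurable (fun ξ => h ξ x y))
    (hξ : Measurable ξ) (hX : Measurable X) (hY : Measurable Y) :
    Measurable (fun ω => gradY (h (ξ ω)) (X ω) (Y ω)) := by
  refine measurable_of_measurable_inner fun w => ?_
  have := measurable_fderiv_apply_of_measurable_comp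
    (fun ω => ((hd (ξ ω)).hasGradientAt_gradY (X ω) (Y ω)).hasFDerivAt) hY
    (measurable_const (a := w)) (fun Z hZ => measurable_eval_of_diff hd hm hξ hX hZ)
  simpa using this

theorem measurable_hessYY_apply (hd : ∀ ξ, TwiceDiff (h ξ))
    (hm : ∀ x y, Measurable (fun ξ => h ξ x y)) (hξ : Measurable ξ) (hX : Measurable X)
    (hY : Measurable Y) {Z : Ω → Vec dy} (hZ : Measurable Z) :
    Measurable (fun ω => hessYY (h (ξ ω)) (X ω) (Y ω) (Z ω)) :=
  measurable_fderiv_apply_of_measurable_comp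
    (fun ω => (hd (ξ ω)).hasFDerivAt_hessYY (X ω) (Y ω)) hY hZ
    (fun _ hY' => measurable_gradY (fun ξ => (hd ξ).1) hm hξ hX hY')

/-- Tested against a fixed w, the product becomes the inner product of Z with the derivative of x ↦
∂_y h in direction w, a limit of difference quotients. -/
theorem measurable_jacXY_apply (hd : ∀ ξ, TwiceDiff (h ξ))
    (hm : ∀ x y, Measurable (fun ξ => h ξ x y)) (hξ : Measurable ξ) (hX : Measurable X)
    (hY : Measurable Y) {Z : Ω → Vec dy} (hZ : Measurable Z) :
    Measurable (fun ω => jacXY (h (ξ ω)) (X ω) (Y ω) (Z ω)) := by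
  refine measurable_of_measurable_inner fun w => ?_
  have := measurable_fderiv_apply_of_measurable_comp
    (fun ω => (hd (ξ ω)).hasFDerivAt_adjoint_jacXY (X ω) (Y ω)) hX (measurable_const (a := w))
    (fun _ hX' => measurable_gradY (fun ξ => (hd ξ).1) hm hξ hX' hY)
  have h2 := Measurable.inner (𝕜 := ℝ) hZ this
  simpa only [ContinuousLinearMap.adjoint_inner_right] using h2

theorem continuous_of_norm_sub_le_pairNorm {V : Type*} [NormedAddCommGroup V]
    {F : Vec dx → Vec dy → V} {C : ℝ}
    (hF : ∀ x x' y y', ‖F x y - F x' y'‖ ≤ C * pairNorm (x - x') (y - y')) :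
    Continuous (fun q : Vec dx × Vec dy => F q.1 q.2) := by
  refine (LipschitzWith.of_dist_le_mul (K := C.toNNReal * 2) fun q q' => ?_).continuous
  rw [dist_eq_norm, dist_eq_norm]
  refine (hF _ _ _ _).trans ?_
  have h1 : C ≤ C.toNNReal := Real.le_coe_toNNReal C
  have h2 := pairNorm_le_add (q.1 - q'.1) (q.2 - q'.2)
  have h3 := norm_fst_le (q - q')
  have h4 := norm_snd_le (q - q')
  simp only [Prod.fst_sub, Prod.snd_sub] at h3 h4
  have h5 := mul_le_mul h1 (by linarith : pairNorm (q.1 - q'.1) (q.2 - q'.2) ≤ 2 * ‖q - q'‖)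
    (pairNorm_nonneg _ _) C.toNNReal.2
  push_cast
  linarith

theorem measurable_comp_of_norm_sub_le_pairNorm {d : ℕ} {F : Vec dx → Vec dy → Vec d} {C : ℝ}
    (hF : ∀ x x' y y', ‖F x y - F x' y'‖ ≤ C * pairNorm (x - x') (y - y'))
    (hX : Measurable X) (hY : Measurable Y) : Measurable (fun ω => F (X ω) (Y ω)) := by
  have h1 := (continuous_of_norm_sub_le_pairNorm hF).measurable
  exact h1.comp (hX.prodMk hY)

theorem measurable_batchAvg {d : ℕ} {F : ℕ → Ω → Vec d} {n : ℕ}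
    (hF : ∀ i, Measurable (F i)) : Measurable (fun ω => batchAvg n (fun i => F i ω)) := by
  have h1 : Measurable (fun ω => ∑ i ∈ Finset.range n, F i ω) :=
    Finset.measurable_fun_sum _ fun i _ => hF i
  exact h1.fun_const_smul ((n : ℝ)⁻¹)

end Measurability

/-! ### Measurability of the solution maps and of the inner loops -/

namespace Problem

variable {dx dy : ℕ} {Ξ : Type*} [MeasurableSpace Ξ] {p : Problem dx dy Ξ}
  {μg Lg Lg' Lf Mg B σf σg σgxy σgyy : ℝ} {Ω : Type*} [mΩ : MeasurableSpace Ω]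
  {X : Ω → Vec dx} {Y Z : Ω → Vec dy}

theorem Assumptions.measurable_yStar (A : p.Assumptions μg Lg Lg' Lf Mg B σf σg σgxy σgyy)
    (hμ : 0 < μg) (hX : Measurable X) : Measurable (fun ω => p.yStar (X ω)) :=
  measurable_comp_of_norm_sub_le_pairNorm (F := fun x (_ : Vec dx) => p.yStar x)
    -- The absolute value permits enlarging ‖x - x'‖ to the pair norm without knowing the sign of
    -- the constant.
    (C := |μg⁻¹ * Lg'|) (fun x x' _ _ => (A.norm_yStar_sub_le hμ x x').trans
      (mul_le_mul (le_abs_self _) (norm_le_pairNorm_left _ _) (norm_nonneg _) (abs_nonneg _))) hX hX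

theorem Assumptions.measurable_zStar (A : p.Assumptions μg Lg Lg' Lf Mg B σf σg σgxy σgyy)
    (hμ : 0 < μg) (hX : Measurable X) (hY : Measurable Y) :
    Measurable (fun ω => p.zStar (X ω) (Y ω)) :=
  measurable_comp_of_norm_sub_le_pairNorm (A.norm_zStar_sub_le hμ) hX hY

theorem Assumptions.measurable_hyperGrad (A : p.Assumptions μg Lg Lg' Lf Mg B σf σg σgxy σgyy)
    (hμ : 0 < μg) (hL : 0 ≤ Lg') (hX : Measurable X) (hY : Measurable Y) :
    Measurable (fun ω => p.hyperGrad (X ω) (Y ω)) :=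
  measurable_comp_of_norm_sub_le_pairNorm (A.norm_hyperGrad_sub_le hμ hL) hX hY

theorem Assumptions.measurable_loss (A : p.Assumptions μg Lg Lg' Lf Mg B σf σg σgxy σgyy)
    (hμ : 0 < μg) (hX : Measurable X) : Measurable (fun ω => p.loss (X ω)) := by
  have : Continuous p.loss := continuous_iff_continuousAt.2 fun x =>
    (A.hasGradientAt_loss hμ x).differentiableAt.continuousAt
  exact this.measurable.comp hX

/-- A deterministic cost is a stochastic cost whose noise lives on a one-point space. -/
theorem Assumptions.measurable_gradX_f (A : p.Assumptions μg Lg Lg' Lf Mg B σf σg σgxy σgyy)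
    (hX : Measurable X) (hY : Measurable Y) : Measurable (fun ω => gradX p.f (X ω) (Y ω)) :=
  measurable_gradX (h := fun _ : Unit => p.f) (ξ := fun _ => ()) (fun _ => A.f_diff)
    (fun _ _ => measurable_const) measurable_const hX hY

theorem Assumptions.measurable_gradY_f (A : p.Assumptions μg Lg Lg' Lf Mg B σf σg σgxy σgyy)
    (hX : Measurable X) (hY : Measurable Y) : Measurable (fun ω => gradY p.f (X ω) (Y ω)) :=
  measurable_gradY (h := fun _ : Unit => p.f) (ξ := fun _ => ()) (fun _ => A.f_diff)
    (fun _ _ => measurable_const) measurable_const hX hY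

theorem Assumptions.measurable_gradY_g (A : p.Assumptions μg Lg Lg' Lf Mg B σf σg σgxy σgyy)
    (hX : Measurable X) (hY : Measurable Y) : Measurable (fun ω => gradY p.g (X ω) (Y ω)) :=
  measurable_gradY (h := fun _ : Unit => p.g) (ξ := fun _ => ()) (fun _ => A.g_diff.1)
    (fun _ _ => measurable_const) measurable_const hX hY

theorem Assumptions.measurable_hessYY_g (A : p.Assumptions μg Lg Lg' Lf Mg B σf σg σgxy σgyy)
    (hX : Measurable X) (hY : Measurable Y) (hZ : Measurable Z) :
    Measurable (fun ω => hessYY p.g (X ω) (Y ω) (Z ω)) :=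
  measurable_hessYY_apply (h := fun _ : Unit => p.g) (ξ := fun _ => ()) (fun _ => A.g_diff)
    (fun _ _ => measurable_const) measurable_const hX hY hZ

theorem Assumptions.measurable_jacXY_g (A : p.Assumptions μg Lg Lg' Lf Mg B σf σg σgxy σgyy)
    (hX : Measurable X) (hY : Measurable Y) (hZ : Measurable Z) :
    Measurable (fun ω => jacXY p.g (X ω) (Y ω) (Z ω)) :=
  measurable_jacXY_apply (h := fun _ : Unit => p.g) (ξ := fun _ => ()) (fun _ => A.g_diff)
    (fun _ _ => measurable_const) measurable_const hX hY hZ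

variable {a : Params} {s : Ω → Sample → Ξ}

theorem Assumptions.measurable_algA (A : p.Assumptions μg Lg Lg' Lf Mg B σf σg σgxy σgyy)
    {k t : ℕ} (hs : ∀ t' < t, ∀ i, Measurable (fun ω => s ω (.g k t' i)))
    (hX : Measurable X) (hY : Measurable Y) :
    Measurable (fun ω => algA p a (s ω) k (X ω) (Y ω) t) := by
  induction t with
  | zero => exact hY
  | succ t ih =>
    have h1 := ih fun t' ht' => hs t' (ht'.trans (Nat.lt_succ_self t))
    exact h1.sub (Measurable.fun_const_smul (measurable_batchAvg fun i => measurable_gradY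
      (fun ξ => (A.ghat_diff ξ).1) A.ghat_meas (hs t (Nat.lt_succ_self t) i) hX h1) a.α)

theorem Assumptions.measurable_algB (A : p.Assumptions μg Lg Lg' Lf Mg B σf σg σgxy σgyy)
    {k n : ℕ} (hs : ∀ n' < n, ∀ i, Measurable (fun ω => s ω (.gyy k n' i)))
    (hX : Measurable X) (hY : Measurable Y) (hZ : Measurable Z) {V : Ω → Vec dy}
    (hV : Measurable V) :
    Measurable (fun ω => algB p a (s ω) k (X ω) (Y ω) (V ω) (Z ω) n) := by
  induction n with
  | zero => exact hZ
  | succ n ih =>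
    have h1 := ih fun n' hn' => hs n' (hn'.trans (Nat.lt_succ_self n))
    exact h1.sub (Measurable.fun_const_smul ((measurable_batchAvg fun i => measurable_hessYY_apply
      A.ghat_diff A.ghat_meas (hs n (Nat.lt_succ_self n) i) hX hY h1).add hV) a.β)

end Problem

/-! ### Independence and second moments -/

section Independence

variable {Ω : Type*} [mΩ : MeasurableSpace Ω] {P : Measure Ω}

/-- Intersections of events of m₀ and m₁ form a π-system that generates the join, and on them the
product formula follows from the two hypotheses. -/
theorem indep_sup_left [IsProbabilityMeasure P] {m₀ m₁ m₂ : MeasurableSpace Ω}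
    (h₀ : m₀ ≤ mΩ) (h₁ : m₁ ≤ mΩ) (h₂ : m₂ ≤ mΩ) (h : Indep m₀ (m₁ ⊔ m₂) P) (h' : Indep m₁ m₂ P) :
    Indep (m₀ ⊔ m₁) m₂ P := by
  set π : Set (Set Ω) := {s | ∃ A B, MeasurableSet[m₀] A ∧ MeasurableSet[m₁] B ∧ s = A ∩ B}
  have hπ : IsPiSystem π := by
    rintro _ ⟨A, B, hA, hB, rfl⟩ _ ⟨A', B', hA', hB', rfl⟩ -
    exact ⟨A ∩ A', B ∩ B', @MeasurableSet.inter _ m₀ _ _ hA hA',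
      @MeasurableSet.inter _ m₁ _ _ hB hB',
      Set.inter_inter_inter_comm _ _ _ _⟩
  have hgen : m₀ ⊔ m₁ = MeasurableSpace.generateFrom π := by
    apply le_antisymm
    · refine sup_le (fun A hA => ?_) (fun B hB => ?_)
      · exact MeasurableSpace.measurableSet_generateFrom
          ⟨A, Set.univ, hA, @MeasurableSet.univ _ m₁, (Set.inter_univ A).symm⟩
      · exact MeasurableSpace.measurableSet_generateFrom
          ⟨Set.univ, B, @MeasurableSet.univ _ m₀, hB, (Set.univ_inter B).symm⟩
    · refine MeasurableSpace.generateFrom_le ?_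
      rintro _ ⟨A, B, hA, hB, rfl⟩
      exact @MeasurableSet.inter _ (m₀ ⊔ m₁) _ _ (le_sup_left (a := m₀) (b := m₁) _ hA)
        (le_sup_right (a := m₀) (b := m₁) _ hB)
  refine IndepSets.indep (sup_le h₀ h₁) h₂ hπ (@MeasurableSpace.isPiSystem_measurableSet _ m₂)
    hgen (@MeasurableSpace.generateFrom_measurableSet _ m₂).symm ?_
  rw [IndepSets_iff]
  rintro _ C ⟨A, B, hA, hB, rfl⟩ hC
  rw [Indep_iff] at h h'
  have hB' := le_sup_left (a := m₁) (b := m₂) _ hB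
  have hC' := le_sup_right (a := m₁) (b := m₂) _ hC
  rw [Set.inter_assoc, h A (B ∩ C) hA (@MeasurableSet.inter _ (m₁ ⊔ m₂) _ _ hB' hC'), h' B C hB hC,
    h A B hA hB', mul_assoc]

/-- This plays the part of conditioning on X: the joint law is a product, and Tonelli integrates ζ
first with X frozen. Working with nonnegative integrals makes integrability a conclusion. -/
theorem integrable_and_integral_le_of_indepFun [IsProbabilityMeasure P] {S Z : Type*}
    [MeasurableSpace S] [MeasurableSpace Z] {X : Ω → S} {ζ : Ω → Z} (hX : Measurable X)
    (hζ : Measurable ζ) (hind : IndepFun X ζ P) {G : S → Z → ℝ} {H : S → ℝ}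
    (hG : Measurable (Function.uncurry G)) (h0 : ∀ s z, 0 ≤ G s z)
    (hint : ∀ s, Integrable (fun ω => G s (ζ ω)) P) (hle : ∀ s, ∫ ω, G s (ζ ω) ∂P ≤ H s)
    (hH : Integrable (fun ω => H (X ω)) P) :
    Integrable (fun ω => G (X ω) (ζ ω)) P ∧ ∫ ω, G (X ω) (ζ ω) ∂P ≤ ∫ ω, H (X ω) ∂P := by
  have hGm : Measurable (fun ω => G (X ω) (ζ ω)) := hG.comp (hX.prodMk hζ)
  have hGe : Measurable (fun q : S × Z => ENNReal.ofReal (G q.1 q.2)) := hG.ennreal_ofReal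
  have hH0 : ∀ s, 0 ≤ H s := fun s => (integral_nonneg fun ω => h0 s (ζ ω)).trans (hle s)
  have hPX := Measure.isProbabilityMeasure_map (μ := P) hX.aemeasurable
  have hPζ := Measure.isProbabilityMeasure_map (μ := P) hζ.aemeasurable
  have key : ∫⁻ ω, ENNReal.ofReal (G (X ω) (ζ ω)) ∂P ≤ ∫⁻ ω, ENNReal.ofReal (H (X ω)) ∂P := by
    calc ∫⁻ ω, ENNReal.ofReal (G (X ω) (ζ ω)) ∂P
        = ∫⁻ q, ENNReal.ofReal (G q.1 q.2) ∂(P.map fun ω => (X ω, ζ ω)) := by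
          rw [lintegral_map hGe (hX.prodMk hζ)]
      _ = ∫⁻ s, ∫⁻ z, ENNReal.ofReal (G s z) ∂(P.map ζ) ∂(P.map X) := by
          rw [(indepFun_iff_map_prod_eq_prod_map_map hX.aemeasurable hζ.aemeasurable).1 hind,
            lintegral_prod _ hGe.aemeasurable]
      _ = ∫⁻ ω, ∫⁻ z, ENNReal.ofReal (G (X ω) z) ∂(P.map ζ) ∂P :=
          lintegral_map hGe.lintegral_prod_right' hX
      _ ≤ ∫⁻ ω, ENNReal.ofReal (H (X ω)) ∂P := by
          refine lintegral_mono fun ω => ?_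
          rw [lintegral_map (f := fun z => ENNReal.ofReal (G (X ω) z))
              (hGe.comp measurable_prodMk_left) hζ,
            ← ofReal_integral_eq_lintegral_ofReal (hint _)
              (Filter.Eventually.of_forall fun _ => h0 _ _)]
          exact ENNReal.ofReal_le_ofReal (hle _)
  have hi : Integrable (fun ω => G (X ω) (ζ ω)) P := by
    refine ⟨hGm.aestronglyMeasurable, ?_⟩
    rw [hasFiniteIntegral_iff_ofReal (Filter.Eventually.of_forall fun _ => h0 _ _)]
    exact key.trans_lt ((hasFiniteIntegral_iff_ofReal
      (Filter.Eventually.of_forall fun _ => hH0 _)).1 hH.2)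
  refine ⟨hi, ?_⟩
  rw [← ENNReal.ofReal_le_ofReal_iff (integral_nonneg fun _ => hH0 _),
    ofReal_integral_eq_lintegral_ofReal hi (Filter.Eventually.of_forall fun _ => h0 _ _),
    ofReal_integral_eq_lintegral_ofReal hH (Filter.Eventually.of_forall fun _ => hH0 _)]
  exact key

/-- The second moment of a constant plus the average of `n` i.i.d. centered vectors. -/
theorem integral_sq_norm_add_batchAvg_le [IsProbabilityMeasure P] {d : ℕ} {F : ℕ → Ω → Vec d}
    (hm : ∀ i, Measurable (F i)) (hind : Pairwise fun i j => IndepFun (F i) (F j) P)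
    (hint : ∀ i, Integrable (F i) P) (h0 : ∀ i, ∫ ω, F i ω ∂P = 0)
    (hsq : ∀ i, Integrable (fun ω => ‖F i ω‖ ^ 2) P) {s : ℝ}
    (hs : ∀ i, ∫ ω, ‖F i ω‖ ^ 2 ∂P ≤ s) (a : Vec d) {n : ℕ} (hn : 1 ≤ n) :
    Integrable (fun ω => ‖a + batchAvg n (fun i => F i ω)‖ ^ 2) P ∧
      ∫ ω, ‖a + batchAvg n (fun i => F i ω)‖ ^ 2 ∂P ≤ ‖a‖ ^ 2 + s / n := by
  have hin : ∀ i j, Integrable (fun ω => ⟪F i ω, F j ω⟫_ℝ) P := by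
    intro i j
    refine Integrable.mono' ((hsq i).add (hsq j)) ((hm i).inner (hm j)).aestronglyMeasurable
      (Filter.Eventually.of_forall fun ω => ?_)
    have := norm_inner_le_norm (𝕜 := ℝ) (F i ω) (F j ω)
    simp only [Pi.add_apply]
    nlinarith [sq_nonneg (‖F i ω‖ - ‖F j ω‖), sq_nonneg (‖F i ω‖ + ‖F j ω‖)]
  -- Cross terms vanish by independence and centering, so only the n diagonal terms of the double
  -- sum survive; divided by n² they give s/n.
  have hin0 : ∀ i j, i ≠ j → ∫ ω, ⟪F i ω, F j ω⟫_ℝ ∂P = 0 := by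
    intro i j hij
    have := (hind hij).integral_bilin (hint i) (hint j) (innerSL ℝ)
    simp only [h0, map_zero] at this
    exact this
  have e : ∀ ω, ‖a + batchAvg n (fun i => F i ω)‖ ^ 2 = ‖a‖ ^ 2
      + 2 * (n : ℝ)⁻¹ * (∑ i ∈ Finset.range n, ⟪a, F i ω⟫_ℝ)
      + ((n : ℝ)⁻¹) ^ 2 * ∑ i ∈ Finset.range n, ∑ j ∈ Finset.range n, ⟪F i ω, F j ω⟫_ℝ := by
    intro ω
    rw [norm_add_sq_real, batchAvg, inner_smul_right, inner_sum, norm_smul, mul_pow,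
      ← real_inner_self_eq_norm_sq (∑ i ∈ Finset.range n, F i ω), sum_inner]
    simp only [inner_sum, Real.norm_eq_abs, sq_abs]
    ring
  have hi1 : Integrable (fun ω => 2 * (n : ℝ)⁻¹ * (∑ i ∈ Finset.range n, ⟪a, F i ω⟫_ℝ)) P :=
    (integrable_finsetSum _ fun i _ => (hint i).const_inner a).const_mul _
  have hi2 : Integrable (fun ω => ((n : ℝ)⁻¹) ^ 2 *
      ∑ i ∈ Finset.range n, ∑ j ∈ Finset.range n, ⟪F i ω, F j ω⟫_ℝ) P :=
    (integrable_finsetSum _ fun i _ => integrable_finsetSum _ fun j _ => hin i j).const_mul _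
  have hi3 : Integrable (fun ω => ‖a‖ ^ 2
      + 2 * (n : ℝ)⁻¹ * (∑ i ∈ Finset.range n, ⟪a, F i ω⟫_ℝ)) P := (integrable_const _).add hi1
  simp only [e]
  refine ⟨hi3.add hi2, ?_⟩
  rw [integral_add hi3 hi2, integral_add (integrable_const _) hi1,
    integral_const_mul, integral_const_mul, integral_finsetSum _ fun i _ => (hint i).const_inner a,
    integral_finsetSum _ fun i _ => integrable_finsetSum _ fun j _ => hin i j]
  have e1 : ∑ i ∈ Finset.range n, ∫ ω, ⟪a, F i ω⟫_ℝ ∂P = 0 :=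
    Finset.sum_eq_zero fun i _ => by rw [integral_inner (hint i), h0, inner_zero_right]
  have e2 : ∑ i ∈ Finset.range n, ∫ ω, ∑ j ∈ Finset.range n, ⟪F i ω, F j ω⟫_ℝ ∂P ≤ n * s := by
    calc _ ≤ ∑ i ∈ Finset.range n, s := Finset.sum_le_sum fun i hi => by
            rw [integral_finsetSum _ fun j _ => hin i j, Finset.sum_eq_single i
              (fun j _ hj => hin0 i j hj.symm) (fun h => absurd hi h)]
            simp only [real_inner_self_eq_norm_sq]
            exact hs i
      _ = n * s := by simp
  have hn' : (0 : ℝ) < n := by exact_mod_cast hn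
  have e3 : ((n : ℝ)⁻¹) ^ 2 * (n * s) = s / n := by field_simp
  rw [e1, mul_zero, add_zero, ← e3]
  simp only [integral_const, probReal_univ, one_smul]
  gcongr

end Independence

/-! ### Fresh batches are independent of the current state -/

section Stage

variable {dx dy : ℕ} {Ξ : Type*} [MeasurableSpace Ξ] {Ω : Type*} {ξ : Sample → Ω → Ξ}
  {init : Ω → State dx dy}

/-- The information in the inputs of the algorithm and in all the noise samples that do not belong
to the batch `ℓ`. -/
@[reducible]
def outsideBatch (ξ : Sample → Ω → Ξ) (init : Ω → State dx dy) (ℓ : ℕ → Sample) :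
    MeasurableSpace Ω :=
  MeasurableSpace.comap (fun ω => ((init ω).x, (init ω).y, (init ω).z)) inferInstance ⊔
    ⨆ s ∈ (Set.range ℓ)ᶜ, MeasurableSpace.comap (ξ s) inferInstance

theorem measurable_sample_outsideBatch {ℓ : ℕ → Sample} {s : Sample} (hs : ∀ i, ℓ i ≠ s) :
    Measurable[outsideBatch ξ init ℓ] (ξ s) := by
  rw [measurable_iff_comap_le]
  refine le_trans ?_ le_sup_right
  exact le_iSup₂_of_le s (by simpa using hs) le_rfl

theorem measurable_init_outsideBatch (ξ : Sample → Ω → Ξ) (init : Ω → State dx dy)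
    (ℓ : ℕ → Sample) :
    Measurable[outsideBatch ξ init ℓ] (fun ω => ((init ω).x, (init ω).y, (init ω).z)) := by
  rw [measurable_iff_comap_le]
  exact le_sup_left

variable {p : Problem dx dy Ξ} [mΩ : MeasurableSpace Ω] {P : Measure Ω}

theorem Sampling.outsideBatch_le (hS : Sampling p P ξ init) (ℓ : ℕ → Sample) :
    outsideBatch ξ init ℓ ≤ mΩ :=
  sup_le (hS.x_meas.prodMk (hS.y_meas.prodMk hS.z_meas)).comap_le
    (iSup₂_le fun s _ => (hS.meas s).comap_le)

/-- The other samples are independent of the batch, and the inputs are independent of all samples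
together; `indep_sup_left` combines the two. -/
theorem Sampling.indepFun_batch (hS : Sampling p P ξ init) {ℓ : ℕ → Sample} {S : Type*}
    [MeasurableSpace S] {X : Ω → S} (hX : Measurable[outsideBatch ξ init ℓ] X) :
    IndepFun X (fun ω i => ξ (ℓ i) ω) P := by
  have := hS.prob
  set m : Sample → MeasurableSpace Ω := fun s => MeasurableSpace.comap (ξ s) inferInstance
  have hm : ∀ s, m s ≤ mΩ := fun s => (hS.meas s).comap_le
  have h1 : Indep (⨆ s ∈ (Set.range ℓ)ᶜ, m s) (⨆ s ∈ Set.range ℓ, m s) P :=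
    indep_iSup_of_disjoint hm hS.indep disjoint_compl_left
  have h2 := hS.init_indep
  rw [IndepFun_iff_Indep] at h2 ⊢
  have hpi : ∀ {ι : Type} (η : ι → Ω → Ξ), MeasurableSpace.comap (fun ω i => η i ω) inferInstance
      = ⨆ i, MeasurableSpace.comap (η i) inferInstance := by
    intro ι η
    simp only [MeasurableSpace.pi, MeasurableSpace.comap_iSup, MeasurableSpace.comap_comp]
    rfl
  rw [hpi] at h2 ⊢
  have h3 : Indep (MeasurableSpace.comap (fun ω => ((init ω).x, (init ω).y, (init ω).z))
      inferInstance) ((⨆ s ∈ (Set.range ℓ)ᶜ, m s) ⊔ (⨆ s ∈ Set.range ℓ, m s)) P :=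
    indep_of_indep_of_le_right h2 (sup_le (iSup₂_le fun s _ => le_iSup m s)
      (iSup₂_le fun s _ => le_iSup m s))
  have h4 := indep_sup_left (hS.x_meas.prodMk (hS.y_meas.prodMk hS.z_meas)).comap_le
    (iSup₂_le fun s _ => hm s) (iSup₂_le fun s _ => hm s) h3 h1
  refine indep_of_indep_of_le_left (indep_of_indep_of_le_right h4 ?_) hX.comap_le
  exact iSup_le fun i => le_iSup₂_of_le (f := fun s (_ : s ∈ Set.range ℓ) => m s) (ℓ i)
    (Set.mem_range_self i) le_rfl

theorem Sampling.integral_comp (hS : Sampling p P ξ init) {V : Type*} [NormedAddCommGroup V]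
    [NormedSpace ℝ V] {F : Ξ → V} (hF : AEStronglyMeasurable F p.law) (s : Sample) :
    ∫ ω, F (ξ s ω) ∂P = ∫ x, F x ∂p.law := by
  rw [← hS.law s] at hF ⊢
  rw [integral_map (hS.meas s).aemeasurable hF]

theorem Sampling.integrable_comp (hS : Sampling p P ξ init) {V : Type*} [NormedAddCommGroup V]
    {F : Ξ → V} (hF : Integrable F p.law) (s : Sample) :
    Integrable (fun ω => F (ξ s ω)) P := by
  rw [← hS.law s] at hF
  exact hF.comp_measurable (hS.meas s)

/-- One use of a fresh batch of `n` samples: it adds to the squared norm its variance. -/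
theorem Sampling.integral_sq_norm_add_batch_le (hS : Sampling p P ξ init) {ℓ : ℕ → Sample}
    (hℓ : Function.Injective ℓ) {S : Type*} [MeasurableSpace S] {X : Ω → S}
    (hX : Measurable[outsideBatch ξ init ℓ] X) {d : ℕ} {Φ : Ξ → S → Vec d}
    (hΦ : Measurable (Function.uncurry Φ)) {a : S → Vec d} (ha : Measurable a) {v : S → ℝ}
    (hint : ∀ s, Integrable (fun x => Φ x s) p.law) (h0 : ∀ s, ∫ x, Φ x s ∂p.law = 0)
    (hsq : ∀ s, Integrable (fun x => ‖Φ x s‖ ^ 2) p.law) (hv : ∀ s, ∫ x, ‖Φ x s‖ ^ 2 ∂p.law ≤ v s)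
    {n : ℕ} (hn : 1 ≤ n) (hI : Integrable (fun ω => ‖a (X ω)‖ ^ 2 + v (X ω) / n) P) :
    Integrable (fun ω => ‖a (X ω) + batchAvg n (fun i => Φ (ξ (ℓ i) ω) (X ω))‖ ^ 2) P ∧
      ∫ ω, ‖a (X ω) + batchAvg n (fun i => Φ (ξ (ℓ i) ω) (X ω))‖ ^ 2 ∂P
        ≤ ∫ ω, (‖a (X ω)‖ ^ 2 + v (X ω) / n) ∂P := by
  have := hS.prob
  have hΦs : ∀ s, Measurable (fun x => Φ x s) := fun s => hΦ.comp measurable_prodMk_right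
  have key := fun s => integral_sq_norm_add_batchAvg_le (P := P) (F := fun i ω => Φ (ξ (ℓ i) ω) s)
    (fun i => (hΦs s).comp (hS.meas _))
    (fun i j hij => (hS.indep.indepFun (hℓ.ne hij)).comp (hΦs s) (hΦs s))
    (fun i => hS.integrable_comp (hint s) _)
    (fun i => by rw [hS.integral_comp (F := fun x => Φ x s) (hint s).aestronglyMeasurable, h0 s])
    (fun i => hS.integrable_comp (hsq s) _)
    (s := v s)
    (fun i => by
      rw [hS.integral_comp (F := fun x => ‖Φ x s‖ ^ 2) (hsq s).aestronglyMeasurable]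
      exact hv s)
    (a s) hn
  refine integrable_and_integral_le_of_indepFun (P := P) (X := X) (ζ := fun ω i => ξ (ℓ i) ω)
    (G := fun s z => ‖a s + batchAvg n (fun i => Φ (z i) s)‖ ^ 2)
    (H := fun s => ‖a s‖ ^ 2 + v s / n) (hX.mono (hS.outsideBatch_le ℓ) le_rfl)
    (measurable_pi_lambda _ fun i => hS.meas _) (hS.indepFun_batch hX) ?_
    (fun _ _ => by positivity) (fun s => (key s).1) (fun s => (key s).2) hI
  have h1 : Measurable (fun q : S × (ℕ → Ξ) => batchAvg n (fun i => Φ (q.2 i) q.1)) :=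
    measurable_batchAvg (F := fun i (q : S × (ℕ → Ξ)) => Φ (q.2 i) q.1) fun i => by
      have h2 : Measurable (fun q : S × (ℕ → Ξ) => (q.2 i, q.1)) :=
        ((measurable_pi_apply i).comp measurable_snd).prodMk measurable_fst
      exact hΦ.comp h2
  exact ((ha.comp measurable_fst).add h1).norm.pow_const 2

end Stage

/-! ### The iterates as random variables -/

section Iterates

variable {dx dy : ℕ} {Ξ : Type*} [MeasurableSpace Ξ] (p : Problem dx dy Ξ) (a : Params)
  {Ω : Type*} (ξ : Sample → Ω → Ξ) (init : Ω → State dx dy)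

/-- The outer iterate `x_k`. -/
def xRV (k : ℕ) (ω : Ω) : Vec dx := (runRV p a ξ init k ω).x

/-- The inner iterates of the outer iteration `k` for `y`. -/
def yIt (k t : ℕ) (ω : Ω) : Vec dy :=
  algA p a (fun i => ξ i ω) k (runRV p a ξ init k ω).x (runRV p a ξ init k ω).y t

/-- The inner output `y_k`. -/
def yRV (k : ℕ) (ω : Ω) : Vec dy := yIt p a ξ init k a.T ω

/-- The stochastic gradient `u_k` of the outer cost in `x`. -/
def uRV (k : ℕ) (ω : Ω) : Vec dx :=
  batchAvg a.nf (fun i => gradX (p.fhat (ξ (.f k i) ω)) (xRV p a ξ init k ω) (yRV p a ξ init k ω))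

/-- The stochastic gradient `v_k` of the outer cost in `y`. -/
def vRV (k : ℕ) (ω : Ω) : Vec dy :=
  batchAvg a.nf (fun i => gradY (p.fhat (ξ (.f k i) ω)) (xRV p a ξ init k ω) (yRV p a ξ init k ω))

/-- The inner iterates of the outer iteration `k` for `z`. -/
def zIt (k n : ℕ) (ω : Ω) : Vec dy :=
  algB p a (fun i => ξ i ω) k (xRV p a ξ init k ω) (yRV p a ξ init k ω) (vRV p a ξ init k ω)
    (runRV p a ξ init k ω).z n

/-- The inner output `z_k`. -/
def zRV (k : ℕ) (ω : Ω) : Vec dy := zIt p a ξ init k a.N ω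

/-- The stochastic Jacobian-vector product of the outer iteration `k`. -/
def wRV (k : ℕ) (ω : Ω) : Vec dx :=
  batchAvg a.ngxy (fun i => jacXY (p.ghat (ξ (.gxy k i) ω)) (xRV p a ξ init k ω)
    (yRV p a ξ init k ω) (zRV p a ξ init k ω))

theorem xRV_succ (k : ℕ) (ω : Ω) : xRV p a ξ init (k + 1) ω
    = xRV p a ξ init k ω - a.γ • (uRV p a ξ init k ω + wRV p a ξ init k ω) := rfl

theorem yIt_succ (k t : ℕ) (ω : Ω) : yIt p a ξ init k (t + 1) ω
    = yIt p a ξ init k t ω - a.α • batchAvg a.ng (fun i =>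
      gradY (p.ghat (ξ (.g k t i) ω)) (xRV p a ξ init k ω) (yIt p a ξ init k t ω)) := rfl

theorem zIt_succ (k n : ℕ) (ω : Ω) : zIt p a ξ init k (n + 1) ω
    = zIt p a ξ init k n ω - a.β • (batchAvg a.ngyy (fun i =>
      hessYY (p.ghat (ξ (.gyy k n i) ω)) (xRV p a ξ init k ω) (yRV p a ξ init k ω)
        (zIt p a ξ init k n ω)) + vRV p a ξ init k ω) := rfl

theorem yIt_zero_succ (k : ℕ) : yIt p a ξ init (k + 1) 0 = yRV p a ξ init k := rfl

theorem zIt_zero_succ (k : ℕ) : zIt p a ξ init (k + 1) 0 = zRV p a ξ init k := rfl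

/-- The outer iteration to which a sample belongs. -/
def Sample.iter : Sample → ℕ
  | .f k _ => k
  | .g k _ _ => k
  | .gxy k _ => k
  | .gyy k _ _ => k

variable {p a ξ init} {μg Lg Lg' Lf Mg B σf σg σgxy σgyy : ℝ} [mΩ : MeasurableSpace Ω]

/-- The σ-algebra on Ω is left free, and only samples of earlier outer iterations are assumed
measurable. Taking `outsideBatch` for it shows that the state before a batch is drawn does not
depend on that batch. -/
theorem Problem.Assumptions.measurable_runRV
    (A : p.Assumptions μg Lg Lg' Lf Mg B σf σg σgxy σgyy)
    (hi : Measurable (fun ω => ((init ω).x, (init ω).y, (init ω).z))) {k : ℕ}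
    (hs : ∀ s : Sample, s.iter < k → Measurable (ξ s)) :
    Measurable (fun ω => (runRV p a ξ init k ω).x) ∧ Measurable (fun ω => (runRV p a ξ init k ω).y)
      ∧ Measurable (fun ω => (runRV p a ξ init k ω).z) := by
  induction k with
  | zero => exact ⟨hi.fst, hi.snd.fst, hi.snd.snd⟩
  | succ k ih =>
    have hk := Nat.lt_succ_self k
    obtain ⟨hx, hy, hz⟩ := ih fun s h => hs s (h.trans hk)
    have hY : Measurable (yRV p a ξ init k) :=
        A.measurable_algA (fun t _ i => hs (.g k t i) hk) hx hy
    have hV : Measurable (vRV p a ξ init k) := measurable_batchAvg fun i =>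
      measurable_gradY A.fhat_diff A.fhat_meas (hs (.f k i) hk) hx hY
    have hU : Measurable (uRV p a ξ init k) := measurable_batchAvg fun i =>
      measurable_gradX A.fhat_diff A.fhat_meas (hs (.f k i) hk) hx hY
    have hZ : Measurable (zRV p a ξ init k) :=
      A.measurable_algB (fun n _ i => hs (.gyy k n i) hk) hx hY hz hV
    have hW : Measurable (wRV p a ξ init k) := measurable_batchAvg fun i =>
      measurable_jacXY_apply A.ghat_diff A.ghat_meas (hs (.gxy k i) hk) hx hY hZ
    exact ⟨hx.sub ((hU.add hW).fun_const_smul a.γ), hY, hZ⟩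

theorem Problem.Assumptions.measurable_xRV_yIt
    (A : p.Assumptions μg Lg Lg' Lf Mg B σf σg σgxy σgyy)
    (hi : Measurable (fun ω => ((init ω).x, (init ω).y, (init ω).z))) {k t : ℕ}
    (hs : ∀ s : Sample, s.iter < k → Measurable (ξ s))
    (hg : ∀ t' < t, ∀ i, Measurable (ξ (.g k t' i))) :
    Measurable (fun ω => (xRV p a ξ init k ω, yIt p a ξ init k t ω)) := by
  obtain ⟨hx, hy, -⟩ := A.measurable_runRV (a := a) hi hs
  exact hx.prodMk (A.measurable_algA hg hx hy)

theorem Problem.Assumptions.measurable_xRV_yRV_vRV_zIt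
    (A : p.Assumptions μg Lg Lg' Lf Mg B σf σg σgxy σgyy)
    (hi : Measurable (fun ω => ((init ω).x, (init ω).y, (init ω).z))) {k n : ℕ}
    (hs : ∀ s : Sample, s.iter < k → Measurable (ξ s))
    (hg : ∀ t i, Measurable (ξ (.g k t i))) (hf : ∀ i, Measurable (ξ (.f k i)))
    (hgyy : ∀ n' < n, ∀ i, Measurable (ξ (.gyy k n' i))) :
    Measurable (fun ω => (xRV p a ξ init k ω, yRV p a ξ init k ω, vRV p a ξ init k ω,
      zIt p a ξ init k n ω)) := by
  obtain ⟨hx, -, hz⟩ := A.measurable_runRV (a := a) hi hs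
  have hY : Measurable (yRV p a ξ init k) :=
    (A.measurable_xRV_yIt (a := a) hi hs (t := a.T) fun t _ i => hg t i).snd
  have hV : Measurable (vRV p a ξ init k) := measurable_batchAvg fun i =>
    measurable_gradY A.fhat_diff A.fhat_meas (hf i) hx hY
  exact hx.prodMk (hY.prodMk (hV.prodMk (A.measurable_algB hgyy hx hY hz hV)))

end Iterates

/-! ### Tools for second-moment recursions -/

section Moments

theorem batchAvg_smul_sub {V : Type*} [AddCommGroup V] [Module ℝ V] {n : ℕ} (hn : 1 ≤ n) (c : ℝ)
    (F : ℕ → V) (b : V) :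
    batchAvg n (fun i => c • (F i - b)) = c • (batchAvg n F - b) := by
  have hn' : (n : ℝ) ≠ 0 := by positivity
  simp only [batchAvg, ← Finset.smul_sum, Finset.sum_sub_distrib, Finset.sum_const,
    Finset.card_range]
  rw [smul_comm, smul_sub (n : ℝ)⁻¹, ← Nat.cast_smul_eq_nsmul ℝ, smul_smul _ (n : ℝ),
    inv_mul_cancel₀ hn', one_smul]

theorem batchAvg_sub {V : Type*} [AddCommGroup V] [Module ℝ V] {n : ℕ} (hn : 1 ≤ n)
    (F : ℕ → V) (b : V) : batchAvg n (fun i => F i - b) = batchAvg n F - b := by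
  simpa using batchAvg_smul_sub hn 1 F b

theorem le_geometric_add {q s : ℝ} (hq : 0 < q) (hq1 : q ≤ 1) {b : ℕ → ℝ}
    (hb : ∀ t, b (t + 1) ≤ (1 - q) * b t + s) (hs : 0 ≤ s) (t : ℕ) :
    b t ≤ (1 - q) ^ t * b 0 + s / q := by
  induction t with
  | zero => simp; positivity
  | succ t ih =>
    have h1 := mul_le_mul_of_nonneg_left ih (by linarith : 0 ≤ 1 - q)
    have h2 : (1 - q) * (s / q) + s = s / q := by field_simp; ring
    have h3 := hb t
    rw [pow_succ]
    linarith

variable {Ω : Type*} [mΩ : MeasurableSpace Ω] {P : Measure Ω}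

theorem integrable_and_integral_le_of_le {F G : Ω → ℝ} (hF : Measurable F) (h0 : ∀ ω, 0 ≤ F ω)
    (hG : Integrable G P) (h : ∀ ω, F ω ≤ G ω) :
    Integrable F P ∧ ∫ ω, F ω ∂P ≤ ∫ ω, G ω ∂P := by
  have hi : Integrable F P := hG.mono' hF.aestronglyMeasurable
    (Filter.Eventually.of_forall fun ω => by rw [Real.norm_of_nonneg (h0 ω)]; exact h ω)
  exact ⟨hi, integral_mono hi hG h⟩

variable {dx dy : ℕ} {Ξ : Type*} [MeasurableSpace Ξ] {p : Problem dx dy Ξ}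
  {ξ : Sample → Ω → Ξ} {init : Ω → State dx dy}

/-- The bound of `Sampling.integral_sq_norm_add_batch_le` with an integrable majorant. -/
theorem Sampling.integral_sq_norm_add_batch_le_of_le (hS : Sampling p P ξ init) {ℓ : ℕ → Sample}
    (hℓ : Function.Injective ℓ) {S : Type*} [MeasurableSpace S] {X : Ω → S}
    (hX : Measurable[outsideBatch ξ init ℓ] X) {d : ℕ} {Φ : Ξ → S → Vec d}
    (hΦ : Measurable (Function.uncurry Φ)) {a : S → Vec d} (ha : Measurable a) {v : S → ℝ}
    (hvm : Measurable v)
    (hint : ∀ s, Integrable (fun x => Φ x s) p.law) (h0 : ∀ s, ∫ x, Φ x s ∂p.law = 0)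
    (hsq : ∀ s, Integrable (fun x => ‖Φ x s‖ ^ 2) p.law) (hv : ∀ s, ∫ x, ‖Φ x s‖ ^ 2 ∂p.law ≤ v s)
    {n : ℕ} (hn : 1 ≤ n) {R : Ω → ℝ} (hR : Integrable R P)
    (hle : ∀ ω, ‖a (X ω)‖ ^ 2 + v (X ω) / n ≤ R ω) :
    Integrable (fun ω => ‖a (X ω) + batchAvg n (fun i => Φ (ξ (ℓ i) ω) (X ω))‖ ^ 2) P ∧
      ∫ ω, ‖a (X ω) + batchAvg n (fun i => Φ (ξ (ℓ i) ω) (X ω))‖ ^ 2 ∂P ≤ ∫ ω, R ω ∂P := by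
  have hX' := hX.mono (hS.outsideBatch_le ℓ) le_rfl
  have hm : Measurable (fun ω => ‖a (X ω)‖ ^ 2 + v (X ω) / n) :=
    ((ha.comp hX').norm.pow_const 2).add ((hvm.comp hX').div_const _)
  have hv0 : ∀ s, 0 ≤ v s := fun s => (integral_nonneg fun _ => by positivity).trans (hv s)
  obtain ⟨h1, h2⟩ := integrable_and_integral_le_of_le hm
    (fun ω => add_nonneg (by positivity) (div_nonneg (hv0 _) (by positivity))) hR hle
  obtain ⟨h3, h4⟩ := hS.integral_sq_norm_add_batch_le hℓ hX hΦ ha hint h0 hsq hv hn h1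
  exact ⟨h3, h4.trans h2⟩

namespace Problem

variable {μg Lg Lg' Lf Mg B σf σg σgxy σgyy : ℝ}

/-- Since ‖Fz‖² = ⟪z, FᵀF z⟫, the expectation passes to FᵀF, and the operator norm of the mean
suffices. -/
theorem integral_sq_norm_apply_le {d e : ℕ} {ν : Measure Ξ} {F : Ξ → Vec d →L[ℝ] Vec e} {σ : ℝ}
    (hF : Integrable (fun ξ => (ContinuousLinearMap.adjoint (F ξ)).comp (F ξ)) ν)
    (hσ : ‖∫ ξ, (ContinuousLinearMap.adjoint (F ξ)).comp (F ξ) ∂ν‖ ≤ σ ^ 2) (z : Vec d) :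
    Integrable (fun ξ => ‖F ξ z‖ ^ 2) ν ∧ ∫ ξ, ‖F ξ z‖ ^ 2 ∂ν ≤ σ ^ 2 * ‖z‖ ^ 2 := by
  have e : ∀ ξ, ‖F ξ z‖ ^ 2 = ⟪z, ((ContinuousLinearMap.adjoint (F ξ)).comp (F ξ)) z⟫_ℝ := by
    intro ξ
    rw [ContinuousLinearMap.comp_apply, ContinuousLinearMap.adjoint_inner_right,
      real_inner_self_eq_norm_sq]
  have h1 := hF.apply_continuousLinearMap z
  simp only [e]
  refine ⟨h1.const_inner z, ?_⟩
  rw [integral_inner h1, ← ContinuousLinearMap.integral_apply hF]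
  refine (real_inner_le_norm _ _).trans ?_
  have h2 := ContinuousLinearMap.le_of_opNorm_le _ hσ z
  nlinarith [norm_nonneg z]

end Problem

end Moments

/-! ### Mean squared errors within one outer iteration -/

namespace Problem

variable {dx dy : ℕ} {Ξ : Type*} [MeasurableSpace Ξ] {p : Problem dx dy Ξ} {a : Params}
  {Ω : Type*} [mΩ : MeasurableSpace Ω] {P : Measure Ω} {ξ : Sample → Ω → Ξ}
  {init : Ω → State dx dy} {μg Lg Lg' Lf Mg B σf σg σgxy σgyy : ℝ}

theorem Assumptions.measurable_xRV (A : p.Assumptions μg Lg Lg' Lf Mg B σf σg σgxy σgyy)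
    (hS : Sampling p P ξ init) (k : ℕ) : Measurable (xRV p a ξ init k) :=
  (A.measurable_runRV (hS.x_meas.prodMk (hS.y_meas.prodMk hS.z_meas)) fun s _ => hS.meas s).1

theorem Assumptions.measurable_yIt (A : p.Assumptions μg Lg Lg' Lf Mg B σf σg σgxy σgyy)
    (hS : Sampling p P ξ init) (k t : ℕ) : Measurable (yIt p a ξ init k t) :=
  (A.measurable_xRV_yIt (hS.x_meas.prodMk (hS.y_meas.prodMk hS.z_meas)) (fun s _ => hS.meas s)
    (fun _ _ _ => hS.meas _)).snd

theorem Assumptions.measurable_yRV (A : p.Assumptions μg Lg Lg' Lf Mg B σf σg σgxy σgyy)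
    (hS : Sampling p P ξ init) (k : ℕ) : Measurable (yRV p a ξ init k) :=
  A.measurable_yIt hS k a.T

theorem Assumptions.measurable_zIt (A : p.Assumptions μg Lg Lg' Lf Mg B σf σg σgxy σgyy)
    (hS : Sampling p P ξ init) (k n : ℕ) : Measurable (zIt p a ξ init k n) :=
  (A.measurable_xRV_yRV_vRV_zIt (hS.x_meas.prodMk (hS.y_meas.prodMk hS.z_meas))
    (fun s _ => hS.meas s) (fun _ _ => hS.meas _) (fun _ => hS.meas _)
    (fun _ _ _ => hS.meas _)).snd.snd.snd

theorem Assumptions.measurable_zRV (A : p.Assumptions μg Lg Lg' Lf Mg B σf σg σgxy σgyy)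
    (hS : Sampling p P ξ init) (k : ℕ) : Measurable (zRV p a ξ init k) :=
  A.measurable_zIt hS k a.N

theorem Assumptions.measurable_uRV (A : p.Assumptions μg Lg Lg' Lf Mg B σf σg σgxy σgyy)
    (hS : Sampling p P ξ init) (k : ℕ) : Measurable (uRV p a ξ init k) :=
  measurable_batchAvg fun i => measurable_gradX A.fhat_diff A.fhat_meas (hS.meas (.f k i))
    (A.measurable_xRV hS k) (A.measurable_yRV hS k)

theorem Assumptions.measurable_wRV (A : p.Assumptions μg Lg Lg' Lf Mg B σf σg σgxy σgyy)
    (hS : Sampling p P ξ init) (k : ℕ) : Measurable (wRV p a ξ init k) :=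
  measurable_batchAvg fun i => measurable_jacXY_apply A.ghat_diff A.ghat_meas
    (hS.meas (.gxy k i)) (A.measurable_xRV hS k) (A.measurable_yRV hS k) (A.measurable_zRV hS k)

/-! ### The inner algorithm for `y` -/

theorem Assumptions.integral_sq_norm_yIt_succ
    (A : p.Assumptions μg Lg Lg' Lf Mg B σf σg σgxy σgyy) (hμ : 0 < μg) (hL : 0 < Lg)
    (hμL : μg ≤ Lg) (hS : Sampling p P ξ init) (hα : a.α = Lg⁻¹) (hn : 1 ≤ a.ng) (k t : ℕ)
    (h : Integrable (fun ω => ‖yIt p a ξ init k t ω - p.yStar (xRV p a ξ init k ω)‖ ^ 2) P) :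
    Integrable (fun ω => ‖yIt p a ξ init k (t + 1) ω - p.yStar (xRV p a ξ init k ω)‖ ^ 2) P ∧
    ∫ ω, ‖yIt p a ξ init k (t + 1) ω - p.yStar (xRV p a ξ init k ω)‖ ^ 2 ∂P
      ≤ (1 - Lg⁻¹ * μg) * ∫ ω, ‖yIt p a ξ init k t ω - p.yStar (xRV p a ξ init k ω)‖ ^ 2 ∂P
        + Lg⁻¹ ^ 2 * (σg ^ 2 / a.ng) := by
  have hprob := hS.prob
  have hlaw := A.prob
  have hq : Lg⁻¹ * μg ≤ 1 := by rwa [inv_mul_le_iff₀ hL, mul_one]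
  have hq0 : 0 < Lg⁻¹ * μg := by positivity
  have hgr : Measurable (fun q : Ξ × (Vec dx × Vec dy) =>
      gradY (p.ghat q.1) q.2.1 q.2.2 - gradY p.g q.2.1 q.2.2) :=
    (measurable_gradY (fun ξ => (A.ghat_diff ξ).1) A.ghat_meas measurable_fst
      measurable_snd.fst measurable_snd.snd).sub
    (A.measurable_gradY_g measurable_snd.fst measurable_snd.snd)
  obtain ⟨h1, h2⟩ := hS.integral_sq_norm_add_batch_le_of_le (ℓ := fun i => .g k t i)
    (fun i j hij => by simpa using hij) (X := fun ω => (xRV p a ξ init k ω, yIt p a ξ init k t ω))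
    (A.measurable_xRV_yIt (mΩ := outsideBatch ξ init fun i => .g k t i)
      (measurable_init_outsideBatch ξ init _)
      (fun s hs => measurable_sample_outsideBatch fun i hi => by
        rw [← hi] at hs; exact lt_irrefl _ hs)
      (fun t' ht' i => measurable_sample_outsideBatch fun j hj => by
        simp only [Sample.g.injEq] at hj; omega))
    (Φ := fun x s => (-Lg⁻¹) • (gradY (p.ghat x) s.1 s.2 - gradY p.g s.1 s.2))
    (a := fun s => s.2 - Lg⁻¹ • gradY p.g s.1 s.2 - p.yStar s.1)
    (v := fun _ => Lg⁻¹ ^ 2 * σg ^ 2) (n := a.ng)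
    (R := fun ω => (1 - Lg⁻¹ * μg) * ‖yIt p a ξ init k t ω - p.yStar (xRV p a ξ init k ω)‖ ^ 2
      + Lg⁻¹ ^ 2 * (σg ^ 2 / a.ng))
    (hgr.fun_const_smul _)
    ((measurable_snd.sub ((A.measurable_gradY_g measurable_fst measurable_snd).fun_const_smul
      Lg⁻¹)).sub (A.measurable_yStar hμ measurable_fst))
    measurable_const
    (fun s => ((A.gy_int s.1 s.2).sub (integrable_const _)).fun_smul _)
    (fun s => by
      rw [integral_smul, integral_sub (A.gy_int s.1 s.2) (integrable_const _), A.gy_mean]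
      simp)
    (fun s => by
      simp only [norm_smul, mul_pow]
      exact (A.g_var_int s.1 s.2).const_mul _)
    (fun s => by
      simp only [norm_smul, mul_pow]
      rw [integral_const_mul, norm_neg, Real.norm_eq_abs, sq_abs]
      exact mul_le_mul_of_nonneg_left (A.g_var s.1 s.2) (by positivity))
    hn ((h.const_mul _).add (integrable_const _))
    (fun ω => by
      have h3 := A.norm_gradient_step_sub_yStar_le hμ hL hμL (xRV p a ξ init k ω)
        (yIt p a ξ init k t ω)
      have h4 := pow_le_pow_left₀ (norm_nonneg _) h3 2
      -- The square of the contraction factor is weakened to the factor itself, so that the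
      -- variances sum to s/q with q = μ/L_g.
      have h5 : (1 - Lg⁻¹ * μg) ^ 2 ≤ 1 - Lg⁻¹ * μg := by nlinarith
      have h6 := mul_le_mul_of_nonneg_right h5
        (sq_nonneg ‖yIt p a ξ init k t ω - p.yStar (xRV p a ξ init k ω)‖)
      rw [mul_pow] at h4
      rw [mul_div_assoc]
      linarith)
  have e : ∀ ω, yIt p a ξ init k (t + 1) ω - p.yStar (xRV p a ξ init k ω)
      = (yIt p a ξ init k t ω - Lg⁻¹ • gradY p.g (xRV p a ξ init k ω) (yIt p a ξ init k t ω)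
        - p.yStar (xRV p a ξ init k ω)) + batchAvg a.ng (fun i => (-Lg⁻¹) •
          (gradY (p.ghat (ξ (.g k t i) ω)) (xRV p a ξ init k ω) (yIt p a ξ init k t ω)
            - gradY p.g (xRV p a ξ init k ω) (yIt p a ξ init k t ω))) := by
    intro ω
    rw [batchAvg_smul_sub hn, yIt_succ, hα]
    module
  simp only [e]
  refine ⟨h1, h2.trans_eq ?_⟩
  rw [integral_add (h.const_mul _) (integrable_const _), integral_const_mul]
  simp

theorem Assumptions.integral_sq_norm_yRV
    (A : p.Assumptions μg Lg Lg' Lf Mg B σf σg σgxy σgyy) (hμ : 0 < μg) (hL : 0 < Lg)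
    (hμL : μg ≤ Lg) (hS : Sampling p P ξ init) (hα : a.α = Lg⁻¹) (hn : 1 ≤ a.ng) (k : ℕ)
    (h : Integrable (fun ω => ‖yIt p a ξ init k 0 ω - p.yStar (xRV p a ξ init k ω)‖ ^ 2) P) :
    Integrable (fun ω => ‖yRV p a ξ init k ω - p.yStar (xRV p a ξ init k ω)‖ ^ 2) P ∧
    ∫ ω, ‖yRV p a ξ init k ω - p.yStar (xRV p a ξ init k ω)‖ ^ 2 ∂P
      ≤ (1 - Lg⁻¹ * μg) ^ a.T *
          ∫ ω, ‖yIt p a ξ init k 0 ω - p.yStar (xRV p a ξ init k ω)‖ ^ 2 ∂P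
        + Lg⁻¹ ^ 2 * (σg ^ 2 / a.ng) / (Lg⁻¹ * μg) := by
  have hint : ∀ t, Integrable
      (fun ω => ‖yIt p a ξ init k t ω - p.yStar (xRV p a ξ init k ω)‖ ^ 2) P := by
    intro t
    induction t with
    | zero => exact h
    | succ t ih => exact (A.integral_sq_norm_yIt_succ hμ hL hμL hS hα hn k t ih).1
  exact ⟨hint a.T, le_geometric_add
    (b := fun t => ∫ ω, ‖yIt p a ξ init k t ω - p.yStar (xRV p a ξ init k ω)‖ ^ 2 ∂P)
    (by positivity) (by rwa [inv_mul_le_iff₀ hL, mul_one])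
    (fun t => (A.integral_sq_norm_yIt_succ hμ hL hμL hS hα hn k t (hint t)).2)
    (by positivity) a.T⟩

/-! ### The stochastic gradients of the outer cost -/

omit mΩ in
theorem Assumptions.measurable_xRV_yRV_outsideBatch
    (A : p.Assumptions μg Lg Lg' Lf Mg B σf σg σgxy σgyy) (k : ℕ) :
    Measurable[outsideBatch ξ init fun i => .f k i]
      (fun ω => (xRV p a ξ init k ω, yRV p a ξ init k ω)) :=
  A.measurable_xRV_yIt (mΩ := outsideBatch ξ init fun i => .f k i)
    (measurable_init_outsideBatch ξ init _)
    (fun s hs => measurable_sample_outsideBatch fun i hi => by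
      rw [← hi] at hs; exact lt_irrefl _ hs)
    (fun t' _ i => measurable_sample_outsideBatch fun j hj => by simp at hj)

theorem Assumptions.integral_sq_norm_uRV
    (A : p.Assumptions μg Lg Lg' Lf Mg B σf σg σgxy σgyy) (hS : Sampling p P ξ init)
    (hn : 1 ≤ a.nf) (k : ℕ) :
    Integrable (fun ω => ‖uRV p a ξ init k ω
      - gradX p.f (xRV p a ξ init k ω) (yRV p a ξ init k ω)‖ ^ 2) P ∧
    ∫ ω, ‖uRV p a ξ init k ω - gradX p.f (xRV p a ξ init k ω) (yRV p a ξ init k ω)‖ ^ 2 ∂P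
      ≤ σf ^ 2 / a.nf := by
  have hprob := hS.prob
  have hlaw := A.prob
  have hm : Measurable (fun q : Ξ × (Vec dx × Vec dy) =>
      gradX (p.fhat q.1) q.2.1 q.2.2 - gradX p.f q.2.1 q.2.2) :=
    (measurable_gradX A.fhat_diff A.fhat_meas measurable_fst
      measurable_snd.fst measurable_snd.snd).sub
    (A.measurable_gradX_f measurable_snd.fst measurable_snd.snd)
  have hi := fun s : Vec dx × Vec dy => integrable_and_integral_le_of_le
    ((hm.comp measurable_prodMk_right).norm.pow_const 2) (fun _ => by positivity)
    (A.f_var_int s.1 s.2) (fun x => le_add_of_nonneg_right (by positivity))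
  obtain ⟨h1, h2⟩ := hS.integral_sq_norm_add_batch_le_of_le (ℓ := fun i => .f k i)
    (fun i j hij => by simpa using hij) (A.measurable_xRV_yRV_outsideBatch (a := a) k)
    (Φ := fun x s => gradX (p.fhat x) s.1 s.2 - gradX p.f s.1 s.2)
    (a := fun _ => 0) (v := fun _ => σf ^ 2) (n := a.nf) (R := fun ω => σf ^ 2 / a.nf)
    hm measurable_const measurable_const
    (fun s => (A.fx_int s.1 s.2).sub (integrable_const _))
    (fun s => by
      rw [integral_sub (A.fx_int s.1 s.2) (integrable_const _), A.fx_mean]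
      simp)
    (fun s => (hi s).1) (fun s => (hi s).2.trans (A.f_var s.1 s.2))
    hn (integrable_const _) (fun ω => by simp)
  simp only [zero_add, batchAvg_sub hn] at h1 h2
  exact ⟨h1, h2.trans_eq (by simp)⟩

theorem Assumptions.integral_sq_norm_vRV
    (A : p.Assumptions μg Lg Lg' Lf Mg B σf σg σgxy σgyy) (hS : Sampling p P ξ init)
    (hn : 1 ≤ a.nf) (k : ℕ) :
    Integrable (fun ω => ‖vRV p a ξ init k ω
      - gradY p.f (xRV p a ξ init k ω) (yRV p a ξ init k ω)‖ ^ 2) P ∧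
    ∫ ω, ‖vRV p a ξ init k ω - gradY p.f (xRV p a ξ init k ω) (yRV p a ξ init k ω)‖ ^ 2 ∂P
      ≤ σf ^ 2 / a.nf := by
  have hprob := hS.prob
  have hlaw := A.prob
  have hm : Measurable (fun q : Ξ × (Vec dx × Vec dy) =>
      gradY (p.fhat q.1) q.2.1 q.2.2 - gradY p.f q.2.1 q.2.2) :=
    (measurable_gradY A.fhat_diff A.fhat_meas measurable_fst
      measurable_snd.fst measurable_snd.snd).sub
    (A.measurable_gradY_f measurable_snd.fst measurable_snd.snd)
  have hi := fun s : Vec dx × Vec dy => integrable_and_integral_le_of_le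
    ((hm.comp measurable_prodMk_right).norm.pow_const 2) (fun _ => by positivity)
    (A.f_var_int s.1 s.2) (fun x => le_add_of_nonneg_left (by positivity))
  obtain ⟨h1, h2⟩ := hS.integral_sq_norm_add_batch_le_of_le (ℓ := fun i => .f k i)
    (fun i j hij => by simpa using hij) (A.measurable_xRV_yRV_outsideBatch (a := a) k)
    (Φ := fun x s => gradY (p.fhat x) s.1 s.2 - gradY p.f s.1 s.2)
    (a := fun _ => 0) (v := fun _ => σf ^ 2) (n := a.nf) (R := fun ω => σf ^ 2 / a.nf)
    hm measurable_const measurable_const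
    (fun s => (A.fy_int s.1 s.2).sub (integrable_const _))
    (fun s => by
      rw [integral_sub (A.fy_int s.1 s.2) (integrable_const _), A.fy_mean]
      simp)
    (fun s => (hi s).1) (fun s => (hi s).2.trans (A.f_var s.1 s.2))
    hn (integrable_const _) (fun ω => by simp)
  simp only [zero_add, batchAvg_sub hn] at h1 h2
  exact ⟨h1, h2.trans_eq (by simp)⟩

end Problem

theorem sq_norm_add_le {E : Type*} [NormedAddCommGroup E] (v w : E) :
    ‖v + w‖ ^ 2 ≤ 2 * ‖v‖ ^ 2 + 2 * ‖w‖ ^ 2 := by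
  have := pow_le_pow_left₀ (norm_nonneg _) (norm_add_le v w) 2
  nlinarith [sq_nonneg (‖v‖ - ‖w‖)]

theorem sq_norm_sub_le {E : Type*} [NormedAddCommGroup E] (v w : E) :
    ‖v - w‖ ^ 2 ≤ 2 * ‖v‖ ^ 2 + 2 * ‖w‖ ^ 2 := by
  rw [sub_eq_add_neg, ← norm_neg w]
  exact sq_norm_add_le v (-w)

/-- Young's inequality with weight θ: (1 + θ)(1 - θ)² ≤ 1 - θ preserves a contraction, and (1 +
1/θ)b² ≤ 2b/m multiplies the perturbation. -/
theorem sq_contraction_add_le {θ b m R E : ℝ} (hm : 0 < m) (hb : 0 < b) (hθ : θ = b * m)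
    (hθ1 : θ ≤ 1) : ((1 - θ) * R + b * E) ^ 2 ≤ (1 - θ) * R ^ 2 + 2 * b / m * E ^ 2 := by
  have hθ0 : 0 < θ := by rw [hθ]; positivity
  have h1 : 2 * ((1 - θ) * R) * (b * E) ≤ θ * ((1 - θ) * R) ^ 2 + (b * E) ^ 2 / θ := by
    have : 0 ≤ (θ * ((1 - θ) * R) - b * E) ^ 2 / θ := by positivity
    have e : (θ * ((1 - θ) * R) - b * E) ^ 2 / θ = θ * ((1 - θ) * R) ^ 2 + (b * E) ^ 2 / θ
      - 2 * ((1 - θ) * R) * (b * E) := by field_simp; ring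
    linarith
  have h2 : (b * E) ^ 2 / θ = b / m * E ^ 2 := by rw [hθ]; field_simp
  have h3 : (b * E) ^ 2 ≤ (b * E) ^ 2 / θ := le_div_self (by positivity) hθ0 hθ1
  have h4 : (1 + θ) * (1 - θ) ^ 2 ≤ 1 - θ := by
      nlinarith [mul_nonneg (sub_nonneg.2 hθ1) (sq_nonneg θ)]
  have h5 := mul_le_mul_of_nonneg_right h4 (sq_nonneg R)
  have h6 : 2 * b / m * E ^ 2 = b / m * E ^ 2 + b / m * E ^ 2 := by ring
  nlinarith

namespace Problem

variable {dx dy : ℕ} {Ξ : Type*} [MeasurableSpace Ξ] {p : Problem dx dy Ξ} {a : Params}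
  {Ω : Type*} [mΩ : MeasurableSpace Ω] {P : Measure Ω} {ξ : Sample → Ω → Ξ}
  {init : Ω → State dx dy} {μg Lg Lg' Lf Mg B σf σg σgxy σgyy : ℝ}

/-! ### The inner algorithm for `z` -/

/-- The error z - z⋆ is mapped by I - bH and shifted by -b(v - ∂_y f). The same v serves in all
steps of a loop, so its error is treated as a perturbation, not as fresh noise. -/
theorem Assumptions.sq_norm_quadratic_step_le
    (A : p.Assumptions μg Lg Lg' Lf Mg B σf σg σgxy σgyy) (hμ : 0 < μg) (hL : 0 < Lg)
    (hμL : μg ≤ Lg) (x : Vec dx) (y v z : Vec dy) :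
    ‖z - (2 * Lg)⁻¹ • (hessYY p.g x y z + v) - p.zStar x y‖ ^ 2
      ≤ (1 - (2 * Lg)⁻¹ * μg) * ‖z - p.zStar x y‖ ^ 2
        + 2 * (2 * Lg)⁻¹ / μg * ‖v - gradY p.f x y‖ ^ 2 := by
  have e : z - (2 * Lg)⁻¹ • (hessYY p.g x y z + v) - p.zStar x y
      = (z - p.zStar x y - (2 * Lg)⁻¹ • hessYY p.g x y (z - p.zStar x y))
        - (2 * Lg)⁻¹ • (v - gradY p.f x y) := by
    rw [map_sub, A.hessYY_zStar hμ]
    module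
  rw [e]
  have h1 := norm_sub_le (z - p.zStar x y - (2 * Lg)⁻¹ • hessYY p.g x y (z - p.zStar x y))
    ((2 * Lg)⁻¹ • (v - gradY p.f x y))
  have h2 := A.norm_sub_smul_hessYY_le hL hμL x y (z - p.zStar x y)
  rw [norm_smul, Real.norm_of_nonneg (by positivity)] at h1
  refine (pow_le_pow_left₀ (norm_nonneg _) (h1.trans (add_le_add_left h2 _)) 2).trans ?_
  exact sq_contraction_add_le hμ (by positivity) rfl
    (by rw [inv_mul_le_iff₀ (by positivity)]; linarith)

theorem Assumptions.sq_norm_le (A : p.Assumptions μg Lg Lg' Lf Mg B σf σg σgxy σgyy)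
    (hμ : 0 < μg) (x : Vec dx) (y z : Vec dy) :
    ‖z‖ ^ 2 ≤ 2 * ‖z - p.zStar x y‖ ^ 2 + 2 * (μg⁻¹ * B) ^ 2 := by
  have h1 := sq_norm_add_le (z - p.zStar x y) (p.zStar x y)
  have h2 := pow_le_pow_left₀ (norm_nonneg _) (A.norm_zStar_le hμ x y) 2
  rw [sub_add_cancel] at h1
  linarith

/-- The Hessian noise is multiplicative: its variance is proportional to ‖z‖² ≤ 2‖z - z⋆‖² +
2(B/μ)². By `hσ` the first part consumes at most half of the contraction, whence the rate bμ/2; the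
second is a constant floor. -/
theorem Assumptions.integral_sq_norm_zIt_succ
    (A : p.Assumptions μg Lg Lg' Lf Mg B σf σg σgxy σgyy) (hμ : 0 < μg) (hL : 0 < Lg)
    (hμL : μg ≤ Lg) (hS : Sampling p P ξ init) (hβ : a.β = (2 * Lg)⁻¹) (hn : 1 ≤ a.ngyy)
    (hnf : 1 ≤ a.nf)
    (hσ : 2 * (2 * Lg)⁻¹ ^ 2 * (σgyy ^ 2 / a.ngyy) ≤ (2 * Lg)⁻¹ * μg / 2) (k n : ℕ)
    (h : Integrable (fun ω => ‖zIt p a ξ init k n ω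
      - p.zStar (xRV p a ξ init k ω) (yRV p a ξ init k ω)‖ ^ 2) P) :
    Integrable (fun ω => ‖zIt p a ξ init k (n + 1) ω
      - p.zStar (xRV p a ξ init k ω) (yRV p a ξ init k ω)‖ ^ 2) P ∧
    ∫ ω, ‖zIt p a ξ init k (n + 1) ω
      - p.zStar (xRV p a ξ init k ω) (yRV p a ξ init k ω)‖ ^ 2 ∂P
      ≤ (1 - (2 * Lg)⁻¹ * μg / 2) * ∫ ω, ‖zIt p a ξ init k n ω
          - p.zStar (xRV p a ξ init k ω) (yRV p a ξ init k ω)‖ ^ 2 ∂P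
        + (2 * (2 * Lg)⁻¹ / μg * (σf ^ 2 / a.nf)
          + 2 * (2 * Lg)⁻¹ ^ 2 * (σgyy ^ 2 / a.ngyy) * (μg⁻¹ * B) ^ 2) := by
  have hprob := hS.prob
  have hlaw := A.prob
  obtain ⟨hv1, hv2⟩ := A.integral_sq_norm_vRV hS hnf k
  have hx : Measurable (fun q : Ξ × (Vec dx × Vec dy × Vec dy × Vec dy) => q.2.1) :=
    measurable_snd.fst
  have hy : Measurable (fun q : Ξ × (Vec dx × Vec dy × Vec dy × Vec dy) => q.2.2.1) :=
    measurable_snd.snd.fst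
  have hz : Measurable (fun q : Ξ × (Vec dx × Vec dy × Vec dy × Vec dy) => q.2.2.2.2) :=
    measurable_snd.snd.snd.snd
  have hm : Measurable (fun q : Ξ × (Vec dx × Vec dy × Vec dy × Vec dy) =>
      hessYY (p.ghat q.1) q.2.1 q.2.2.1 q.2.2.2.2 - hessYY p.g q.2.1 q.2.2.1 q.2.2.2.2) :=
    (measurable_hessYY_apply A.ghat_diff A.ghat_meas measurable_fst hx hy hz).sub
      (A.measurable_hessYY_g hx hy hz)
  have hv := fun s : Vec dx × Vec dy × Vec dy × Vec dy =>
    integral_sq_norm_apply_le (A.gyy_var_int s.1 s.2.1) (A.gyy_var s.1 s.2.1) s.2.2.2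
  simp only [sub_apply] at hv
  have hint := fun s : Vec dx × Vec dy × Vec dy × Vec dy =>
    (A.gyy_int s.1 s.2.1).apply_continuousLinearMap s.2.2.2
  have hmX : Measurable[outsideBatch ξ init fun i => .gyy k n i] (fun ω => (xRV p a ξ init k ω,
      yRV p a ξ init k ω, vRV p a ξ init k ω, zIt p a ξ init k n ω)) :=
    A.measurable_xRV_yRV_vRV_zIt (mΩ := outsideBatch ξ init fun i => .gyy k n i)
      (measurable_init_outsideBatch ξ init _)
      (fun s hs => measurable_sample_outsideBatch fun i hi => by
        rw [← hi] at hs; exact lt_irrefl _ hs)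
      (fun t i => measurable_sample_outsideBatch fun j hj => by simp at hj)
      (fun i => measurable_sample_outsideBatch fun j hj => by simp at hj)
      (fun n' hn' i => measurable_sample_outsideBatch fun j hj => by
        simp only [Sample.gyy.injEq] at hj; omega)
  obtain ⟨h1, h2⟩ := hS.integral_sq_norm_add_batch_le_of_le (ℓ := fun i => .gyy k n i)
    (fun i j hij => by simpa using hij) hmX
    (Φ := fun x s => (-(2 * Lg)⁻¹) •
      (hessYY (p.ghat x) s.1 s.2.1 s.2.2.2 - hessYY p.g s.1 s.2.1 s.2.2.2))
    (a := fun s => s.2.2.2 - (2 * Lg)⁻¹ • (hessYY p.g s.1 s.2.1 s.2.2.2 + s.2.2.1)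
      - p.zStar s.1 s.2.1)
    (v := fun s => (2 * Lg)⁻¹ ^ 2 * (σgyy ^ 2 * ‖s.2.2.2‖ ^ 2)) (n := a.ngyy)
    (R := fun ω => (1 - (2 * Lg)⁻¹ * μg / 2) * ‖zIt p a ξ init k n ω
          - p.zStar (xRV p a ξ init k ω) (yRV p a ξ init k ω)‖ ^ 2
      + (2 * (2 * Lg)⁻¹ / μg * ‖vRV p a ξ init k ω
          - gradY p.f (xRV p a ξ init k ω) (yRV p a ξ init k ω)‖ ^ 2
        + 2 * (2 * Lg)⁻¹ ^ 2 * (σgyy ^ 2 / a.ngyy) * (μg⁻¹ * B) ^ 2))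
    (hm.fun_const_smul _)
    ((measurable_snd.snd.snd.sub (((A.measurable_hessYY_g measurable_fst measurable_snd.fst
      measurable_snd.snd.snd).add measurable_snd.snd.fst).fun_const_smul
      (2 * Lg)⁻¹)).sub (A.measurable_zStar hμ measurable_fst measurable_snd.fst))
    (((measurable_snd.snd.snd.norm.pow_const 2).const_mul _).const_mul _)
    (fun s => ((hint s).sub (integrable_const _)).fun_smul _)
    (fun s => by
      rw [integral_smul, integral_sub (hint s) (integrable_const _),
        ← ContinuousLinearMap.integral_apply (A.gyy_int s.1 s.2.1), A.gyy_mean]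
      simp)
    (fun s => by
      simp only [norm_smul, mul_pow]
      exact (hv s).1.const_mul _)
    (fun s => by
      simp only [norm_smul, mul_pow]
      rw [integral_const_mul, norm_neg, Real.norm_eq_abs, sq_abs]
      exact mul_le_mul_of_nonneg_left (hv s).2 (by positivity))
    hn ((h.const_mul _).add ((hv1.const_mul _).add (integrable_const _)))
    (fun ω => by
      have h3 := A.sq_norm_quadratic_step_le hμ hL hμL (xRV p a ξ init k ω) (yRV p a ξ init k ω)
        (vRV p a ξ init k ω) (zIt p a ξ init k n ω)
      have h4 := A.sq_norm_le hμ (xRV p a ξ init k ω) (yRV p a ξ init k ω)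
        (zIt p a ξ init k n ω)
      have h5 : 0 ≤ (2 * Lg)⁻¹ ^ 2 * (σgyy ^ 2 / a.ngyy) := by positivity
      have h6 := mul_le_mul_of_nonneg_left h4 h5
      have h7 := mul_le_mul_of_nonneg_right hσ (sq_nonneg ‖zIt p a ξ init k n ω
          - p.zStar (xRV p a ξ init k ω) (yRV p a ξ init k ω)‖)
      have h8 : (2 * Lg)⁻¹ ^ 2 * (σgyy ^ 2 * ‖zIt p a ξ init k n ω‖ ^ 2) / a.ngyy
        = (2 * Lg)⁻¹ ^ 2 * (σgyy ^ 2 / a.ngyy) * ‖zIt p a ξ init k n ω‖ ^ 2 := by ring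
      rw [h8]
      linarith)
  have e : ∀ ω, zIt p a ξ init k (n + 1) ω
        - p.zStar (xRV p a ξ init k ω) (yRV p a ξ init k ω)
      = (zIt p a ξ init k n ω - (2 * Lg)⁻¹ • (hessYY p.g (xRV p a ξ init k ω)
          (yRV p a ξ init k ω) (zIt p a ξ init k n ω) + vRV p a ξ init k ω)
        - p.zStar (xRV p a ξ init k ω) (yRV p a ξ init k ω)) + batchAvg a.ngyy (fun i =>
          (-(2 * Lg)⁻¹) • (hessYY (p.ghat (ξ (.gyy k n i) ω)) (xRV p a ξ init k ω)
            (yRV p a ξ init k ω) (zIt p a ξ init k n ω)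
            - hessYY p.g (xRV p a ξ init k ω) (yRV p a ξ init k ω) (zIt p a ξ init k n ω))) := by
    intro ω
    rw [batchAvg_smul_sub hn, zIt_succ, hβ]
    module
  simp only [e]
  refine ⟨h1, h2.trans ?_⟩
  have hv3 : Integrable (fun ω => 2 * (2 * Lg)⁻¹ / μg * ‖vRV p a ξ init k ω
          - gradY p.f (xRV p a ξ init k ω) (yRV p a ξ init k ω)‖ ^ 2
        + 2 * (2 * Lg)⁻¹ ^ 2 * (σgyy ^ 2 / a.ngyy) * (μg⁻¹ * B) ^ 2) P :=
    (hv1.const_mul _).add (integrable_const _)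
  rw [integral_add (h.const_mul _) hv3, integral_const_mul,
    integral_add (hv1.const_mul _) (integrable_const _), integral_const_mul, integral_const]
  simp only [probReal_univ, one_smul]
  gcongr

theorem Assumptions.integral_sq_norm_zRV
    (A : p.Assumptions μg Lg Lg' Lf Mg B σf σg σgxy σgyy) (hμ : 0 < μg) (hL : 0 < Lg)
    (hμL : μg ≤ Lg) (hS : Sampling p P ξ init) (hβ : a.β = (2 * Lg)⁻¹) (hn : 1 ≤ a.ngyy)
    (hnf : 1 ≤ a.nf)
    (hσ : 2 * (2 * Lg)⁻¹ ^ 2 * (σgyy ^ 2 / a.ngyy) ≤ (2 * Lg)⁻¹ * μg / 2) (k : ℕ)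
    (h : Integrable (fun ω => ‖zIt p a ξ init k 0 ω
      - p.zStar (xRV p a ξ init k ω) (yRV p a ξ init k ω)‖ ^ 2) P) :
    Integrable (fun ω => ‖zRV p a ξ init k ω
      - p.zStar (xRV p a ξ init k ω) (yRV p a ξ init k ω)‖ ^ 2) P ∧
    ∫ ω, ‖zRV p a ξ init k ω
      - p.zStar (xRV p a ξ init k ω) (yRV p a ξ init k ω)‖ ^ 2 ∂P
      ≤ (1 - (2 * Lg)⁻¹ * μg / 2) ^ a.N * ∫ ω, ‖zIt p a ξ init k 0 ω
          - p.zStar (xRV p a ξ init k ω) (yRV p a ξ init k ω)‖ ^ 2 ∂P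
        + (2 * (2 * Lg)⁻¹ / μg * (σf ^ 2 / a.nf)
          + 2 * (2 * Lg)⁻¹ ^ 2 * (σgyy ^ 2 / a.ngyy) * (μg⁻¹ * B) ^ 2)
            / ((2 * Lg)⁻¹ * μg / 2) := by
  have hint : ∀ n, Integrable (fun ω => ‖zIt p a ξ init k n ω
      - p.zStar (xRV p a ξ init k ω) (yRV p a ξ init k ω)‖ ^ 2) P := by
    intro n
    induction n with
    | zero => exact h
    | succ n ih => exact (A.integral_sq_norm_zIt_succ hμ hL hμL hS hβ hn hnf hσ k n ih).1
  have hq : (2 * Lg)⁻¹ * μg ≤ 1 := by rw [inv_mul_le_iff₀ (by positivity)]; linarith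
  exact ⟨hint a.N, le_geometric_add (b := fun n => ∫ ω, ‖zIt p a ξ init k n ω
      - p.zStar (xRV p a ξ init k ω) (yRV p a ξ init k ω)‖ ^ 2 ∂P)
    (by positivity) (by linarith)
    (fun n => (A.integral_sq_norm_zIt_succ hμ hL hμL hS hβ hn hnf hσ k n (hint n)).2)
    (by positivity) a.N⟩

/-! ### The stochastic hypergradient -/

theorem Assumptions.integral_sq_norm_wRV
    (A : p.Assumptions μg Lg Lg' Lf Mg B σf σg σgxy σgyy) (hμ : 0 < μg)
    (hS : Sampling p P ξ init) (hn : 1 ≤ a.ngxy) (k : ℕ)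
    (h : Integrable (fun ω => ‖zRV p a ξ init k ω
      - p.zStar (xRV p a ξ init k ω) (yRV p a ξ init k ω)‖ ^ 2) P) :
    Integrable (fun ω => ‖wRV p a ξ init k ω
      - jacXY p.g (xRV p a ξ init k ω) (yRV p a ξ init k ω) (zRV p a ξ init k ω)‖ ^ 2) P ∧
    ∫ ω, ‖wRV p a ξ init k ω
      - jacXY p.g (xRV p a ξ init k ω) (yRV p a ξ init k ω) (zRV p a ξ init k ω)‖ ^ 2 ∂P
      ≤ σgxy ^ 2 / a.ngxy * (2 * ∫ ω, ‖zRV p a ξ init k ω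
          - p.zStar (xRV p a ξ init k ω) (yRV p a ξ init k ω)‖ ^ 2 ∂P + 2 * (μg⁻¹ * B) ^ 2) := by
  have hprob := hS.prob
  have hlaw := A.prob
  have hx : Measurable (fun q : Ξ × (Vec dx × Vec dy × Vec dy × Vec dy) => q.2.1) :=
    measurable_snd.fst
  have hy : Measurable (fun q : Ξ × (Vec dx × Vec dy × Vec dy × Vec dy) => q.2.2.1) :=
    measurable_snd.snd.fst
  have hz : Measurable (fun q : Ξ × (Vec dx × Vec dy × Vec dy × Vec dy) => q.2.2.2.2) :=
    measurable_snd.snd.snd.snd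
  have hm : Measurable (fun q : Ξ × (Vec dx × Vec dy × Vec dy × Vec dy) =>
      jacXY (p.ghat q.1) q.2.1 q.2.2.1 q.2.2.2.2 - jacXY p.g q.2.1 q.2.2.1 q.2.2.2.2) :=
    (measurable_jacXY_apply A.ghat_diff A.ghat_meas measurable_fst hx hy hz).sub
      (A.measurable_jacXY_g hx hy hz)
  have hv := fun s : Vec dx × Vec dy × Vec dy × Vec dy =>
    integral_sq_norm_apply_le (A.gxy_var_int s.1 s.2.1) (A.gxy_var s.1 s.2.1) s.2.2.2
  simp only [sub_apply] at hv
  have hint := fun s : Vec dx × Vec dy × Vec dy × Vec dy =>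
    (A.gxy_int s.1 s.2.1).apply_continuousLinearMap s.2.2.2
  have hmX : Measurable[outsideBatch ξ init fun i => .gxy k i] (fun ω => (xRV p a ξ init k ω,
      yRV p a ξ init k ω, vRV p a ξ init k ω, zRV p a ξ init k ω)) :=
    A.measurable_xRV_yRV_vRV_zIt (mΩ := outsideBatch ξ init fun i => .gxy k i)
      (measurable_init_outsideBatch ξ init _)
      (fun s hs => measurable_sample_outsideBatch fun i hi => by
        rw [← hi] at hs; exact lt_irrefl _ hs)
      (fun t i => measurable_sample_outsideBatch fun j hj => by simp at hj)
      (fun i => measurable_sample_outsideBatch fun j hj => by simp at hj)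
      (fun n' _ i => measurable_sample_outsideBatch fun j hj => by simp at hj)
  obtain ⟨h1, h2⟩ := hS.integral_sq_norm_add_batch_le_of_le (ℓ := fun i => .gxy k i)
    (fun i j hij => by simpa using hij) hmX
    (Φ := fun x s => jacXY (p.ghat x) s.1 s.2.1 s.2.2.2 - jacXY p.g s.1 s.2.1 s.2.2.2)
    (a := fun s => 0)
    (v := fun s => σgxy ^ 2 * ‖s.2.2.2‖ ^ 2) (n := a.ngxy)
    (R := fun ω => σgxy ^ 2 / a.ngxy * (2 * ‖zRV p a ξ init k ω
          - p.zStar (xRV p a ξ init k ω) (yRV p a ξ init k ω)‖ ^ 2 + 2 * (μg⁻¹ * B) ^ 2))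
    hm measurable_const ((measurable_snd.snd.snd.norm.pow_const 2).const_mul _)
    (fun s => (hint s).sub (integrable_const _))
    (fun s => by
      rw [integral_sub (hint s) (integrable_const _),
        ← ContinuousLinearMap.integral_apply (A.gxy_int s.1 s.2.1), A.gxy_mean]
      simp)
    (fun s => (hv s).1) (fun s => (hv s).2)
    hn (((h.const_mul _).add (integrable_const _)).const_mul _)
    (fun ω => by
      have h4 := A.sq_norm_le hμ (xRV p a ξ init k ω) (yRV p a ξ init k ω) (zRV p a ξ init k ω)
      have h5 : 0 ≤ σgxy ^ 2 / a.ngxy := by positivity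
      have h6 := mul_le_mul_of_nonneg_left h4 h5
      have h8 : σgxy ^ 2 * ‖zRV p a ξ init k ω‖ ^ 2 / a.ngxy
        = σgxy ^ 2 / a.ngxy * ‖zRV p a ξ init k ω‖ ^ 2 := by ring
      simp only [norm_zero, ne_eq, OfNat.ofNat_ne_zero, not_false_eq_true, zero_pow, zero_add]
      rw [h8]
      exact h6)
  simp only [zero_add, batchAvg_sub hn] at h1 h2
  refine ⟨h1, h2.trans_eq ?_⟩
  rw [integral_const_mul, integral_add (h.const_mul _) (integrable_const _), integral_const_mul,
    integral_const]
  simp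

/-- Four sources of error: the noise of u, the noise of w, the Jacobian applied to z - z⋆, and the
change of the hypergradient from y to y⋆(x). The factor 4 comes from two levels of ‖v + w‖² ≤ 2‖v‖²
+ 2‖w‖². -/
theorem Assumptions.integral_sq_norm_hyperGrad_error
    (A : p.Assumptions μg Lg Lg' Lf Mg B σf σg σgxy σgyy) (hμ : 0 < μg) (hL' : 0 ≤ Lg')
    (hS : Sampling p P ξ init) (hn : 1 ≤ a.ngxy) (hnf : 1 ≤ a.nf) (k : ℕ)
    (hy : Integrable (fun ω => ‖yRV p a ξ init k ω - p.yStar (xRV p a ξ init k ω)‖ ^ 2) P)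
    (hz : Integrable (fun ω => ‖zRV p a ξ init k ω
      - p.zStar (xRV p a ξ init k ω) (yRV p a ξ init k ω)‖ ^ 2) P) :
    Integrable (fun ω => ‖uRV p a ξ init k ω + wRV p a ξ init k ω
      - p.hyperGrad (xRV p a ξ init k ω) (p.yStar (xRV p a ξ init k ω))‖ ^ 2) P ∧
    ∫ ω, ‖uRV p a ξ init k ω + wRV p a ξ init k ω
      - p.hyperGrad (xRV p a ξ init k ω) (p.yStar (xRV p a ξ init k ω))‖ ^ 2 ∂P
      ≤ 4 * (σf ^ 2 / a.nf + σgxy ^ 2 / a.ngxy * (2 * ∫ ω, ‖zRV p a ξ init k ω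
          - p.zStar (xRV p a ξ init k ω) (yRV p a ξ init k ω)‖ ^ 2 ∂P + 2 * (μg⁻¹ * B) ^ 2)
        + Lg' ^ 2 * ∫ ω, ‖zRV p a ξ init k ω
          - p.zStar (xRV p a ξ init k ω) (yRV p a ξ init k ω)‖ ^ 2 ∂P
        + hyperConst μg Lg' Lf Mg B ^ 2 *
          ∫ ω, ‖yRV p a ξ init k ω - p.yStar (xRV p a ξ init k ω)‖ ^ 2 ∂P) := by
  have hprob := hS.prob
  obtain ⟨hu1, hu2⟩ := A.integral_sq_norm_uRV hS hnf k
  obtain ⟨hw1, hw2⟩ := A.integral_sq_norm_wRV hμ hS hn k hz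
  have hxm := A.measurable_xRV (a := a) hS k
  have hI := (((hu1.add hw1).add (hz.const_mul (Lg' ^ 2))).add
    (hy.const_mul (hyperConst μg Lg' Lf Mg B ^ 2))).const_mul 4
  obtain ⟨h1, h2⟩ := integrable_and_integral_le_of_le (F := fun ω => ‖uRV p a ξ init k ω
      + wRV p a ξ init k ω
      - p.hyperGrad (xRV p a ξ init k ω) (p.yStar (xRV p a ξ init k ω))‖ ^ 2)
    ((((A.measurable_uRV hS k).add (A.measurable_wRV hS k)).sub
      (A.measurable_hyperGrad hμ hL' hxm (A.measurable_yStar hμ hxm))).norm.pow_const 2)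
    (fun ω => by positivity) hI (fun ω => by
      simp only [Pi.add_apply]
      set x := xRV p a ξ init k ω
      set y := yRV p a ξ init k ω
      set z := zRV p a ξ init k ω
      set u := uRV p a ξ init k ω
      set w := wRV p a ξ init k ω
      have e : u + w - p.hyperGrad x (p.yStar x) = ((u - gradX p.f x y) + (w - jacXY p.g x y z))
          + (jacXY p.g x y (z - p.zStar x y)
            + (p.hyperGrad x y - p.hyperGrad x (p.yStar x))) := by
        rw [show p.hyperGrad x y = gradX p.f x y + jacXY p.g x y (p.zStar x y) from rfl, map_sub]
        abel
      have h3 := (jacXY p.g x y).le_of_opNorm_le (A.norm_jacXY_le hL' x y) (z - p.zStar x y)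
      have h4 := A.norm_hyperGrad_sub_le hμ hL' x x y (p.yStar x)
      rw [sub_self, pairNorm_zero_left] at h4
      have h5 := pow_le_pow_left₀ (norm_nonneg _) h3 2
      have h6 := pow_le_pow_left₀ (norm_nonneg _) h4 2
      rw [mul_pow] at h5 h6
      rw [e]
      have h7 := sq_norm_add_le ((u - gradX p.f x y) + (w - jacXY p.g x y z))
        (jacXY p.g x y (z - p.zStar x y) + (p.hyperGrad x y - p.hyperGrad x (p.yStar x)))
      have h8 := sq_norm_add_le (u - gradX p.f x y) (w - jacXY p.g x y z)
      have h9 := sq_norm_add_le (jacXY p.g x y (z - p.zStar x y))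
        (p.hyperGrad x y - p.hyperGrad x (p.yStar x))
      linarith)
  refine ⟨h1, h2.trans ?_⟩
  rw [integral_const_mul, integral_add' ((hu1.add hw1).add (hz.const_mul _)) (hy.const_mul _),
    integral_add' (hu1.add hw1) (hz.const_mul _), integral_add' hu1 hw1, integral_const_mul,
    integral_const_mul]
  gcongr

end Problem

/-! ### Coupled recursions for the gap and the warm-start errors -/

section Errors

variable {dx dy : ℕ} {Ξ : Type*} [MeasurableSpace Ξ] (p : Problem dx dy Ξ) (a : Params)
  {Ω : Type*} (ξ : Sample → Ω → Ξ) (init : Ω → State dx dy)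

/-- The squared error of the inner output `y_k`. -/
def sqY (k : ℕ) (ω : Ω) : ℝ := ‖yRV p a ξ init k ω - p.yStar (xRV p a ξ init k ω)‖ ^ 2

/-- The squared error of the warm start for `y_k`. -/
def sqY₀ (k : ℕ) (ω : Ω) : ℝ := ‖yIt p a ξ init k 0 ω - p.yStar (xRV p a ξ init k ω)‖ ^ 2

/-- The squared error of the inner output `z_k`. -/
def sqZ (k : ℕ) (ω : Ω) : ℝ :=
  ‖zRV p a ξ init k ω - p.zStar (xRV p a ξ init k ω) (yRV p a ξ init k ω)‖ ^ 2

/-- The squared error of the warm start for `z_k`. -/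
def sqZ₀ (k : ℕ) (ω : Ω) : ℝ :=
  ‖zIt p a ξ init k 0 ω - p.zStar (xRV p a ξ init k ω) (yRV p a ξ init k ω)‖ ^ 2

/-- The squared norm of the gradient of the bilevel objective at `x_k`. -/
def sqGrad (k : ℕ) (ω : Ω) : ℝ :=
  ‖p.hyperGrad (xRV p a ξ init k ω) (p.yStar (xRV p a ξ init k ω))‖ ^ 2

/-- The squared error of the stochastic hypergradient at `x_k`. -/
def sqErr (k : ℕ) (ω : Ω) : ℝ :=
  ‖uRV p a ξ init k ω + wRV p a ξ init k ω
    - p.hyperGrad (xRV p a ξ init k ω) (p.yStar (xRV p a ξ init k ω))‖ ^ 2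

/-- The optimality gap of the bilevel objective at `x_k`. -/
def gapRV (k : ℕ) (ω : Ω) : ℝ := p.loss (xRV p a ξ init k ω) - p.lossInf

end Errors

namespace Problem

variable {dx dy : ℕ} {Ξ : Type*} [MeasurableSpace Ξ] {p : Problem dx dy Ξ} {a : Params}
  {Ω : Type*} [mΩ : MeasurableSpace Ω] {P : Measure Ω} {ξ : Sample → Ω → Ξ}
  {init : Ω → State dx dy} {μg Lg Lg' Lf Mg B σf σg σgxy σgyy : ℝ}

omit mΩ in
theorem sq_norm_xRV_sub_le (k : ℕ) (ω : Ω) :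
    ‖xRV p a ξ init (k + 1) ω - xRV p a ξ init k ω‖ ^ 2
      ≤ a.γ ^ 2 * (2 * sqGrad p a ξ init k ω + 2 * sqErr p a ξ init k ω) := by
  rw [xRV_succ, sub_sub_cancel_left, norm_neg, norm_smul, mul_pow, Real.norm_eq_abs, sq_abs]
  refine mul_le_mul_of_nonneg_left ?_ (sq_nonneg _)
  have := sq_norm_add_le (p.hyperGrad (xRV p a ξ init k ω) (p.yStar (xRV p a ξ init k ω)))
    (uRV p a ξ init k ω + wRV p a ξ init k ω
      - p.hyperGrad (xRV p a ξ init k ω) (p.yStar (xRV p a ξ init k ω)))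
  rwa [add_sub_cancel] at this

omit mΩ in
theorem gapRV_nonneg (hb : BddBelow (Set.range p.loss)) (k : ℕ) (ω : Ω) :
    0 ≤ gapRV p a ξ init k ω :=
  sub_nonneg.2 (ciInf_le hb _)

theorem Assumptions.measurable_gapRV (A : p.Assumptions μg Lg Lg' Lf Mg B σf σg σgxy σgyy)
    (hμ : 0 < μg) (hS : Sampling p P ξ init) (k : ℕ) : Measurable (gapRV p a ξ init k) :=
  (A.measurable_loss hμ (A.measurable_xRV hS k)).sub measurable_const

theorem Assumptions.measurable_sqGrad (A : p.Assumptions μg Lg Lg' Lf Mg B σf σg σgxy σgyy)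
    (hμ : 0 < μg) (hL' : 0 ≤ Lg') (hS : Sampling p P ξ init) (k : ℕ) :
    Measurable (sqGrad p a ξ init k) :=
  (A.measurable_hyperGrad hμ hL' (A.measurable_xRV hS k)
    (A.measurable_yStar hμ (A.measurable_xRV hS k))).norm.pow_const 2

theorem Assumptions.integrable_sqGrad (A : p.Assumptions μg Lg Lg' Lf Mg B σf σg σgxy σgyy)
    (hμ : 0 < μg) (hL' : 0 ≤ Lg') (hc : 0 ≤ hyperConst μg Lg' Lf Mg B)
    (hsc : 0 < smoothConst μg Lg' Lf Mg B) (hb : BddBelow (Set.range p.loss))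
    (hS : Sampling p P ξ init) (k : ℕ) (h : Integrable (gapRV p a ξ init k) P) :
    Integrable (sqGrad p a ξ init k) P :=
  (integrable_and_integral_le_of_le (A.measurable_sqGrad hμ hL' hS k) (fun _ => sq_nonneg _)
    (h.const_mul (2 * smoothConst μg Lg' Lf Mg B)) fun _ =>
      sq_norm_gradient_le hsc (A.hasGradientAt_loss hμ)
        (A.norm_hyperGrad_yStar_sub_le hμ hL' hc) (fun _ => ciInf_le hb _) _).1

omit mΩ in
-- With γ = 1/L the descent lemma leaves -γ⟪G, ψ⟫ + (γ/2)‖ψ‖², which equals (γ/2)(‖ψ - G‖² - ‖G‖²).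
-- The inequality is pathwise and asks nothing of the direction ψ.
theorem Assumptions.gapRV_succ_le (A : p.Assumptions μg Lg Lg' Lf Mg B σf σg σgxy σgyy)
    (hμ : 0 < μg) (hL' : 0 ≤ Lg') (hc : 0 ≤ hyperConst μg Lg' Lf Mg B)
    (hsc : 0 < smoothConst μg Lg' Lf Mg B) (hγ : a.γ = (smoothConst μg Lg' Lf Mg B)⁻¹)
    (k : ℕ) (ω : Ω) : gapRV p a ξ init (k + 1) ω ≤ gapRV p a ξ init k ω
      - a.γ / 2 * sqGrad p a ξ init k ω + a.γ / 2 * sqErr p a ξ init k ω := by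
  have h1 := le_add_inner_add_sq_of_lipschitz_gradient (A.hasGradientAt_loss hμ)
    (A.norm_hyperGrad_yStar_sub_le hμ hL' hc) (xRV p a ξ init k ω)
    (-(a.γ • (uRV p a ξ init k ω + wRV p a ξ init k ω)))
  simp only [gapRV, xRV_succ, sqGrad, sqErr]
  rw [← sub_eq_add_neg] at h1
  set G := p.hyperGrad (xRV p a ξ init k ω) (p.yStar (xRV p a ξ init k ω))
  set ψ := uRV p a ξ init k ω + wRV p a ξ init k ω
  rw [norm_neg, norm_smul, inner_neg_right, inner_smul_right, Real.norm_eq_abs, mul_pow,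
    sq_abs] at h1
  have h2 := norm_sub_sq_real ψ G
  rw [real_inner_comm] at h2
  have h3 : smoothConst μg Lg' Lf Mg B / 2 * (a.γ ^ 2 * ‖ψ‖ ^ 2) = a.γ / 2 * ‖ψ‖ ^ 2 := by
    rw [hγ]; field_simp
  rw [h2]
  linarith

theorem Assumptions.integral_gapRV_succ_le
    (A : p.Assumptions μg Lg Lg' Lf Mg B σf σg σgxy σgyy)
    (hμ : 0 < μg) (hL' : 0 ≤ Lg') (hc : 0 ≤ hyperConst μg Lg' Lf Mg B)
    (hsc : 0 < smoothConst μg Lg' Lf Mg B) (hγ : a.γ = (smoothConst μg Lg' Lf Mg B)⁻¹)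
    (hb : BddBelow (Set.range p.loss)) (hS : Sampling p P ξ init)
    (k : ℕ) (hg : Integrable (gapRV p a ξ init k) P) (hh : Integrable (sqGrad p a ξ init k) P)
    (he : Integrable (sqErr p a ξ init k) P) :
    Integrable (gapRV p a ξ init (k + 1)) P ∧ ∫ ω, gapRV p a ξ init (k + 1) ω ∂P
      ≤ ∫ ω, gapRV p a ξ init k ω ∂P - a.γ / 2 * ∫ ω, sqGrad p a ξ init k ω ∂P
        + a.γ / 2 * ∫ ω, sqErr p a ξ init k ω ∂P := by
  have hI := (hg.sub (hh.const_mul (a.γ / 2))).add (he.const_mul (a.γ / 2))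
  obtain ⟨h1, h2⟩ := integrable_and_integral_le_of_le (A.measurable_gapRV (a := a) hμ hS (k + 1))
    (gapRV_nonneg hb (k + 1)) hI (A.gapRV_succ_le hμ hL' hc hsc hγ k)
  refine ⟨h1, h2.trans_eq ?_⟩
  rw [integral_add' (hg.sub (hh.const_mul _)) (he.const_mul _), integral_sub' hg (hh.const_mul _),
    integral_const_mul, integral_const_mul]

/-- The loop restarts from y_k, so its initial error is the preceding output error plus the
displacement of y⋆ caused by the outer step. -/
theorem Assumptions.integral_sqY₀_succ_le
    (A : p.Assumptions μg Lg Lg' Lf Mg B σf σg σgxy σgyy) (hμ : 0 < μg)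
    (hS : Sampling p P ξ init) (k : ℕ) (hy : Integrable (sqY p a ξ init k) P)
    (hh : Integrable (sqGrad p a ξ init k) P) (he : Integrable (sqErr p a ξ init k) P) :
    Integrable (sqY₀ p a ξ init (k + 1)) P ∧ ∫ ω, sqY₀ p a ξ init (k + 1) ω ∂P
      ≤ 2 * ∫ ω, sqY p a ξ init k ω ∂P + 2 * (μg⁻¹ * Lg') ^ 2 * (a.γ ^ 2 *
        (2 * ∫ ω, sqGrad p a ξ init k ω ∂P + 2 * ∫ ω, sqErr p a ξ init k ω ∂P)) := by
  have hI := (hy.const_mul 2).add ((((hh.const_mul 2).add (he.const_mul 2)).const_mul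
    (a.γ ^ 2)).const_mul (2 * (μg⁻¹ * Lg') ^ 2))
  obtain ⟨h1, h2⟩ := integrable_and_integral_le_of_le (F := sqY₀ p a ξ init (k + 1))
    (((A.measurable_yIt hS (k + 1) 0).sub
      (A.measurable_yStar hμ (A.measurable_xRV hS (k + 1)))).norm.pow_const 2)
    (fun _ => sq_nonneg _) hI (fun ω => by
      have h3 := sq_norm_add_le (yRV p a ξ init k ω - p.yStar (xRV p a ξ init k ω))
        (p.yStar (xRV p a ξ init k ω) - p.yStar (xRV p a ξ init (k + 1) ω))
      have h4 := pow_le_pow_left₀ (norm_nonneg _)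
        (A.norm_yStar_sub_le hμ (xRV p a ξ init k ω) (xRV p a ξ init (k + 1) ω)) 2
      have h5 := sq_norm_xRV_sub_le (p := p) (a := a) (ξ := ξ) (init := init) k ω
      have h6 := mul_le_mul_of_nonneg_left h5 (sq_nonneg (μg⁻¹ * Lg'))
      rw [mul_pow, norm_sub_rev (xRV p a ξ init k ω)] at h4
      rw [sub_add_sub_cancel] at h3
      simp only [sqY₀, yIt_zero_succ, Pi.add_apply]
      change _ ≤ 2 * ‖yRV p a ξ init k ω - p.yStar (xRV p a ξ init k ω)‖ ^ 2 + _
      linarith)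
  refine ⟨h1, h2.trans_eq ?_⟩
  rw [integral_add' (hy.const_mul _) ((((hh.const_mul 2).add (he.const_mul 2)).const_mul
    (a.γ ^ 2)).const_mul (2 * (μg⁻¹ * Lg') ^ 2)), integral_const_mul, integral_const_mul,
    integral_const_mul, integral_add' (hh.const_mul 2) (he.const_mul 2), integral_const_mul,
    integral_const_mul]

theorem Assumptions.integral_sqZ₀_succ_le
    (A : p.Assumptions μg Lg Lg' Lf Mg B σf σg σgxy σgyy) (hμ : 0 < μg)
    (hS : Sampling p P ξ init) (k : ℕ) (hz : Integrable (sqZ p a ξ init k) P)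
    (hh : Integrable (sqGrad p a ξ init k) P) (he : Integrable (sqErr p a ξ init k) P)
    (hy : Integrable (sqY p a ξ init (k + 1)) P)
    (hy₀ : Integrable (sqY₀ p a ξ init (k + 1)) P) :
    Integrable (sqZ₀ p a ξ init (k + 1)) P ∧ ∫ ω, sqZ₀ p a ξ init (k + 1) ω ∂P
      ≤ 2 * ∫ ω, sqZ p a ξ init k ω ∂P + 2 * (μg⁻¹ * (Lf + Mg * (μg⁻¹ * B))) ^ 2 * (a.γ ^ 2 *
        (2 * ∫ ω, sqGrad p a ξ init k ω ∂P + 2 * ∫ ω, sqErr p a ξ init k ω ∂P)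
          + (2 * ∫ ω, sqY p a ξ init (k + 1) ω ∂P
            + 2 * ∫ ω, sqY₀ p a ξ init (k + 1) ω ∂P)) := by
  set ℓ := μg⁻¹ * (Lf + Mg * (μg⁻¹ * B))
  have hI1 := ((hh.const_mul 2).add (he.const_mul 2)).const_mul (a.γ ^ 2)
  have hI2 := (hy.const_mul 2).add (hy₀.const_mul 2)
  have hI := (hz.const_mul 2).add ((hI1.add hI2).const_mul (2 * ℓ ^ 2))
  obtain ⟨h1, h2⟩ := integrable_and_integral_le_of_le (F := sqZ₀ p a ξ init (k + 1))
    (((A.measurable_zIt hS (k + 1) 0).sub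
      (A.measurable_zStar hμ (A.measurable_xRV hS (k + 1))
        (A.measurable_yRV hS (k + 1)))).norm.pow_const 2)
    (fun _ => sq_nonneg _) hI (fun ω => by
      have h3 := sq_norm_add_le
        (zRV p a ξ init k ω - p.zStar (xRV p a ξ init k ω) (yRV p a ξ init k ω))
        (p.zStar (xRV p a ξ init k ω) (yRV p a ξ init k ω)
          - p.zStar (xRV p a ξ init (k + 1) ω) (yRV p a ξ init (k + 1) ω))
      rw [norm_sub_rev (p.zStar (xRV p a ξ init k ω) (yRV p a ξ init k ω))] at h3
      have h4 := pow_le_pow_left₀ (norm_nonneg _)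
        (A.norm_zStar_sub_le hμ (xRV p a ξ init (k + 1) ω) (xRV p a ξ init k ω)
          (yRV p a ξ init (k + 1) ω) (yRV p a ξ init k ω)) 2
      rw [mul_pow, sq_pairNorm] at h4
      have h5 := sq_norm_xRV_sub_le (p := p) (a := a) (ξ := ξ) (init := init) k ω
      -- As z⋆ also depends on y, the move from y_k to y_{k+1} counts. Both points are compared with
      -- y⋆(x_{k+1}), which yields the output and the warm-start errors of the new y-loop.
      have h7 := sq_norm_sub_le (yRV p a ξ init (k + 1) ω - p.yStar (xRV p a ξ init (k + 1) ω))
        (yRV p a ξ init k ω - p.yStar (xRV p a ξ init (k + 1) ω))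
      rw [sub_sub_sub_cancel_right] at h7
      have h6 := mul_le_mul_of_nonneg_left (add_le_add h5 h7) (sq_nonneg ℓ)
      rw [sub_add_sub_cancel] at h3
      simp only [sqZ₀, zIt_zero_succ, Pi.add_apply, sqY, sqY₀, yIt_zero_succ]
      change _ ≤ 2 * ‖zRV p a ξ init k ω
        - p.zStar (xRV p a ξ init k ω) (yRV p a ξ init k ω)‖ ^ 2 + _
      linarith)
  refine ⟨h1, h2.trans_eq ?_⟩
  rw [integral_add' (hz.const_mul _) ((hI1.add hI2).const_mul _), integral_const_mul,
    integral_const_mul, integral_add' hI1 hI2, integral_const_mul,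
    integral_add' (hh.const_mul 2) (he.const_mul 2), integral_const_mul,
    integral_const_mul, integral_add' (hy.const_mul 2) (hy₀.const_mul 2), integral_const_mul,
    integral_const_mul]

/-- All the errors have a finite expectation. -/
theorem Assumptions.integrable_errors (A : p.Assumptions μg Lg Lg' Lf Mg B σf σg σgxy σgyy)
    (hμ : 0 < μg) (hL : 0 < Lg) (hμL : μg ≤ Lg) (hL' : 0 ≤ Lg')
    (hc : 0 ≤ hyperConst μg Lg' Lf Mg B) (hsc : 0 < smoothConst μg Lg' Lf Mg B)
    (hb : BddBelow (Set.range p.loss)) (hS : Sampling p P ξ init)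
    (hα : a.α = Lg⁻¹) (hβ : a.β = (2 * Lg)⁻¹) (hγ : a.γ = (smoothConst μg Lg' Lf Mg B)⁻¹)
    (hng : 1 ≤ a.ng) (hngyy : 1 ≤ a.ngyy) (hngxy : 1 ≤ a.ngxy) (hnf : 1 ≤ a.nf)
    (hσ : 2 * (2 * Lg)⁻¹ ^ 2 * (σgyy ^ 2 / a.ngyy) ≤ (2 * Lg)⁻¹ * μg / 2)
    (h0 : Integrable (gapRV p a ξ init 0) P) (hy0 : Integrable (sqY₀ p a ξ init 0) P)
    (hz0 : Integrable (sqZ₀ p a ξ init 0) P) (k : ℕ) :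
    Integrable (gapRV p a ξ init k) P ∧ Integrable (sqY₀ p a ξ init k) P ∧
      Integrable (sqZ₀ p a ξ init k) P ∧ Integrable (sqY p a ξ init k) P ∧
      Integrable (sqZ p a ξ init k) P ∧ Integrable (sqGrad p a ξ init k) P ∧
      Integrable (sqErr p a ξ init k) P := by
  -- The gap and the two warm-start errors determine the rest: the loops give the output errors, and
  -- smoothness of ℒ bounds the squared gradient by the gap.
  have inner : ∀ k, Integrable (gapRV p a ξ init k) P → Integrable (sqY₀ p a ξ init k) P →
      Integrable (sqZ₀ p a ξ init k) P → Integrable (sqY p a ξ init k) P ∧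
      Integrable (sqZ p a ξ init k) P ∧ Integrable (sqGrad p a ξ init k) P ∧
      Integrable (sqErr p a ξ init k) P := by
    intro k hg hy hz
    have h1 := (A.integral_sq_norm_yRV hμ hL hμL hS hα hng k hy).1
    have h2 := (A.integral_sq_norm_zRV hμ hL hμL hS hβ hngyy hnf hσ k hz).1
    exact ⟨h1, h2, A.integrable_sqGrad hμ hL' hc hsc hb hS k hg,
      (A.integral_sq_norm_hyperGrad_error hμ hL' hS hngxy hnf k h1 h2).1⟩
  induction k with
  | zero => exact ⟨h0, hy0, hz0, inner 0 h0 hy0 hz0⟩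
  | succ k ih =>
    obtain ⟨hg, hy₀, hz₀, hy, hz, hh, he⟩ := ih
    have h1 := (A.integral_gapRV_succ_le hμ hL' hc hsc hγ hb hS k hg hh he).1
    have h2 := (A.integral_sqY₀_succ_le hμ hS k hy hh he).1
    have h3 := (A.integral_sq_norm_yRV hμ hL hμL hS hα hng (k + 1) h2).1
    have h4 := (A.integral_sqZ₀_succ_le hμ hS k hz hh he h3 h2).1
    exact ⟨h1, h2, h4, inner (k + 1) h1 h2 h4⟩

end Problem

/-! ### Powers of the condition number and the deterministic recursions -/

section Constants

/-- All the constants of the problem are bounded by a multiple of a power of the condition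
number. -/
theorem exists_condition_bound {Lg Lg' Lf Mg B εmax : ℝ} (hLg : 0 < Lg) (hLg' : 0 < Lg')
    (hLf : 0 < Lf) (hMg : 0 < Mg) (hB : 0 < B) (hεmax : 0 < εmax) :
    ∃ K : ℝ, 1 ≤ K ∧ Lg⁻¹ ≤ K ∧ Lg' ≤ K ∧ εmax ≤ K ∧ ∀ μg κ : ℝ, 0 < μg → μg ≤ Lg → κ = Lg / μg →
      0 ≤ Problem.hyperConst μg Lg' Lf Mg B ∧ 0 < smoothConst μg Lg' Lf Mg B ∧
      μg⁻¹ * Lg' ≤ K * κ ∧ μg⁻¹ * (Lf + Mg * (μg⁻¹ * B)) ≤ K * κ ^ 2 ∧ μg⁻¹ * B ≤ K * κ ∧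
      Problem.hyperConst μg Lg' Lf Mg B ≤ K * κ ^ 2 ∧ smoothConst μg Lg' Lf Mg B ≤ K * κ ^ 3 ∧
      (smoothConst μg Lg' Lf Mg B)⁻¹ ≤ K := by
  set i := Lg⁻¹ with hi
  have hi0 : 0 < i := by positivity
  set M := Lf + i ^ 2 * Lg' * Mg * B + i * (Lg' * Lf + Mg * B) with hM
  have hM0 : 0 < M := by positivity
  -- Substituting μ⁻¹ = κ/L_g makes every constant a polynomial in κ with coefficients free of μ. K
  -- is the sum of all the quantities to be dominated; Lf⁻¹ is included because L ≥ L_f bounds the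
  -- outer step.
  set K := 1 + i + Lg' + εmax + i * Lg' + (i * Lf + Mg * B * i ^ 2) + i * B + M
    + M * (1 + i * Lg') + Lf⁻¹ with hK
  have p1 : 0 < i * Lg' := by positivity
  have p2 : 0 < i * Lf + Mg * B * i ^ 2 := by positivity
  have p3 : 0 < i * B := by positivity
  have p4 : 0 < M * (1 + i * Lg') := by positivity
  have p5 : 0 < Lf⁻¹ := by positivity
  refine ⟨K, by linarith, by linarith, by linarith, by linarith, ?_⟩
  intro μg κ hμ hμL hκ
  have hκ1 : 1 ≤ κ := by rw [hκ, one_le_div hμ]; exact hμL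
  have hμi : μg⁻¹ = κ * i := by rw [hκ, hi]; field_simp
  have hκ0 : 0 ≤ κ := by linarith
  have hκ2 : κ ≤ κ ^ 2 := by nlinarith
  have hκ12 : 1 ≤ κ ^ 2 := by nlinarith
  have e1 : Problem.hyperConst μg Lg' Lf Mg B
      = Lf + i ^ 2 * Lg' * Mg * B * κ ^ 2 + i * (Lg' * Lf + Mg * B) * κ := by
    rw [Problem.hyperConst, hμi]; ring
  have hH : Problem.hyperConst μg Lg' Lf Mg B ≤ M * κ ^ 2 := by
    rw [e1, hM]
    have h1 : Lf ≤ Lf * κ ^ 2 := le_mul_of_one_le_right hLf.le hκ12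
    have h2 : i * (Lg' * Lf + Mg * B) * κ ≤ i * (Lg' * Lf + Mg * B) * κ ^ 2 :=
      mul_le_mul_of_nonneg_left hκ2 (by positivity)
    linarith
  have hHL : Lf ≤ Problem.hyperConst μg Lg' Lf Mg B := by
    rw [e1]
    have h1 : 0 ≤ i ^ 2 * Lg' * Mg * B * κ ^ 2 := by positivity
    have h2 : 0 ≤ i * (Lg' * Lf + Mg * B) * κ := by positivity
    linarith
  have e2 : smoothConst μg Lg' Lf Mg B = Problem.hyperConst μg Lg' Lf Mg B * (1 + i * Lg' * κ) := by
    rw [smoothConst, Problem.hyperConst, hμi]; ring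
  have hSL : Lf ≤ smoothConst μg Lg' Lf Mg B := by
    rw [e2]
    exact hHL.trans (le_mul_of_one_le_right (hLf.le.trans hHL)
      (by have : 0 ≤ i * Lg' * κ := by positivity
          linarith))
  have hKM : M ≤ K := by linarith
  refine ⟨hLf.le.trans hHL, hLf.trans_le hSL, ?_, ?_, ?_, ?_, ?_, ?_⟩
  · rw [hμi]
    nlinarith [mul_le_mul_of_nonneg_right (by linarith : i * Lg' ≤ K) hκ0]
  · have h1 : μg⁻¹ * (Lf + Mg * (μg⁻¹ * B)) = i * Lf * κ + Mg * B * i ^ 2 * κ ^ 2 := by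
      rw [hμi]; ring
    have h2 : i * Lf * κ ≤ i * Lf * κ ^ 2 := mul_le_mul_of_nonneg_left hκ2 (by positivity)
    have h3 := mul_le_mul_of_nonneg_right (by linarith : i * Lf + Mg * B * i ^ 2 ≤ K)
      (sq_nonneg κ)
    linarith
  · rw [hμi]
    nlinarith [mul_le_mul_of_nonneg_right (by linarith : i * B ≤ K) hκ0]
  · exact hH.trans (mul_le_mul_of_nonneg_right hKM (by positivity))
  · rw [e2]
    have h1 : 1 + i * Lg' * κ ≤ (1 + i * Lg') * κ := by linarith
    have h2 := mul_le_mul hH h1 (by positivity) (by positivity)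
    have h3 := mul_le_mul_of_nonneg_right (by linarith : M * (1 + i * Lg') ≤ K)
      (by positivity : 0 ≤ κ ^ 3)
    calc _ ≤ _ := h2
      _ = M * (1 + i * Lg') * κ ^ 3 := by ring
      _ ≤ _ := h3
  · exact (inv_anti₀ hLf hSL).trans (by linarith)

theorem one_sub_pow_le_exp {q x : ℝ} (hq : q ≤ 1) {n : ℕ} (hn : x ≤ n * q) :
    (1 - q) ^ n ≤ Real.exp (-x) := by
  calc (1 - q) ^ n ≤ Real.exp (-q) ^ n :=
        pow_le_pow_left₀ (by linarith) (Real.one_sub_le_exp_neg q) n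
    _ = Real.exp (-(n * q)) := by rw [← Real.exp_nat_mul]; ring_nf
    _ ≤ Real.exp (-x) := Real.exp_le_exp.2 (by linarith)

/-- The exponential is e^{-c/4} κ^{-c/4}: from c = 24 on, its power of κ cancels κ⁶, and e^{-c/4} ≤
4/c is as small as desired. This is the purpose of the factor 1 + log κ in the number of inner
steps. -/
theorem pow_mul_exp_le {κ c : ℝ} (hκ : 1 ≤ κ) (hc : 24 ≤ c) :
    κ ^ 6 * Real.exp (-(c / 4 * (1 + Real.log κ))) ≤ 4 / c := by
  have hκ0 : 0 < κ := by linarith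
  have hl := Real.log_nonneg hκ
  have h1 : κ ^ 6 = Real.exp (6 * Real.log κ) := by
    rw [mul_comm, Real.exp_mul, Real.exp_log hκ0]; norm_cast
  rw [h1, ← Real.exp_add]
  have h2 : Real.exp (6 * Real.log κ + -(c / 4 * (1 + Real.log κ))) ≤ Real.exp (-(c / 4)) :=
    Real.exp_le_exp.2 (by nlinarith)
  refine h2.trans ?_
  rw [Real.exp_neg, show 4 / c = (c / 4)⁻¹ from (inv_div c 4).symm]
  exact inv_anti₀ (by positivity) (by linarith [Real.add_one_le_exp (c / 4)])

/-- The contraction of the inner errors over one outer iteration. -/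
theorem inner_error_recursion {K κ ρ S a b h e A' B' a' b' γ ℓy ℓz : ℝ} (hK : 1 ≤ K) (hκ : 1 ≤ κ)
    (hρ : 0 ≤ ρ) (hρ1 : ρ ≤ 1) (hS : 0 ≤ S) (ha : 0 ≤ a) (hb : 0 ≤ b) (hh : 0 ≤ h) (he : 0 ≤ e)
    (hA0 : 0 ≤ A') (ha'0 : 0 ≤ a')
    (hγ : 0 ≤ γ) (hγK : γ ≤ K) (hℓy : 0 ≤ ℓy) (hℓyK : ℓy ≤ K * κ) (hℓz : 0 ≤ ℓz)
    (hℓzK : ℓz ≤ K * κ ^ 2)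
    (hA : A' ≤ 2 * a + 2 * ℓy ^ 2 * (γ ^ 2 * (2 * h + 2 * e)))
    (hB : B' ≤ 2 * b + 2 * ℓz ^ 2 * (γ ^ 2 * (2 * h + 2 * e) + (2 * a' + 2 * A')))
    (ha' : κ ^ 4 * a' ≤ ρ * (κ ^ 4 * A') + K ^ 2 * S) (hb' : b' ≤ ρ * B' + 6 * K ^ 4 * S)
    (hek : e ≤ 12 * K ^ 2 * (κ ^ 4 * a + b + S)) :
    κ ^ 4 * a' + b' ≤ 546 * K ^ 8 * κ ^ 6 * ρ * (κ ^ 4 * a + b + h + S) + 7 * K ^ 4 * S := by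
  have hK0 : 0 ≤ K := by linarith
  have hκ0 : 0 ≤ κ := by linarith
  have hγ2 : γ ^ 2 ≤ K ^ 2 := pow_le_pow_left₀ hγ hγK 2
  have hy2 : ℓy ^ 2 ≤ K ^ 2 * κ ^ 2 := by
    rw [← mul_pow]; exact pow_le_pow_left₀ hℓy hℓyK 2
  have hz2 : ℓz ^ 2 ≤ K ^ 2 * κ ^ 4 := by
    calc ℓz ^ 2 ≤ (K * κ ^ 2) ^ 2 := pow_le_pow_left₀ hℓz hℓzK 2
      _ = K ^ 2 * κ ^ 4 := by ring
  have hκ4 : 1 ≤ κ ^ 4 := one_le_pow₀ hκ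
  set W := κ ^ 4 * a + b with hW
  have hκa : 0 ≤ κ ^ 4 * a := by positivity
  have hD : γ ^ 2 * (2 * h + 2 * e) ≤ 2 * K ^ 2 * (h + e) := by
    nlinarith [mul_le_mul_of_nonneg_right hγ2 (by positivity : 0 ≤ 2 * h + 2 * e)]
  set X := K ^ 6 * κ ^ 6 with hX
  have hX1 : 1 ≤ X := one_le_mul_of_one_le_of_one_le (one_le_pow₀ hK) (one_le_pow₀ hκ)
  have hX2 : K ^ 4 * κ ^ 6 ≤ X :=
    mul_le_mul_of_nonneg_right (pow_le_pow_right₀ hK (by norm_num)) (by positivity)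
  have hX3 : K ^ 4 * κ ^ 4 ≤ X :=
    mul_le_mul (pow_le_pow_right₀ hK (by norm_num)) (pow_le_pow_right₀ hκ (by norm_num))
      (by positivity) (by positivity)
  have hA2 : κ ^ 4 * A' ≤ 2 * (κ ^ 4 * a) + 4 * (K ^ 4 * κ ^ 6) * (h + e) := by
    have h1 : ℓy ^ 2 * (γ ^ 2 * (2 * h + 2 * e)) ≤ (K ^ 2 * κ ^ 2) * (2 * K ^ 2 * (h + e)) :=
      mul_le_mul hy2 hD (by positivity) (by positivity)
    have h2 : A' ≤ 2 * a + 2 * ((K ^ 2 * κ ^ 2) * (2 * K ^ 2 * (h + e))) := by linarith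
    calc κ ^ 4 * A' ≤ κ ^ 4 * (2 * a + 2 * ((K ^ 2 * κ ^ 2) * (2 * K ^ 2 * (h + e)))) :=
          mul_le_mul_of_nonneg_left h2 (by positivity)
      _ = _ := by ring
  have hA3 : κ ^ 4 * A' ≤ 4 * (K ^ 4 * κ ^ 6) * (W + h + e) := by
    have h1 : 1 ≤ K ^ 4 * κ ^ 6 :=
      one_le_mul_of_one_le_of_one_le (one_le_pow₀ hK) (one_le_pow₀ hκ)
    have h2 : κ ^ 4 * a ≤ K ^ 4 * κ ^ 6 * W :=
      (by linarith : κ ^ 4 * a ≤ W).trans (le_mul_of_one_le_left (by positivity) h1)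
    linarith [mul_nonneg (zero_le_one.trans h1) (by positivity : 0 ≤ W)]
  -- The new output error of y is eliminated in favour of its warm-start error, since ρ ≤ 1 ≤ κ⁴.
  have haA : a' ≤ A' + K ^ 2 * S := by
    have h1 : ρ * (κ ^ 4 * A') ≤ κ ^ 4 * A' := mul_le_of_le_one_left (by positivity) hρ1
    have h2 : K ^ 2 * S ≤ κ ^ 4 * (K ^ 2 * S) := le_mul_of_one_le_left (by positivity) hκ4
    have h3 : κ ^ 4 * a' ≤ κ ^ 4 * (A' + K ^ 2 * S) := by linarith
    exact le_of_mul_le_mul_left h3 (by positivity)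
  have hB2 : B' ≤ 2 * b + 4 * (K ^ 4 * κ ^ 4) * (h + e) + 8 * K ^ 2 * (κ ^ 4 * A')
      + 4 * (K ^ 4 * κ ^ 4) * S := by
    have h1 : γ ^ 2 * (2 * h + 2 * e) + (2 * a' + 2 * A')
        ≤ 2 * K ^ 2 * (h + e) + (4 * A' + 2 * (K ^ 2 * S)) := by linarith
    have h2 := mul_le_mul hz2 h1 (by positivity) (by positivity)
    calc B' ≤ 2 * b + 2 * ((K ^ 2 * κ ^ 4)
          * (2 * K ^ 2 * (h + e) + (4 * A' + 2 * (K ^ 2 * S)))) := by linarith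
      _ = _ := by ring
  have hB3 : 8 * K ^ 2 * (κ ^ 4 * A') ≤ 32 * X * (W + h + e) := by
    calc 8 * K ^ 2 * (κ ^ 4 * A') ≤ 8 * K ^ 2 * (4 * (K ^ 4 * κ ^ 6) * (W + h + e)) :=
          mul_le_mul_of_nonneg_left hA3 (by positivity)
      _ = _ := by rw [hX]; ring
  have hsum : κ ^ 4 * A' + B' ≤ 42 * X * (W + h + e) + 4 * X * S := by
    have h1 := mul_le_mul_of_nonneg_right hX2 (by positivity : 0 ≤ W + h + e)
    have h2 := mul_le_mul_of_nonneg_right hX3 (by positivity : 0 ≤ h + e)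
    have h3 := mul_le_mul_of_nonneg_right hX3 hS
    have h4 : b ≤ X * W := (by linarith : b ≤ W).trans (le_mul_of_one_le_left (by positivity) hX1)
    have h5 : 0 ≤ X * W := by positivity
    have h6 : 0 ≤ X * (h + e) := by positivity
    linarith
  -- Inserting e ≤ 12K²(W + S) produces 546 = 42(1 + 12).
  have hfin : 42 * X * (W + h + e) + 4 * X * S ≤ 546 * (K ^ 2 * X) * (W + h + S) := by
    have hK2 : 1 ≤ K ^ 2 := one_le_pow₀ hK
    have h1 := mul_le_mul_of_nonneg_left hek (by positivity : 0 ≤ X)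
    have h2 : X * (W + h + S) ≤ K ^ 2 * X * (W + h + S) := by
      rw [mul_assoc (K ^ 2)]
      exact le_mul_of_one_le_left (by positivity) hK2
    have h3 : 0 ≤ K ^ 2 * X * h := by positivity
    have h4 : 0 ≤ X * S := by positivity
    have h5 : 0 ≤ K ^ 2 * X * S := by positivity
    have h6 : X * S ≤ K ^ 2 * X * S := by
      rw [mul_assoc (K ^ 2)]
      exact le_mul_of_one_le_left (by positivity) hK2
    have h7 : 0 ≤ K ^ 2 * X * W := by positivity
    linarith
  have hr := mul_le_mul_of_nonneg_left (hsum.trans hfin) hρ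
  have hKS : K ^ 2 * S ≤ K ^ 4 * S :=
    mul_le_mul_of_nonneg_right (pow_le_pow_right₀ hK (by norm_num)) hS
  have e1 : ρ * (546 * (K ^ 2 * X) * (W + h + S)) = 546 * K ^ 8 * κ ^ 6 * ρ * (W + h + S) := by
    rw [hX]; ring
  linarith

/-- The bound on the average squared gradient norm from the recursions for the errors. -/
theorem sum_sq_gradient_le {K η S E₀ D : ℝ} {W h e G : ℕ → ℝ} (hK : 1 ≤ K) (hη : 0 ≤ η)
    (hηK : 48 * K ^ 2 * η ≤ 1) (hS : 0 ≤ S) (hD : 0 < D) (hE₀ : 0 ≤ E₀)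
    (hG0 : ∀ k, 0 ≤ G k) (hG : ∀ k, G (k + 1) ≤ G k - D⁻¹ / 2 * h k + D⁻¹ / 2 * e k)
    (he : ∀ k, e k ≤ 12 * K ^ 2 * (W k + S)) (hW : ∀ k, 0 ≤ W k) (hh : ∀ k, 0 ≤ h k)
    (hW0 : W 0 ≤ η * E₀ + 7 * K ^ 4 * S)
    (hWs : ∀ k, W (k + 1) ≤ η * (W k + h k + S) + 7 * K ^ 4 * S) (n : ℕ) :
    ∑ i ∈ Finset.range n, h i ≤ 4 * D * G 0 + E₀ + 408 * K ^ 6 * n * S := by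
  have hK2 : 1 ≤ K ^ 2 := one_le_pow₀ hK
  have hη1 : 48 * η ≤ 1 := by nlinarith
  have hK4 : 1 ≤ K ^ 4 := one_le_pow₀ hK
  have hKS : S ≤ K ^ 4 * S := le_mul_of_one_le_left hS hK4
  have h1 : ∀ n : ℕ, ∑ i ∈ Finset.range (n + 1), W i ≤ η * E₀
      + η * (∑ i ∈ Finset.range n, W i + ∑ i ∈ Finset.range n, h i) + 8 * K ^ 4 * (n + 1) * S := by
    intro n
    induction n with
    | zero => simp; nlinarith
    | succ n ih =>
      have h2 := hWs n
      have h3 : η * S ≤ S := mul_le_of_le_one_left hS (by linarith)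
      rw [Finset.sum_range_succ]
      conv_rhs => rw [Finset.sum_range_succ W, Finset.sum_range_succ h]
      push_cast
      nlinarith
  -- As η ≤ 1/2, the sum of W on the right of `h1` is absorbed, at the cost of a factor 2.
  have h2 : ∑ i ∈ Finset.range n, W i ≤ 2 * η * (E₀ + ∑ i ∈ Finset.range n, h i)
      + 16 * K ^ 4 * n * S := by
    have hh0 : ∀ m : ℕ, 0 ≤ ∑ i ∈ Finset.range m, h i := fun m => Finset.sum_nonneg fun i _ => hh i
    rcases n with _ | n
    · simp; positivity
    · have hw : ∑ i ∈ Finset.range n, W i ≤ ∑ i ∈ Finset.range (n + 1), W i := by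
        rw [Finset.sum_range_succ]; linarith [hW n]
      have hhh : ∑ i ∈ Finset.range n, h i ≤ ∑ i ∈ Finset.range (n + 1), h i := by
        rw [Finset.sum_range_succ]; linarith [hh n]
      have hw0 : 0 ≤ ∑ i ∈ Finset.range (n + 1), W i := Finset.sum_nonneg fun i _ => hW i
      have h3 := h1 n
      have h4 := mul_le_mul_of_nonneg_left (add_le_add hw hhh) hη
      have h5 : η * ∑ i ∈ Finset.range (n + 1), W i ≤ 1 / 2 * ∑ i ∈ Finset.range (n + 1), W i :=
        mul_le_mul_of_nonneg_right (by linarith) hw0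
      push_cast
      linarith
  have h3 : ∑ i ∈ Finset.range n, e i ≤ 12 * K ^ 2 * (∑ i ∈ Finset.range n, W i + n * S) := by
    calc _ ≤ ∑ i ∈ Finset.range n, 12 * K ^ 2 * (W i + S) := Finset.sum_le_sum fun i _ => he i
      _ = _ := by rw [← Finset.mul_sum, Finset.sum_add_distrib]; simp
  have h4 : ∑ i ∈ Finset.range n, h i ≤ 2 * D * (G 0 - G n) + ∑ i ∈ Finset.range n, e i := by
    clear h2 h3
    induction n with
    | zero => simp
    | succ n ih =>
      rw [Finset.sum_range_succ, Finset.sum_range_succ]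
      have h5 := mul_le_mul_of_nonneg_left (hG n) hD.le
      have h6 : D * (G n - D⁻¹ / 2 * h n + D⁻¹ / 2 * e n) = D * G n - h n / 2 + e n / 2 := by
        field_simp
      linarith
  have h5 : 0 ≤ ∑ i ∈ Finset.range n, h i := Finset.sum_nonneg fun i _ => hh i
  -- The sum of h enters ∑ e with coefficient 24K²η ≤ 1/2 and is absorbed. Doubling the rest gives
  -- 4D G₀ + E₀ and 408 = 2(192 + 12).
  have h6 := mul_le_mul_of_nonneg_left h2 (by positivity : 0 ≤ 12 * K ^ 2)
  have h7 := mul_le_mul_of_nonneg_right hηK (add_nonneg hE₀ h5)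
  have h8 : K ^ 2 * (n * S) ≤ K ^ 6 * (n * S) :=
    mul_le_mul_of_nonneg_right (pow_le_pow_right₀ hK (by norm_num)) (by positivity)
  have h9 : 0 ≤ D * G n := mul_nonneg hD.le (hG0 n)
  have h10 : 12 * K ^ 2 * (16 * K ^ 4 * n * S) = 192 * K ^ 6 * n * S := by ring
  nlinarith

end Constants

/-! ### Bounds with explicit powers of κ, and the summed gradient bound -/

namespace Problem

variable {dx dy : ℕ} {Ξ : Type*} [MeasurableSpace Ξ] {p : Problem dx dy Ξ} {a : Params}
  {Ω : Type*} [mΩ : MeasurableSpace Ω] {P : Measure Ω} {ξ : Sample → Ω → Ξ}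
  {init : Ω → State dx dy} {μg Lg Lg' Lf Mg B σf σg σgxy σgyy : ℝ}

/-- The floor of the y-loop is L_g⁻² κ σ_g²/n; with the weight κ⁴ this is where the fifth power of κ
in the batch size comes from. -/
theorem Assumptions.pow_mul_integral_sqY_le
    (A : p.Assumptions μg Lg Lg' Lf Mg B σf σg σgxy σgyy) (hμ : 0 < μg) (hL : 0 < Lg)
    (hμL : μg ≤ Lg) (hS : Sampling p P ξ init) (hα : a.α = Lg⁻¹) (hn : 1 ≤ a.ng) {κ K S r : ℝ}
    (hκ : κ = Lg / μg) (hK : Lg⁻¹ ≤ K) (hsg : κ ^ 5 * (σg ^ 2 / a.ng) ≤ S)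
    (hT : κ * r ≤ a.T) (k : ℕ) (h : Integrable (sqY₀ p a ξ init k) P) :
    κ ^ 4 * ∫ ω, sqY p a ξ init k ω ∂P
      ≤ Real.exp (-r) * (κ ^ 4 * ∫ ω, sqY₀ p a ξ init k ω ∂P) + K ^ 2 * S := by
  have hκ0 : 0 < κ := by rw [hκ]; positivity
  have hq : Lg⁻¹ * μg = κ⁻¹ := by rw [hκ]; field_simp
  have h1 := (A.integral_sq_norm_yRV hμ hL hμL hS hα hn k h).2
  change ∫ ω, sqY p a ξ init k ω ∂P ≤ (1 - Lg⁻¹ * μg) ^ a.T * ∫ ω, sqY₀ p a ξ init k ω ∂P + _ at h1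
  have h2 : (1 - Lg⁻¹ * μg) ^ a.T ≤ Real.exp (-r) :=
    one_sub_pow_le_exp (by rwa [inv_mul_le_iff₀ hL, mul_one])
      (by rw [hq, ← div_eq_mul_inv, le_div_iff₀ hκ0]; linarith)
  have h3 : 0 ≤ ∫ ω, sqY₀ p a ξ init k ω ∂P := integral_nonneg fun _ => sq_nonneg _
  have h4 : κ ^ 4 * (Lg⁻¹ ^ 2 * (σg ^ 2 / a.ng) / (Lg⁻¹ * μg))
      = Lg⁻¹ ^ 2 * (κ ^ 5 * (σg ^ 2 / a.ng)) := by
    rw [hq]; field_simp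
  have h5 : Lg⁻¹ ^ 2 * (κ ^ 5 * (σg ^ 2 / a.ng)) ≤ K ^ 2 * S :=
    mul_le_mul (pow_le_pow_left₀ (by positivity) hK 2) hsg (by positivity) (by positivity)
  have h6 := mul_le_mul_of_nonneg_left (h1.trans (add_le_add_left
    (mul_le_mul_of_nonneg_right h2 h3) _)) (by positivity : 0 ≤ κ ^ 4)
  rw [mul_add, h4] at h6
  linarith

/-- With rate 1/(4κ), the floor is of order κ²σ_f²/n + κ(B/μ)²σ_gyy²/n. As B/μ is of order κ, this
explains the powers κ² and κ³ in the two batch sizes. -/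
theorem Assumptions.integral_sqZ_le
    (A : p.Assumptions μg Lg Lg' Lf Mg B σf σg σgxy σgyy) (hμ : 0 < μg) (hL : 0 < Lg)
    (hμL : μg ≤ Lg) (hS : Sampling p P ξ init) (hβ : a.β = (2 * Lg)⁻¹) (hn : 1 ≤ a.ngyy)
    (hnf : 1 ≤ a.nf)
    (hσ : 2 * (2 * Lg)⁻¹ ^ 2 * (σgyy ^ 2 / a.ngyy) ≤ (2 * Lg)⁻¹ * μg / 2) {κ K S r : ℝ}
    (hκ : κ = Lg / μg) (hK1 : 1 ≤ K) (hK : Lg⁻¹ ≤ K) (hB : 0 ≤ B) (hKB : μg⁻¹ * B ≤ K * κ)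
    (hsyy : κ ^ 3 * (σgyy ^ 2 / a.ngyy) ≤ S) (hsf : κ ^ 2 * (σf ^ 2 / a.nf) ≤ S)
    (hN : 4 * κ * r ≤ a.N) (k : ℕ) (h : Integrable (sqZ₀ p a ξ init k) P) :
    ∫ ω, sqZ p a ξ init k ω ∂P
      ≤ Real.exp (-r) * ∫ ω, sqZ₀ p a ξ init k ω ∂P + 6 * K ^ 4 * S := by
  have hκ0 : 0 < κ := by rw [hκ]; positivity
  have hq : (2 * Lg)⁻¹ * μg / 2 = (4 * κ)⁻¹ := by rw [hκ]; field_simp; norm_num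
  have hμi : μg⁻¹ = Lg⁻¹ * κ := by rw [hκ]; field_simp
  have h1 := (A.integral_sq_norm_zRV hμ hL hμL hS hβ hn hnf hσ k h).2
  change ∫ ω, sqZ p a ξ init k ω ∂P
    ≤ (1 - (2 * Lg)⁻¹ * μg / 2) ^ a.N * ∫ ω, sqZ₀ p a ξ init k ω ∂P + _ at h1
  have h2 : (1 - (2 * Lg)⁻¹ * μg / 2) ^ a.N ≤ Real.exp (-r) :=
    one_sub_pow_le_exp
      (by
        have : (2 * Lg)⁻¹ * μg ≤ 1 := by rw [inv_mul_le_iff₀ (by positivity)]; linarith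
        linarith)
      (by rw [hq, ← div_eq_mul_inv, le_div_iff₀ (by positivity)]; linarith)
  have h3 : 0 ≤ ∫ ω, sqZ₀ p a ξ init k ω ∂P := integral_nonneg fun _ => sq_nonneg _
  have hS0 : 0 ≤ S := le_trans (by positivity) hsf
  have hi0 : 0 < Lg⁻¹ := by positivity
  have h4 : (2 * (2 * Lg)⁻¹ / μg * (σf ^ 2 / a.nf)
      + 2 * (2 * Lg)⁻¹ ^ 2 * (σgyy ^ 2 / a.ngyy) * (μg⁻¹ * B) ^ 2) / ((2 * Lg)⁻¹ * μg / 2)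
      = 4 * (Lg⁻¹ ^ 2 * (κ ^ 2 * (σf ^ 2 / a.nf)))
        + 2 * (Lg⁻¹ ^ 2 * (κ * (σgyy ^ 2 / a.ngyy) * (μg⁻¹ * B) ^ 2)) := by
    rw [hq, div_eq_mul_inv _ μg, hμi]
    field_simp
    ring
  have h5 : Lg⁻¹ ^ 2 * (κ ^ 2 * (σf ^ 2 / a.nf)) ≤ K ^ 2 * S :=
    mul_le_mul (pow_le_pow_left₀ hi0.le hK 2) hsf (by positivity) (by positivity)
  have h6 : κ * (σgyy ^ 2 / a.ngyy) * (μg⁻¹ * B) ^ 2 ≤ K ^ 2 * S := by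
    calc κ * (σgyy ^ 2 / a.ngyy) * (μg⁻¹ * B) ^ 2
        ≤ κ * (σgyy ^ 2 / a.ngyy) * (K * κ) ^ 2 :=
          mul_le_mul_of_nonneg_left (pow_le_pow_left₀ (by positivity) hKB 2) (by positivity)
      _ = K ^ 2 * (κ ^ 3 * (σgyy ^ 2 / a.ngyy)) := by ring
      _ ≤ K ^ 2 * S := mul_le_mul_of_nonneg_left hsyy (by positivity)
  have h7 : Lg⁻¹ ^ 2 * (κ * (σgyy ^ 2 / a.ngyy) * (μg⁻¹ * B) ^ 2) ≤ K ^ 2 * (K ^ 2 * S) :=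
    mul_le_mul (pow_le_pow_left₀ hi0.le hK 2) h6 (by positivity) (by positivity)
  have h8 : K ^ 2 * S ≤ K ^ 4 * S :=
    mul_le_mul_of_nonneg_right (pow_le_pow_right₀ hK1 (by norm_num)) hS0
  rw [h4] at h1
  have h9 := mul_le_mul_of_nonneg_right h2 h3
  have h10 : K ^ 2 * (K ^ 2 * S) = K ^ 4 * S := by ring
  linarith

/-- The noise of w is proportional to ‖z‖². Its fixed part, of order (B/μ)², calls for the power κ²
in the batch size; its part in z - z⋆ is absorbed by S ≤ K. -/
theorem Assumptions.integral_sqErr_le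
    (A : p.Assumptions μg Lg Lg' Lf Mg B σf σg σgxy σgyy) (hμ : 0 < μg) (hL' : 0 ≤ Lg')
    (hS : Sampling p P ξ init) (hn : 1 ≤ a.ngxy) (hnf : 1 ≤ a.nf) {κ K S : ℝ} (hκ : 1 ≤ κ)
    (hK1 : 1 ≤ K) (hKL' : Lg' ≤ K) (hB : 0 ≤ B) (hKB : μg⁻¹ * B ≤ K * κ)
    (hc : 0 ≤ hyperConst μg Lg' Lf Mg B) (hKc : hyperConst μg Lg' Lf Mg B ≤ K * κ ^ 2)
    (hSK : S ≤ K) (hsxy : κ ^ 2 * (σgxy ^ 2 / a.ngxy) ≤ S) (hsf : κ ^ 2 * (σf ^ 2 / a.nf) ≤ S)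
    (k : ℕ) (hy : Integrable (sqY p a ξ init k) P) (hz : Integrable (sqZ p a ξ init k) P) :
    ∫ ω, sqErr p a ξ init k ω ∂P
      ≤ 12 * K ^ 2 * (κ ^ 4 * ∫ ω, sqY p a ξ init k ω ∂P + ∫ ω, sqZ p a ξ init k ω ∂P + S) := by
  have h1 := (A.integral_sq_norm_hyperGrad_error hμ hL' hS hn hnf k hy hz).2
  change ∫ ω, sqErr p a ξ init k ω ∂P ≤ 4 * (σf ^ 2 / a.nf
    + σgxy ^ 2 / a.ngxy * (2 * ∫ ω, sqZ p a ξ init k ω ∂P + 2 * (μg⁻¹ * B) ^ 2)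
    + Lg' ^ 2 * ∫ ω, sqZ p a ξ init k ω ∂P
    + hyperConst μg Lg' Lf Mg B ^ 2 * ∫ ω, sqY p a ξ init k ω ∂P) at h1
  have hy0 : 0 ≤ ∫ ω, sqY p a ξ init k ω ∂P := integral_nonneg fun _ => sq_nonneg _
  have hz0 : 0 ≤ ∫ ω, sqZ p a ξ init k ω ∂P := integral_nonneg fun _ => sq_nonneg _
  set y := ∫ ω, sqY p a ξ init k ω ∂P
  set z := ∫ ω, sqZ p a ξ init k ω ∂P
  have hκ2 : 1 ≤ κ ^ 2 := one_le_pow₀ hκ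
  have hK2 : 1 ≤ K ^ 2 := one_le_pow₀ hK1
  have hKK : K ≤ K ^ 2 := by nlinarith
  have hS0 : 0 ≤ S := le_trans (by positivity) hsf
  have h2 : σf ^ 2 / a.nf ≤ S := (le_mul_of_one_le_left (by positivity) hκ2).trans hsf
  have h3 : σgxy ^ 2 / a.ngxy ≤ S := (le_mul_of_one_le_left (by positivity) hκ2).trans hsxy
  have h4 : σgxy ^ 2 / a.ngxy * (μg⁻¹ * B) ^ 2 ≤ K ^ 2 * S := by
    calc σgxy ^ 2 / a.ngxy * (μg⁻¹ * B) ^ 2 ≤ σgxy ^ 2 / a.ngxy * (K * κ) ^ 2 :=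
          mul_le_mul_of_nonneg_left (pow_le_pow_left₀ (by positivity) hKB 2) (by positivity)
      _ = K ^ 2 * (κ ^ 2 * (σgxy ^ 2 / a.ngxy)) := by ring
      _ ≤ K ^ 2 * S := mul_le_mul_of_nonneg_left hsxy (by positivity)
  have h5 : σgxy ^ 2 / a.ngxy * z ≤ K ^ 2 * z :=
    mul_le_mul_of_nonneg_right (by linarith) hz0
  have h6 : Lg' ^ 2 * z ≤ K ^ 2 * z :=
    mul_le_mul_of_nonneg_right (pow_le_pow_left₀ hL' hKL' 2) hz0
  have h7 : hyperConst μg Lg' Lf Mg B ^ 2 * y ≤ K ^ 2 * (κ ^ 4 * y) := by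
    calc _ ≤ (K * κ ^ 2) ^ 2 * y := mul_le_mul_of_nonneg_right (pow_le_pow_left₀ hc hKc 2) hy0
      _ = _ := by ring
  have h8 : S ≤ K ^ 2 * S := le_mul_of_one_le_left hS0 hK2
  have h9 : 0 ≤ K ^ 2 * (κ ^ 4 * y) := by positivity
  linarith

theorem Assumptions.sum_integral_sqGrad_le
    (A : p.Assumptions μg Lg Lg' Lf Mg B σf σg σgxy σgyy)
    (hμ : 0 < μg) (hL : 0 < Lg) (hμL : μg ≤ Lg) (hL' : 0 ≤ Lg') (hLf : 0 ≤ Lf) (hMg : 0 ≤ Mg)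
    (hB : 0 ≤ B) (hc : 0 ≤ hyperConst μg Lg' Lf Mg B) (hsc : 0 < smoothConst μg Lg' Lf Mg B)
    (hb : BddBelow (Set.range p.loss)) (hS : Sampling p P ξ init)
    (hα : a.α = Lg⁻¹) (hβ : a.β = (2 * Lg)⁻¹) (hγ : a.γ = (smoothConst μg Lg' Lf Mg B)⁻¹)
    (hng : 1 ≤ a.ng) (hngyy : 1 ≤ a.ngyy) (hngxy : 1 ≤ a.ngxy) (hnf : 1 ≤ a.nf)
    (hσ : 2 * (2 * Lg)⁻¹ ^ 2 * (σgyy ^ 2 / a.ngyy) ≤ (2 * Lg)⁻¹ * μg / 2)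
    {κ K S c : ℝ} (hκ : κ = Lg / μg) (hK1 : 1 ≤ K) (hKi : Lg⁻¹ ≤ K) (hKL' : Lg' ≤ K)
    (hKy : μg⁻¹ * Lg' ≤ K * κ) (hKz : μg⁻¹ * (Lf + Mg * (μg⁻¹ * B)) ≤ K * κ ^ 2)
    (hKB : μg⁻¹ * B ≤ K * κ) (hKc : hyperConst μg Lg' Lf Mg B ≤ K * κ ^ 2)
    (hKγ : (smoothConst μg Lg' Lf Mg B)⁻¹ ≤ K)
    (hSK : S ≤ K) (hsg : κ ^ 5 * (σg ^ 2 / a.ng) ≤ S)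
    (hsyy : κ ^ 3 * (σgyy ^ 2 / a.ngyy) ≤ S) (hsxy : κ ^ 2 * (σgxy ^ 2 / a.ngxy) ≤ S)
    (hsf : κ ^ 2 * (σf ^ 2 / a.nf) ≤ S) (hcK : 200000 * K ^ 10 ≤ c)
    (hT : c * (κ * (1 + Real.log κ)) ≤ a.T) (hN : c * (κ * (1 + Real.log κ)) ≤ a.N)
    (h0 : Integrable (gapRV p a ξ init 0) P) (hy0 : Integrable (sqY₀ p a ξ init 0) P)
    (hz0 : Integrable (sqZ₀ p a ξ init 0) P) (n : ℕ) :
    ∑ i ∈ Finset.range n, ∫ ω, sqGrad p a ξ init i ω ∂P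
      ≤ 4 * smoothConst μg Lg' Lf Mg B * ∫ ω, gapRV p a ξ init 0 ω ∂P
        + (∫ ω, sqY₀ p a ξ init 0 ω ∂P + ∫ ω, sqZ₀ p a ξ init 0 ω ∂P) + 408 * K ^ 6 * n * S := by
  have hint := A.integrable_errors hμ hL hμL hL' hc hsc hb hS hα hβ hγ hng hngyy hngxy hnf hσ
    h0 hy0 hz0
  have hκ1 : 1 ≤ κ := by rw [hκ, one_le_div hμ]; exact hμL
  have hκ0 : 0 < κ := by linarith
  have hlog := Real.log_nonneg hκ1
  have hK10 : 1 ≤ K ^ 10 := one_le_pow₀ hK1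
  have hc0 : 0 < c := by linarith
  have hS0 : 0 ≤ S := le_trans (by positivity) hsf
  set r := c / 4 * (1 + Real.log κ) with hr
  have hr0 : 0 ≤ r := by positivity
  set ρ := Real.exp (-r) with hρ
  have hρ0 : 0 ≤ ρ := (Real.exp_pos _).le
  have hρ1 : ρ ≤ 1 := Real.exp_le_one_iff.2 (by linarith)
  have hY := fun k => A.pow_mul_integral_sqY_le hμ hL hμL hS hα hng hκ hKi hsg (r := r)
    (by rw [hr]; nlinarith [mul_nonneg hκ0.le (by positivity : 0 ≤ c * (1 + Real.log κ))]) k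
    (hint k).2.1
  have hZ := fun k => A.integral_sqZ_le hμ hL hμL hS hβ hngyy hnf hσ hκ hK1 hKi hB hKB hsyy hsf
    (r := r) (by rw [hr]; linarith) k (hint k).2.2.1
  have hE := fun k => A.integral_sqErr_le hμ hL' hS hngxy hnf hκ1 hK1 hKL' hB hKB hc hKc hSK hsxy
    hsf k (hint k).2.2.2.1 (hint k).2.2.2.2.1
  -- The size of c is settled here: 48 · 546 · 4 = 104832 must not exceed c/K¹⁰.
  have hη : 48 * K ^ 2 * (546 * K ^ 8 * κ ^ 6 * ρ) ≤ 1 := by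
    have h1 := pow_mul_exp_le hκ1 (by linarith : 24 ≤ c)
    have h2 : 48 * K ^ 2 * (546 * K ^ 8 * κ ^ 6 * ρ) = 26208 * K ^ 10 * (κ ^ 6 * ρ) := by ring
    rw [h2]
    calc 26208 * K ^ 10 * (κ ^ 6 * ρ) ≤ 26208 * K ^ 10 * (4 / c) :=
          mul_le_mul_of_nonneg_left h1 (by positivity)
      _ = 104832 * K ^ 10 / c := by ring
      _ ≤ 1 := by rw [div_le_one hc0]; linarith
  have hnn : ∀ F : Ω → ℝ, (∀ ω, 0 ≤ F ω) → 0 ≤ ∫ ω, F ω ∂P := fun F hF => integral_nonneg hF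
  have hA0 := fun k => hnn (sqY₀ p a ξ init k) fun _ => sq_nonneg _
  have hB0 := fun k => hnn (sqZ₀ p a ξ init k) fun _ => sq_nonneg _
  have ha0 := fun k => hnn (sqY p a ξ init k) fun _ => sq_nonneg _
  have hb0 := fun k => hnn (sqZ p a ξ init k) fun _ => sq_nonneg _
  have hh0 := fun k => hnn (sqGrad p a ξ init k) fun _ => sq_nonneg _
  have he0 := fun k => hnn (sqErr p a ξ init k) fun _ => sq_nonneg _
  have hγ0 : 0 ≤ a.γ := by rw [hγ]; positivity
  refine sum_sq_gradient_le (η := 546 * K ^ 8 * κ ^ 6 * ρ)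
    (W := fun k => κ ^ 4 * ∫ ω, sqY p a ξ init k ω ∂P + ∫ ω, sqZ p a ξ init k ω ∂P)
    (h := fun k => ∫ ω, sqGrad p a ξ init k ω ∂P) (e := fun k => ∫ ω, sqErr p a ξ init k ω ∂P)
    (G := fun k => ∫ ω, gapRV p a ξ init k ω ∂P) hK1 (by positivity) hη hS0 hsc
    (add_nonneg (hA0 0) (hB0 0)) (fun k => hnn _ (gapRV_nonneg hb k)) (fun k => ?_) hE
    (fun k => add_nonneg (mul_nonneg (by positivity) (ha0 k)) (hb0 k)) hh0 ?_ (fun k => ?_) n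
  · obtain ⟨hg, -, -, -, -, hh, he⟩ := hint k
    rw [← hγ]
    exact (A.integral_gapRV_succ_le hμ hL' hc hsc hγ hb hS k hg hh he).2
  -- At the first iteration there is no preceding loop: the initial errors enter directly, with ρ ≤
  -- ρκ⁴ ≤ η.
  · have h1 := hY 0
    have h2 := hZ 0
    have hX : 1 ≤ 546 * K ^ 8 * κ ^ 2 := by
      have := one_le_mul_of_one_le_of_one_le (one_le_pow₀ hK1 : 1 ≤ K ^ 8)
        (one_le_pow₀ hκ1 : 1 ≤ κ ^ 2)
      linarith
    have h3 : ρ * κ ^ 4 ≤ 546 * K ^ 8 * κ ^ 6 * ρ := by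
      have h3 := mul_le_mul_of_nonneg_right hX (by positivity : 0 ≤ ρ * κ ^ 4)
      linarith
    have h4 : ρ ≤ ρ * κ ^ 4 := le_mul_of_one_le_right hρ0 (one_le_pow₀ hκ1)
    have h5 := mul_le_mul_of_nonneg_right h3 (hA0 0)
    have h6 := mul_le_mul_of_nonneg_right (h4.trans h3) (hB0 0)
    have h7 : K ^ 2 * S ≤ K ^ 4 * S :=
      mul_le_mul_of_nonneg_right (pow_le_pow_right₀ hK1 (by norm_num)) hS0
    linarith
  · obtain ⟨-, -, -, hy, hz, hh, he⟩ := hint k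
    obtain ⟨-, hy₀', -, hy', -, -, -⟩ := hint (k + 1)
    exact inner_error_recursion hK1 hκ1 hρ0 hρ1 hS0 (ha0 k) (hb0 k) (hh0 k) (he0 k)
      (hA0 (k + 1)) (ha0 (k + 1)) hγ0 (by rw [hγ]; exact hKγ) (by positivity) hKy (by positivity)
      hKz (A.integral_sqY₀_succ_le hμ hS k hy hh he).2
      (A.integral_sqZ₀_succ_le hμ hS k hz hh he hy' hy₀').2 (hY (k + 1)) (hZ (k + 1)) (hE k)

end Problem

/-! ### Complexity count -/

section Complexity

theorem div_natCast_le_of_le {c q ε : ℝ} {n : ℕ} (hc : 0 < c) (hε : 0 < ε) (hn : 1 ≤ n)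
    (h : c * (q / ε) ≤ n) : q / n ≤ ε / c := by
  have hn' : (0 : ℝ) < n := by exact_mod_cast hn
  rw [div_le_div_iff₀ hn' hc]
  rw [mul_div_assoc', div_le_iff₀ hε] at h
  linarith

/-- With q = κS/ε, S the noise level, the inner batches are O(q) and used in O(κ(1 + log κ)) steps,
while the outer batches are O(κq) and used once. So an outer iteration costs O(κq(1 + log κ)), four
terms with coefficient 2c'² each, and k contributes the third c'. -/
theorem complexity_le {a : Params} {κ ε μg σf σg σgxy σgyy c' D : ℝ} {k : ℕ} (hκ : 1 ≤ κ)
    (hε : 0 < ε) (hc' : 1 ≤ c') (hT : (a.T : ℝ) ≤ c' * (κ * (1 + Real.log κ)))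
    (hN : (a.N : ℝ) ≤ c' * (κ * (1 + Real.log κ)))
    (hng : (a.ng : ℝ) ≤ 1 + c' * (κ ^ 5 * σg ^ 2 / ε))
    (hngyy : (a.ngyy : ℝ) ≤ 1 + c' * (κ ^ 3 * σgyy ^ 2 / ε * max 1 (ε * μg ^ 2)))
    (hngxy : (a.ngxy : ℝ) ≤ 1 + c' * (κ ^ 2 * σgxy ^ 2 / ε))
    (hnf : (a.nf : ℝ) ≤ 1 + c' * (κ ^ 2 * σf ^ 2 / ε))
    (hk : (k : ℝ) ≤ c' * (κ ^ 3 / ε * D))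
    (hS : ε ≤ c' * κ * noiseLevel κ ε μg σf σg σgxy σgyy) :
    (complexity a k : ℝ) ≤ 8 * c' ^ 3 * (1 + Real.log κ) * (κ ^ 5 / ε ^ 2 *
      noiseLevel κ ε μg σf σg σgxy σgyy * D) := by
  set N := noiseLevel κ ε μg σf σg σgxy σgyy with hNdef
  have hm : 0 ≤ max 1 (ε * μg ^ 2) := zero_le_one.trans (le_max_left _ _)
  have hNe : N = κ ^ 4 * σg ^ 2 + κ ^ 2 * max 1 (ε * μg ^ 2) * σgyy ^ 2 + σgxy ^ 2 + σf ^ 2 := rfl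
  set m := max 1 (ε * μg ^ 2)
  have t1 : 0 ≤ κ ^ 4 * σg ^ 2 := by positivity
  have t2 : 0 ≤ κ ^ 2 * m * σgyy ^ 2 := by positivity
  have t3 : 0 ≤ σgxy ^ 2 := by positivity
  have t4 : 0 ≤ σf ^ 2 := by positivity
  have hN0 : 0 ≤ N := by rw [hNe]; positivity
  have hκ0 : 0 < κ := by linarith
  have hlog := Real.log_nonneg hκ
  set q := κ * N / ε with hq
  have hq0 : 0 ≤ q := by positivity
  -- The assumption ε ≤ c'κS serves here: the rounding term 1 in each batch size is absorbed by c'q.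
  have hq1 : 1 ≤ c' * q := by
    rw [hq, mul_div_assoc', le_div_iff₀ hε]; linarith
  have g1 : κ ^ 5 * σg ^ 2 / ε ≤ q := by
    rw [hq]; gcongr ?_ / ε
    calc κ ^ 5 * σg ^ 2 = κ * (κ ^ 4 * σg ^ 2) := by ring
      _ ≤ κ * N := mul_le_mul_of_nonneg_left (by linarith) hκ0.le
  have g2 : κ ^ 3 * σgyy ^ 2 / ε * m ≤ q := by
    calc κ ^ 3 * σgyy ^ 2 / ε * m = κ * (κ ^ 2 * m * σgyy ^ 2) / ε := by ring
      _ ≤ κ * N / ε := by gcongr; linarith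
  have g3 : κ ^ 2 * σgxy ^ 2 / ε ≤ κ * q := by
    calc κ ^ 2 * σgxy ^ 2 / ε ≤ κ ^ 2 * N / ε := by gcongr; linarith
      _ = κ * q := by rw [hq]; ring
  have g4 : κ ^ 2 * σf ^ 2 / ε ≤ κ * q := by
    calc κ ^ 2 * σf ^ 2 / ε ≤ κ ^ 2 * N / ε := by gcongr; linarith
      _ = κ * q := by rw [hq]; ring
  have hc0 : 0 ≤ c' := by linarith
  have b1 : (a.ng : ℝ) ≤ 2 * (c' * q) := by linarith [mul_le_mul_of_nonneg_left g1 hc0]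
  have b2 : (a.ngyy : ℝ) ≤ 2 * (c' * q) := by linarith [mul_le_mul_of_nonneg_left g2 hc0]
  have hqκ : c' * q ≤ c' * (κ * q) :=
    mul_le_mul_of_nonneg_left (le_mul_of_one_le_left hq0 hκ) hc0
  set l := 1 + Real.log κ
  have hl : 1 ≤ l := by linarith
  have hcl : 1 ≤ c' * l := one_le_mul_of_one_le_of_one_le hc' hl
  have hqc : c' * (κ * q) ≤ c' * l * (c' * (κ * q)) :=
    le_mul_of_one_le_left (by positivity) hcl
  have b3 : (a.ngxy : ℝ) ≤ 2 * (c' * l * (c' * (κ * q))) := by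
    linarith [mul_le_mul_of_nonneg_left g3 hc0]
  have b4 : (a.nf : ℝ) ≤ 2 * (c' * l * (c' * (κ * q))) := by
    linarith [mul_le_mul_of_nonneg_left g4 hc0]
  have b5 : (a.T : ℝ) * a.ng ≤ c' * (κ * l) * (2 * (c' * q)) :=
    mul_le_mul hT b1 (by positivity) (by positivity)
  have b6 : (a.N : ℝ) * a.ngyy ≤ c' * (κ * l) * (2 * (c' * q)) :=
    mul_le_mul hN b2 (by positivity) (by positivity)
  have b7 : (a.T : ℝ) * a.ng + a.N * a.ngyy + a.ngxy + a.nf ≤ 8 * (c' * l * (c' * (κ * q))) := by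
    linarith
  rw [complexity]
  push_cast
  calc (k : ℝ) * (a.T * a.ng + a.N * a.ngyy + a.ngxy + a.nf)
      ≤ c' * (κ ^ 3 / ε * D) * (8 * (c' * l * (c' * (κ * q)))) :=
        mul_le_mul hk b7 (by positivity) ((Nat.cast_nonneg k).trans hk)
    _ = _ := by rw [hq]; field_simp

end Complexity

end Amigo

end

/-! ### The main theorem -/

theorem corollary4 (Lg Lg' Lf Mg B εmax : ℝ) (hLg : 0 < Lg) (hLg' : 0 < Lg') (hLf : 0 < Lf)
    (hMg : 0 < Mg) (hB : 0 < B) (hεmax : 0 < εmax) :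
    ∃ c : ℝ, 0 < c ∧ ∀ c' : ℝ, c ≤ c' → ∃ C : ℝ, 0 < C ∧
      ∀ (dx dy : ℕ) (Ξ : Type*) [MeasurableSpace Ξ] (p : Amigo.Problem dx dy Ξ)
        (μg κ σf σg σgxy σgyy ε : ℝ),
        0 < μg → μg ≤ Lg → κ = Lg / μg →
        p.Assumptions μg Lg Lg' Lf Mg B σf σg σgxy σgyy →
        BddBelow (Set.range p.loss) →
        0 < ε → ε ≤ εmax →
      ∀ a : Amigo.Params,
        a.α = Lg⁻¹ → a.β = (2 * Lg)⁻¹ → a.γ = (Amigo.smoothConst μg Lg' Lf Mg B)⁻¹ →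
        Amigo.IsOrder c c' (κ * (1 + Real.log κ)) a.T →
        Amigo.IsOrder c c' (κ * (1 + Real.log κ)) a.N →
        Amigo.BatchOrder c c' (κ ^ 5 * σg ^ 2 / ε) a.ng →
        Amigo.BatchOrder c c' (κ ^ 3 * σgyy ^ 2 / ε * max 1 (ε * μg ^ 2)) a.ngyy →
        Amigo.BatchOrder c c' (κ ^ 2 * σgxy ^ 2 / ε) a.ngxy →
        Amigo.BatchOrder c c' (κ ^ 2 * σf ^ 2 / ε) a.nf →
      ∀ (Ω : Type*) [MeasurableSpace Ω] (P : MeasureTheory.Measure Ω)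
        (ξ : Amigo.Sample → Ω → Ξ) (init : Ω → Amigo.State dx dy),
        Amigo.Sampling p P ξ init →
        MeasureTheory.Integrable (fun ω => p.loss (init ω).x) P →
        MeasureTheory.Integrable (Amigo.errY p init) P →
        MeasureTheory.Integrable (Amigo.errZ p a ξ init) P →
      ∀ k : ℕ, 1 ≤ k → c * (κ ^ 3 / ε * Amigo.initGap p a P ξ init) ≤ k →
        (Differentiable ℝ p.loss ∧
          (∀ i ∈ Finset.Icc 1 k, MeasureTheory.Integrable
            (fun ω => ‖gradient p.loss (Amigo.runRV p a ξ init i ω).x‖ ^ 2) P) ∧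
          (1 / (k : ℝ)) * ∑ i ∈ Finset.Icc 1 k,
            ∫ ω, ‖gradient p.loss (Amigo.runRV p a ξ init i ω).x‖ ^ 2 ∂P ≤ ε) ∧
        ((k : ℝ) ≤ c' * (κ ^ 3 / ε * Amigo.initGap p a P ξ init) →
          ε ≤ c' * κ * Amigo.noiseLevel κ ε μg σf σg σgxy σgyy →
          (Amigo.complexity a k : ℝ) ≤ C * (1 + Real.log κ) * (κ ^ 5 / ε ^ 2 *
            Amigo.noiseLevel κ ε μg σf σg σgxy σgyy * Amigo.initGap p a P ξ init)) := by
  obtain ⟨K, hK1, hKi, hKL', hKε, hK⟩ :=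
    Amigo.exists_condition_bound hLg hLg' hLf hMg hB hεmax
  have hK0 : 0 < K := by linarith
  have hK10 : 1 ≤ K ^ 10 := one_le_pow₀ hK1
  refine ⟨200000 * K ^ 10, by positivity, fun c' hcc' => ⟨8 * c' ^ 3, ?_, ?_⟩⟩
  · have : 0 < c' := by linarith
    positivity
  intro dx dy Ξ _ p μg κ σf σg σgxy σgyy ε hμ hμL hκ A hb hε hεm a hα hβ hγ hT hN hng hngyy hngxy
    hnf Ω _ P ξ init hS hloss hy hz k hk1 hk
  obtain ⟨hc, hsc, hKy, hKz, hKB, hKc, hKs, hKγ⟩ := hK μg κ hμ hμL hκ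
  set c := 200000 * K ^ 10 with hcdef
  have hκ1 : 1 ≤ κ := by rw [hκ, one_le_div hμ]; exact hμL
  have hκ0 : 0 < κ := by linarith
  have hc1 : 1 ≤ c := by linarith
  have hc0 : 0 < c := by linarith
  have hprob := hS.prob
  refine ⟨?_, fun hk2 hεS => Amigo.complexity_le hκ1 hε (hc1.trans hcc') hT.2 hN.2 hng.2.2
    hngyy.2.2 hngxy.2.2 hnf.2.2 hk2 hεS⟩
  have hi0 : 0 < Lg⁻¹ := by positivity
  have hsg : κ ^ 5 * (σg ^ 2 / a.ng) ≤ ε / c := by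
    rw [mul_div_assoc']; exact Amigo.div_natCast_le_of_le hc0 hε hng.1 hng.2.1
  have hsxy : κ ^ 2 * (σgxy ^ 2 / a.ngxy) ≤ ε / c := by
    rw [mul_div_assoc']; exact Amigo.div_natCast_le_of_le hc0 hε hngxy.1 hngxy.2.1
  have hsf : κ ^ 2 * (σf ^ 2 / a.nf) ≤ ε / c := by
    rw [mul_div_assoc']; exact Amigo.div_natCast_le_of_le hc0 hε hnf.1 hnf.2.1
  have hq0 : 0 ≤ κ ^ 3 * σgyy ^ 2 / ε := by positivity
  have hsyy : κ ^ 3 * (σgyy ^ 2 / a.ngyy) ≤ ε / c := by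
    rw [mul_div_assoc']
    refine Amigo.div_natCast_le_of_le hc0 hε hngyy.1 (le_trans ?_ hngyy.2.1)
    exact mul_le_mul_of_nonneg_left (le_mul_of_one_le_right hq0 (le_max_left _ _)) hc0.le
  -- The branch ε μ² of the maximum is used here: it cancels ε, so that the Hessian batch keeps the
  -- z-loop contractive however large ε is. What remains is 2 ≤ c L_g⁴, which holds since K ≥ 1/L_g.
  have hσ : 2 * (2 * Lg)⁻¹ ^ 2 * (σgyy ^ 2 / a.ngyy) ≤ (2 * Lg)⁻¹ * μg / 2 := by
    have h1 : c * (κ ^ 3 * σgyy ^ 2 / ε * (ε * μg ^ 2)) ≤ a.ngyy := le_trans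
      (mul_le_mul_of_nonneg_left (mul_le_mul_of_nonneg_left (le_max_right _ _) hq0) hc0.le)
      hngyy.2.1
    have hμκ : μg = Lg / κ := by rw [hκ]; field_simp
    have hn : (0 : ℝ) < a.ngyy := by exact_mod_cast hngyy.1
    have h2 : c * (κ ^ 3 * σgyy ^ 2 / ε * (ε * μg ^ 2)) = c * Lg ^ 2 * κ * σgyy ^ 2 := by
      rw [hμκ]; field_simp
    have h3 : 2 ≤ c * Lg ^ 4 := by
      have h4 : Lg⁻¹ ^ 4 ≤ K ^ 10 :=
        (pow_le_pow_left₀ hi0.le hKi 4).trans (pow_le_pow_right₀ hK1 (by norm_num))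
      have h5 : 1 ≤ K ^ 10 * Lg ^ 4 := by
        rwa [inv_pow, inv_le_iff_one_le_mul₀ (by positivity)] at h4
      rw [hcdef]
      linarith
    rw [h2] at h1
    have h6 : 2 * κ * σgyy ^ 2 ≤ Lg ^ 2 * a.ngyy := by
      have h7 := mul_le_mul_of_nonneg_right h3 (by positivity : 0 ≤ κ * σgyy ^ 2)
      have h8 := mul_le_mul_of_nonneg_left h1 (by positivity : 0 ≤ Lg ^ 2)
      linarith
    have h9 : σgyy ^ 2 / a.ngyy ≤ Lg ^ 2 / (2 * κ) := by
      rw [div_le_div_iff₀ hn (by positivity)]; linarith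
    calc 2 * (2 * Lg)⁻¹ ^ 2 * (σgyy ^ 2 / a.ngyy)
        ≤ 2 * (2 * Lg)⁻¹ ^ 2 * (Lg ^ 2 / (2 * κ)) := by gcongr
      _ = (2 * Lg)⁻¹ * μg / 2 := by rw [hμκ]; field_simp
  have hgap : MeasureTheory.Integrable (Amigo.gapRV p a ξ init 0) P :=
    hloss.sub (MeasureTheory.integrable_const _)
  have hy0 : MeasureTheory.Integrable (Amigo.sqY₀ p a ξ init 0) P := hy
  have hz0 : MeasureTheory.Integrable (Amigo.sqZ₀ p a ξ init 0) P := hz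
  have hgrad : ∀ x, gradient p.loss x = p.hyperGrad x (p.yStar x) := fun x =>
    (A.hasGradientAt_loss hμ x).gradient
  simp only [hgrad]
  refine ⟨fun x => (A.hasGradientAt_loss hμ x).differentiableAt, fun i _ => ?_, ?_⟩
  · exact (A.integrable_errors hμ hLg hμL hLg'.le hc hsc hb hS hα hβ hγ hng.1 hngyy.1 hngxy.1 hnf.1
      hσ hgap hy0 hz0 i).2.2.2.2.2.1
  -- This bound on the noise level is where ε ≤ εmax is needed.
  · have hSK : ε / c ≤ K := (div_le_self hε.le hc1).trans (hεm.trans hKε)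
    have hsum := A.sum_integral_sqGrad_le hμ hLg hμL hLg'.le hLf.le hMg.le hB.le hc hsc hb hS hα
      hβ hγ hng.1 hngyy.1 hngxy.1 hnf.1 hσ hκ hK1 hKi hKL' hKy hKz hKB hKc hKγ hSK hsg hsyy hsxy
      hsf le_rfl hT.1 hN.1 hgap hy0 hz0 (k + 1)
    set D := Amigo.initGap p a P ξ init with hD
    -- Definitional: the y-component of the state of index 1 is y₀, so `errZ` is the warm-start
    -- error of the first z-loop.
    have hDe : D = ∫ ω, Amigo.gapRV p a ξ init 0 ω ∂P + ∫ ω, Amigo.sqY₀ p a ξ init 0 ω ∂P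
      + ∫ ω, Amigo.sqZ₀ p a ξ init 0 ω ∂P := rfl
    have hg0 : 0 ≤ ∫ ω, Amigo.gapRV p a ξ init 0 ω ∂P :=
      MeasureTheory.integral_nonneg (Amigo.Problem.gapRV_nonneg hb 0)
    have hA0 : 0 ≤ ∫ ω, Amigo.sqY₀ p a ξ init 0 ω ∂P :=
      MeasureTheory.integral_nonneg fun _ => sq_nonneg _
    have hB0 : 0 ≤ ∫ ω, Amigo.sqZ₀ p a ξ init 0 ω ∂P :=
      MeasureTheory.integral_nonneg fun _ => sq_nonneg _
    have hk0 : (1 : ℝ) ≤ k := by exact_mod_cast hk1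
    have hKκ : 1 ≤ K * κ ^ 3 := one_le_mul_of_one_le_of_one_le hK1 (one_le_pow₀ hκ1)
    have h1 : 4 * Amigo.smoothConst μg Lg' Lf Mg B * ∫ ω, Amigo.gapRV p a ξ init 0 ω ∂P
        + (∫ ω, Amigo.sqY₀ p a ξ init 0 ω ∂P + ∫ ω, Amigo.sqZ₀ p a ξ init 0 ω ∂P)
        ≤ 4 * (K * κ ^ 3) * D := by
      have h2 := mul_le_mul_of_nonneg_right hKs hg0
      have h3 := mul_le_mul_of_nonneg_right hKκ (add_nonneg hA0 hB0)
      rw [hDe]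
      linarith
    have h2 : κ ^ 3 * D ≤ ε / c * k := by
      rw [div_mul_eq_mul_div, le_div_iff₀ hc0]
      rw [div_mul_eq_mul_div, mul_div_assoc', div_le_iff₀ hε] at hk
      linarith
    -- The summed bound covers the iterates 0, …, k, hence its k + 1 terms; the nonnegative term of
    -- index 0 is dropped.
    have h3 : ∑ i ∈ Finset.Icc 1 k, ∫ ω, Amigo.sqGrad p a ξ init i ω ∂P
        ≤ ∑ i ∈ Finset.range (k + 1), ∫ ω, Amigo.sqGrad p a ξ init i ω ∂P :=
      Finset.sum_le_sum_of_subset_of_nonneg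
        (fun i hi => Finset.mem_range.2 (Nat.lt_succ_of_le (Finset.mem_Icc.1 hi).2))
        (fun i _ _ => MeasureTheory.integral_nonneg fun _ => sq_nonneg _)
    have hS0 : 0 < ε / c := by positivity
    have h4 : 4 * (K * κ ^ 3) * D ≤ 4 * K ^ 10 * (ε / c * k) := by
      have h5 : K ≤ K ^ 10 := le_self_pow₀ hK1 (by norm_num)
      calc 4 * (K * κ ^ 3) * D = 4 * K * (κ ^ 3 * D) := by ring
        _ ≤ 4 * K * (ε / c * k) := mul_le_mul_of_nonneg_left h2 (by positivity)
        _ ≤ 4 * K ^ 10 * (ε / c * k) := by gcongr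
    -- Here k + 1 ≤ 2k. Together with the 4 from the initial gap this makes 820K¹⁰ ≤ c.
    have h6 : 408 * K ^ 6 * ((k + 1 : ℕ) : ℝ) * (ε / c) ≤ 816 * K ^ 10 * (ε / c * k) := by
      have h7 : K ^ 6 ≤ K ^ 10 := pow_le_pow_right₀ hK1 (by norm_num)
      push_cast
      calc 408 * K ^ 6 * ((k : ℝ) + 1) * (ε / c) ≤ 408 * K ^ 10 * (2 * k) * (ε / c) := by
            gcongr; linarith
        _ = 816 * K ^ 10 * (ε / c * k) := by ring
    have h8 : 820 * K ^ 10 * (ε / c * k) ≤ ε * k := by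
      have h9 : 820 * K ^ 10 * (ε / c * k) = (820 * K ^ 10 / c) * (ε * k) := by ring
      rw [h9]
      refine mul_le_of_le_one_left (by positivity) ?_
      rw [div_le_one hc0, hcdef]
      linarith
    rw [one_div, inv_mul_le_iff₀ (by linarith)]
    change ∑ i ∈ Finset.Icc 1 k, ∫ ω, Amigo.sqGrad p a ξ init i ω ∂P ≤ _
    linarith
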